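/- Let $(g,\mu,J)$ be a driven cofactor system on a smooth manifold $M$ of dimension $m+n$. That is: $g$ is a Riemannian metric and $\mu=Q_\alpha\,dq^\alpha$ a smooth 1-form; $J$ is a smooth nonsingular type $(1,1)$ tensor field, symmetric with respect to $g$, with $J_{\alpha\beta|\gamma}=\frac12(\alpha_\alpha g_{\beta\gamma}+\alpha_\beta g_{\alpha\gamma})$ for some 1-form $\alpha$ (a special conformal Killing tensor), and $D_J\mu:=d_J\mu+d(\operatorname{tr}J)\wedge\mu=0$; and there is a smooth distribution $K$ of rank $n$ along $\tau:TM\to M$ with $\Phi(K)\subset K$, $\nabla K\subset K$, $D^V_ZK\subset K$ for all vector fields $Z$ along $\tau$, $d\mu(K,K)=0$ and $D^H\mu(K^\perp,K)\not\equiv 0$. Here $\Phi$, $\nabla$, $D^V$, $D^H$ are the Jacobi endomorphism, the dynamical covariant derivative and the vertical and horizontal covariant derivatives of the second-order field $\Gamma=v^\alpha\partial_{q^\alpha}+f^\alpha\partial_{v^\alpha}$, $f^\alpha=-\Gamma^\alpha_{\beta\gamma}v^\beta v^\gamma+g^{\alpha\beta}Q_\beta$. Let $\hat\Gamma$ be the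 push-forward of $\Gamma$ to $T^*M$ under $p_\alpha=g_{\alpha\beta}v^\beta$. For a type $(1,1)$ tensor $L$ let $$P_L=L^\alpha_\beta\,\partial_{p_\beta}\wedge\partial_{q^\alpha}-\tfrac12p_\gamma\left(\frac{\partial L^\gamma_\alpha}{\partial q^\beta}-\frac{\partial L^\gamma_\beta}{\partial q^\alpha}\right)\partial_{p_\alpha}\wedge\partial_{p_\beta},\qquad \{F,G\}_L=P_L(dF)(G).$$ Then $K$ is spanned by a distribution on $M$. Let $P_2$ be the $g$-orthogonal projection onto it. 1. $(J,P_2)$ is a cofactor pair: $P_2$ also satisfies the special conformal Killing condition with respect to $g$, and $D_{P_2}\mu=0$. The cofactor tensor of $J+aP_2$ is a polynomial $A(a)=\sum_{i=1}^{n+1}A_{(i)}a^{i-1}$ in $a$, and smooth functions $W_{(i)}$ with $A_{(i)}\mu=-dW_{(i)}$ exist on every convex coordinate domain. 2. Let $W_{(1)},\dots,W_{(n+1)}$ be any such functions on a coordinate domain. Put $H_{(i)}=\frac12A_{(i)}^{\alpha\beta}p_\alpha p_\beta+W_{(i)}$ and $H(a)=\sum_{i=1}^{n+1}H_{(i)}a^{i-1}$.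 Then $\det(J+aP_2)\,\hat\Gamma=P_{J+aP_2}(dH(a))$ for all $a\in\mathbb R$, every $H_{(i)}$ is a first integral of $\hat\Gamma$, and $\{H_{(i)},H_{(l)}\}_J=\{H_{(i)},H_{(l)}\}_{P_2}=0$ for all $i,l$. 3. In adapted coordinates $(y^i,x^a)$, i.e. $K=\operatorname{span}\{\partial_{x^a}\}$ and $K^\perp=\operatorname{span}\{\partial_{y^i}\}$, on a product domain $V\times\Omega$ with $\Omega$ connected, the $(y^i,p_i)$-components of $\hat\Gamma$ (the driving system) and the function $H_{(n+1)}$ depend on $(y,p_y)$ only. Along every solution $(y(t),p_y(t))$ of the driving system on an open time interval, the functions $(t,x,p_x)\mapsto H_{(i)}(y(t),x,p_y(t),p_x)$, $i=1,\dots,n$, are constant along the solutions of the driven system (the time-dependent system for $(x^a,p_a)$ obtained by inserting $(y(t),p_y(t))$ in $\hat\Gamma$), and for each $t$ they are in involution with respect to the standard Poisson bracket in the variables $(x^a,p_a)$. -/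

import Mathlib

open scoped Manifold ContDiff Polynomial Bundle

noncomputable section

namespace DrivenCofactor

/-! ### Calculus in one coordinate domain

Coordinates are indexed by a finite type `ι`. A point of `TM` or `T*M` over a coordinate domain is
a pair `(q, v)` or `(q, p)` of coordinate vectors. A type (1,1) tensor `J` is represented by the
matrices `J q` with `J q α β = J^α_β(q)`, the metric by `G q α β = g_{αβ}(q)`, a 1-form by its
components `Q q α = Q_α(q)`. -/

/-- The coordinate space. -/
abbrev Coord (ι : Type) := EuclideanSpace ℝ ι

section Local

variable {ι : Type} [Fintype ι] [DecidableEq ι]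

/-- The partial derivative `∂f/∂q^α`. -/
def pd (f : Coord ι → ℝ) (q : Coord ι) (α : ι) : ℝ :=
  fderiv ℝ f q (EuclideanSpace.single α 1)

/-- The Christoffel symbols `Γ^α_{βγ}` of the Levi-Civita connection of `G`. -/
def christoffel (G : Coord ι → Matrix ι ι ℝ) (q : Coord ι) (α β γ : ι) : ℝ :=
  (1 / 2) * ∑ δ, (G q)⁻¹ α δ *
    (pd (fun x => G x δ β) q γ + pd (fun x => G x δ γ) q β - pd (fun x => G x β γ) q δ)

/-- The covariant derivative `J^α_{β|γ}` of a type (1,1) tensor. -/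
def covDeriv (G J : Coord ι → Matrix ι ι ℝ) (q : Coord ι) (α β γ : ι) : ℝ :=
  pd (fun x => J x α β) q γ - (∑ σ, J q α σ * christoffel G q σ β γ)
    + ∑ σ, J q σ β * christoffel G q α σ γ

/-- `J` is symmetric with respect to `G` and satisfies
`J_{αβ|γ} = ½ (a_α g_{βγ} + a_β g_{αγ})` for some 1-form `a`: the condition on a special conformal
Killing tensor, on the coordinate domain `U`. -/
def IsSCKT (U : Set (Coord ι)) (G J : Coord ι → Matrix ι ι ℝ) : Prop :=
  (∀ q ∈ U, (G q * J q).IsSymm) ∧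
  ∃ a : Coord ι → ι → ℝ, ∀ q ∈ U, ∀ α β γ,
    ∑ ρ, G q α ρ * covDeriv G J q ρ β γ = (1 / 2) * (a q α * G q β γ + a q β * G q α γ)

/-- The components `(d_J Q)_{αβ}` of the 2-form `d_J Q`, where `d_J` is the derivation of degree 1
which anticommutes with `d` and has `d_J f = J(df)` on functions. -/
def dJ (J : Coord ι → Matrix ι ι ℝ) (Q : Coord ι → ι → ℝ) (q : Coord ι) (α β : ι) : ℝ :=
  (∑ σ, J q σ α * pd (fun x => Q x β) q σ) - (∑ σ, J q σ β * pd (fun x => Q x α) q σ)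
    - ∑ σ, Q q σ * (pd (fun x => J x σ β) q α - pd (fun x => J x σ α) q β)

/-- The components of `D_J Q = d_J Q + d(tr J) ∧ Q`. -/
def gaugedDJ (J : Coord ι → Matrix ι ι ℝ) (Q : Coord ι → ι → ℝ) (q : Coord ι) (α β : ι) : ℝ :=
  dJ J Q q α β + (pd (fun x => (J x).trace) q α * Q q β - pd (fun x => (J x).trace) q β * Q q α)

/-- The components `f^α(q,v)` of the second-order field
`Γ = v^α ∂/∂q^α + f^α ∂/∂v^α` of the equations of motion with kinetic energy metric `G` and
force 1-form `Q`. -/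
def sode (G : Coord ι → Matrix ι ι ℝ) (Q : Coord ι → ι → ℝ) (q v : Coord ι) : Coord ι :=
  WithLp.toLp 2 fun α =>
    -(∑ β, ∑ γ, christoffel G q α β γ * v β * v γ) + ∑ β, (G q)⁻¹ α β * Q q β

/-- The connection coefficients `Γ^α_β = -½ ∂f^α/∂v^β` of a second-order field `f`. -/
def conn (f : Coord ι → Coord ι → Coord ι) (q v : Coord ι) : Matrix ι ι ℝ :=
  fun α β => -(1 / 2) * pd (fun w => f q w α) v β

/-- The derivative of `F(q,v)` along the second-order field `f`. -/
def alongSode {V : Type} [NormedAddCommGroup V] [NormedSpace ℝ V]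
    (f : Coord ι → Coord ι → Coord ι) (F : Coord ι × Coord ι → V) (q v : Coord ι) : V :=
  fderiv ℝ F (q, v) (v, f q v)

/-- The Jacobi endomorphism `Φ^α_β = -∂f^α/∂q^β - Γ^α_γ Γ^γ_β - Γ(Γ^α_β)`. -/
def jacobiEndo (f : Coord ι → Coord ι → Coord ι) (q v : Coord ι) : Matrix ι ι ℝ :=
  fun α β => -pd (fun x => f x v α) q β - (∑ γ, conn f q v α γ * conn f q v γ β)
    - alongSode f (fun z => conn f z.1 z.2 α β) q v

/-- The dynamical covariant derivative `(∇X)^α = Γ(X^α) + Γ^α_β X^β` of a vector field along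
`τ : TM → M`. -/
def nabla (f : Coord ι → Coord ι → Coord ι) (X : Coord ι × Coord ι → Coord ι)
    (q v : Coord ι) : Coord ι :=
  alongSode f X q v + WithLp.toLp 2 fun α => ∑ β, conn f q v α β * X (q, v) β

/-- The components `(D^H Q)(∂_α, ∂_β) = ∂_α Q_β - (∂Γ^γ_α/∂v^β) Q_γ` of the horizontal covariant
differential of a 1-form. -/
def horDiff (f : Coord ι → Coord ι → Coord ι) (Q : Coord ι → ι → ℝ) (q v : Coord ι)
    (α β : ι) : ℝ :=
  pd (fun x => Q x β) q α - ∑ γ, pd (fun w => conn f q w γ α) v β * Q q γ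

/-- A field of subspaces `D q v`, over `(q,v)` with `q ∈ U`, that is a smooth distribution of
rank `r` along `τ`. -/
def IsSmoothDistribution (r : ℕ) (U : Set (Coord ι))
    (D : Coord ι → Coord ι → Submodule ℝ (Coord ι)) : Prop :=
  ∀ q₀ ∈ U, ∀ v₀, ∃ O : Set (Coord ι × Coord ι), IsOpen O ∧ (q₀, v₀) ∈ O ∧ O ⊆ U ×ˢ Set.univ ∧
    ∃ X : Fin r → Coord ι × Coord ι → Coord ι, (∀ i, ContDiffOn ℝ ∞ (X i) O) ∧
      ∀ z ∈ O, LinearIndependent ℝ (fun i => X i z) ∧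
        Submodule.span ℝ (Set.range fun i => X i z) = D z.1 z.2

/-- `X` is a smooth section, over the open set `O` of the tangent bundle, of the distribution `D`
along `τ` over `U`. -/
def IsSection (U : Set (Coord ι)) (D : Coord ι → Coord ι → Submodule ℝ (Coord ι))
    (O : Set (Coord ι × Coord ι)) (X : Coord ι × Coord ι → Coord ι) : Prop :=
  IsOpen O ∧ O ⊆ U ×ˢ Set.univ ∧ ContDiffOn ℝ ∞ X O ∧ ∀ z ∈ O, X z ∈ D z.1 z.2

/-- The velocity part `g^{αβ} p_β` of `Γ̂`, the push-forward of the second-order field under the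
Legendre map `p_α = g_{αβ} v^β`. -/
def hatQ (G : Coord ι → Matrix ι ι ℝ) (q p : Coord ι) : Coord ι :=
  WithLp.toLp 2 fun α => ∑ β, (G q)⁻¹ α β * p β

/-- The momentum part of `Γ̂`: the derivative of `g_{αβ} v^β` along the second-order field, at
`v = g⁻¹ p`. -/
def hatP (G : Coord ι → Matrix ι ι ℝ) (Q : Coord ι → ι → ℝ) (q p : Coord ι) : Coord ι :=
  WithLp.toLp 2 fun α =>
    (∑ β, ∑ γ, pd (fun x => G x α β) q γ * hatQ G q p γ * hatQ G q p β)
      + ∑ β, G q α β * sode G Q q (hatQ G q p) β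

/-- The derivative of `F(q,p)` along the vector field with components `(a, b)`. -/
def alongField (a b : ι → ℝ) (F : Coord ι → Coord ι → ℝ) (q p : Coord ι) : ℝ :=
  (∑ α, a α * pd (fun x => F x p) q α) + ∑ α, b α * pd (fun s => F q s) p α

/-- The `∂/∂q^α`-components of `P_J(dF)`. -/
def poissonQ (J : Coord ι → Matrix ι ι ℝ) (F : Coord ι → Coord ι → ℝ) (q p : Coord ι)
    (α : ι) : ℝ :=
  ∑ β, J q α β * pd (fun s => F q s) p β

/-- The `∂/∂p_β`-components of `P_J(dF)`, where
`P_J = J^α_β ∂/∂p_β ∧ ∂/∂q^α - ½ p_γ (∂J^γ_α/∂q^β - ∂J^γ_β/∂q^α) ∂/∂p_α ∧ ∂/∂p_β`. -/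
def poissonP (J : Coord ι → Matrix ι ι ℝ) (F : Coord ι → Coord ι → ℝ) (q p : Coord ι)
    (β : ι) : ℝ :=
  -(∑ α, J q α β * pd (fun x => F x p) q α)
    - ∑ α, ∑ γ, p γ * (pd (fun x => J x γ α) q β - pd (fun x => J x γ β) q α)
        * pd (fun s => F q s) p α

/-- The bracket `{F, H}_J = P_J(dF)(H)`. For `J = 1` it is the standard Poisson bracket
`(∂F/∂p_α)(∂H/∂q^α) - (∂F/∂q^α)(∂H/∂p_α)`. -/
def bracket (J : Coord ι → Matrix ι ι ℝ) (F H : Coord ι → Coord ι → ℝ) (q p : Coord ι) : ℝ :=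
  alongField (poissonQ J F q p) (poissonP J F q p) H q p

/-- The coefficient of `a ^ k` in the cofactor tensor of `J + a P`. -/
def cofCoeff (J P : Matrix ι ι ℝ) (k : ℕ) : Matrix ι ι ℝ :=
  ((J.map Polynomial.C + (Polynomial.X : ℝ[X]) • P.map Polynomial.C).adjugate).map
    fun r => r.coeff k

/-- The functions `W k` are smooth and satisfy `A_k Q = - dW_k` on `O`, where `A_k` is the
coefficient of `a ^ k` in the cofactor tensor of `J + a P`, for `k = 0, ..., n`. -/
def IsPotentialFamily {n : ℕ} (J P : Coord ι → Matrix ι ι ℝ) (Q : Coord ι → ι → ℝ)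
    (O : Set (Coord ι)) (W : Fin (n + 1) → Coord ι → ℝ) : Prop :=
  ∀ k, ContDiffOn ℝ ∞ (W k) O ∧
    ∀ q ∈ O, ∀ β, ∑ α, cofCoeff (J q) (P q) k α β * Q q α = -pd (W k) q β

/-- The function `½ A_k^{αβ} p_α p_β + W`, where `A_k^{αβ} = (A_k)^α_γ g^{γβ}`. -/
def quadFun (G J P : Coord ι → Matrix ι ι ℝ) (k : ℕ) (W : Coord ι → ℝ) (q p : Coord ι) : ℝ :=
  (1 / 2) * (∑ α, ∑ β, (cofCoeff (J q) (P q) k * (G q)⁻¹) α β * p α * p β) + W q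

end Local

/-! ### Geometric objects on a manifold and their components in a chart -/

section Mfd

variable {ι : Type} [Fintype ι] [DecidableEq ι]
  {M : Type*} [TopologicalSpace M] [ChartedSpace (Coord ι) M]

variable (ι M) in
/-- Smooth Riemannian metrics on `M`. -/
abbrev RiemMetric [IsManifold 𝓘(ℝ, Coord ι) ∞ M] :=
  Bundle.ContMDiffRiemannianMetric 𝓘(ℝ, Coord ι) ∞ (Coord ι)
    (fun x : M => TangentSpace 𝓘(ℝ, Coord ι) x)

/-- A (1,1) tensor field, as an endomorphism of each tangent space, is smooth. -/
def SmoothEnd [IsManifold 𝓘(ℝ, Coord ι) ∞ M]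
    (J : ∀ x : M, TangentSpace 𝓘(ℝ, Coord ι) x →L[ℝ] TangentSpace 𝓘(ℝ, Coord ι) x) : Prop :=
  ContMDiff 𝓘(ℝ, Coord ι) (𝓘(ℝ, Coord ι).prod 𝓘(ℝ, Coord ι →L[ℝ] Coord ι)) ∞
    (fun x => Bundle.TotalSpace.mk' (Coord ι →L[ℝ] Coord ι)
      (E := fun x : M => TangentSpace 𝓘(ℝ, Coord ι) x →L[ℝ] TangentSpace 𝓘(ℝ, Coord ι) x) x (J x))

/-- A 1-form is smooth. -/
def SmoothForm [IsManifold 𝓘(ℝ, Coord ι) ∞ M]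
    (μ : ∀ x : M, TangentSpace 𝓘(ℝ, Coord ι) x →L[ℝ] ℝ) : Prop :=
  ContMDiff 𝓘(ℝ, Coord ι) (𝓘(ℝ, Coord ι).prod 𝓘(ℝ, Coord ι →L[ℝ] ℝ)) ∞
    (fun x => Bundle.TotalSpace.mk' (Coord ι →L[ℝ] ℝ)
      (E := fun x : M => TangentSpace 𝓘(ℝ, Coord ι) x →L[ℝ] Bundle.Trivial M ℝ x) x (μ x))

/-- The charts of the smooth structure of `M`. -/
def IsSmoothChart (e : OpenPartialHomeomorph M (Coord ι)) : Prop :=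
  e ∈ IsManifold.maximalAtlas 𝓘(ℝ, Coord ι) ∞ M

/-- The tangent vector `v^α ∂/∂q^α` at the point with coordinates `q`. -/
def frame (e : OpenPartialHomeomorph M (Coord ι)) (q : Coord ι) :
    Coord ι →L[ℝ] TangentSpace 𝓘(ℝ, Coord ι) (e.symm q) :=
  mfderiv 𝓘(ℝ, Coord ι) 𝓘(ℝ, Coord ι) e.symm q

/-- The components of a tangent vector at the point with coordinates `q`. -/
def coframe (e : OpenPartialHomeomorph M (Coord ι)) (q : Coord ι) :
    TangentSpace 𝓘(ℝ, Coord ι) (e.symm q) →L[ℝ] Coord ι :=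
  mfderiv 𝓘(ℝ, Coord ι) 𝓘(ℝ, Coord ι) e (e.symm q)

/-- The components `g_{αβ}` of the metric. -/
def compMetric [IsManifold 𝓘(ℝ, Coord ι) ∞ M] (e : OpenPartialHomeomorph M (Coord ι))
    (g : RiemMetric ι M) (q : Coord ι) : Matrix ι ι ℝ :=
  fun α β => g.inner (e.symm q) (frame e q (EuclideanSpace.single α 1))
    (frame e q (EuclideanSpace.single β 1))

/-- The components `J^α_β` of a (1,1) tensor field. -/
def compEnd (e : OpenPartialHomeomorph M (Coord ι))
    (J : ∀ x : M, TangentSpace 𝓘(ℝ, Coord ι) x →ₗ[ℝ] TangentSpace 𝓘(ℝ, Coord ι) x)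
    (q : Coord ι) : Matrix ι ι ℝ :=
  fun α β => coframe e q (J (e.symm q) (frame e q (EuclideanSpace.single β 1))) α

/-- The components `Q_α` of a 1-form. -/
def compForm (e : OpenPartialHomeomorph M (Coord ι))
    (μ : ∀ x : M, TangentSpace 𝓘(ℝ, Coord ι) x →L[ℝ] ℝ) (q : Coord ι) (α : ι) : ℝ :=
  μ (e.symm q) (frame e q (EuclideanSpace.single α 1))

/-- The coordinate expression of a field of subspaces `K x v ⊆ T_x M`, `v ∈ T_x M`. -/
def compDist (e : OpenPartialHomeomorph M (Coord ι))
    (K : ∀ x : M, TangentSpace 𝓘(ℝ, Coord ι) x → Submodule ℝ (TangentSpace 𝓘(ℝ, Coord ι) x))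
    (q v : Coord ι) : Submodule ℝ (Coord ι) :=
  (K (e.symm q) (frame e q v)).comap (frame e q).toLinearMap

/-- The orthogonal complement of a subspace of `T_x M`. -/
def perp [IsManifold 𝓘(ℝ, Coord ι) ∞ M] (g : RiemMetric ι M) (x : M)
    (S : Submodule ℝ (TangentSpace 𝓘(ℝ, Coord ι) x)) :
    Submodule ℝ (TangentSpace 𝓘(ℝ, Coord ι) x) where
  carrier := {w | ∀ s ∈ S, g.inner x s w = 0}
  add_mem' := by
    intro a b ha hb s hs
    simp [ha s hs, hb s hs]
  zero_mem' := by
    intro s _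
    simp
  smul_mem' := by
    intro c a ha s hs
    simp [ha s hs]

theorem isCompl_perp [IsManifold 𝓘(ℝ, Coord ι) ∞ M] (g : RiemMetric ι M) (x : M)
    (S : Submodule ℝ (TangentSpace 𝓘(ℝ, Coord ι) x)) : IsCompl S (perp g x S) := by
  have : FiniteDimensional ℝ (TangentSpace 𝓘(ℝ, Coord ι) x) :=
    inferInstanceAs (FiniteDimensional ℝ (Coord ι))
  let B : LinearMap.BilinForm ℝ (TangentSpace 𝓘(ℝ, Coord ι) x) :=
    LinearMap.mk₂ ℝ (fun a b => g.inner x a b) (by simp) (by simp) (by simp) (by simp)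
  have hB : B.IsRefl := by
    intro a b h
    change g.inner x b a = 0
    rw [g.symm]
    exact h
  have hS : perp g x S = B.orthogonal S := by
    ext w
    exact Iff.rfl
  rw [hS, LinearMap.BilinForm.isCompl_orthogonal_iff_disjoint hB, ← hS, Submodule.disjoint_def]
  intro w hw hw'
  by_contra h0
  exact (g.pos x w h0).ne' (hw' w hw)

/-- The orthogonal projection of `T_x M` onto a subspace. -/
def orthProj [IsManifold 𝓘(ℝ, Coord ι) ∞ M] (g : RiemMetric ι M) (x : M)
    (S : Submodule ℝ (TangentSpace 𝓘(ℝ, Coord ι) x)) :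
    TangentSpace 𝓘(ℝ, Coord ι) x →ₗ[ℝ] TangentSpace 𝓘(ℝ, Coord ι) x :=
  Submodule.projection S (perp g x S) (isCompl_perp g x S)

/-- The orthogonal projection `P₂` onto a distribution `K` along `τ : TM → M` which is spanned by a
distribution on `M`, so that `K x v` does not depend on `v`. -/
def projK [IsManifold 𝓘(ℝ, Coord ι) ∞ M] (g : RiemMetric ι M)
    (K : ∀ x : M, TangentSpace 𝓘(ℝ, Coord ι) x → Submodule ℝ (TangentSpace 𝓘(ℝ, Coord ι) x))
    (x : M) : TangentSpace 𝓘(ℝ, Coord ι) x →ₗ[ℝ] TangentSpace 𝓘(ℝ, Coord ι) x :=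
  orthProj g x (K x 0)

/-- The components of the second-order field `Γ` on `TM` determined by `g` and `μ`. -/
def compSode [IsManifold 𝓘(ℝ, Coord ι) ∞ M] (e : OpenPartialHomeomorph M (Coord ι))
    (g : RiemMetric ι M) (μ : ∀ x : M, TangentSpace 𝓘(ℝ, Coord ι) x →L[ℝ] ℝ) :
    Coord ι → Coord ι → Coord ι :=
  sode (compMetric e g) (compForm e μ)

/-- A cofactor system `(g, μ, J)`: `J` is a nonsingular special conformal Killing tensor with
`D_J μ = 0`. -/
structure IsCofactorSystem [IsManifold 𝓘(ℝ, Coord ι) ∞ M] (g : RiemMetric ι M)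
    (μ : ∀ x : M, TangentSpace 𝓘(ℝ, Coord ι) x →L[ℝ] ℝ)
    (J : ∀ x : M, TangentSpace 𝓘(ℝ, Coord ι) x →L[ℝ] TangentSpace 𝓘(ℝ, Coord ι) x) : Prop where
  smooth_form : SmoothForm μ
  smooth_end : SmoothEnd J
  nonsingular : ∀ x, LinearMap.det (J x).toLinearMap ≠ 0
  sckt : ∀ e, IsSmoothChart e →
    IsSCKT e.target (compMetric e g) (compEnd e fun x => (J x).toLinearMap)
  gauged_closed : ∀ e, IsSmoothChart e → ∀ q ∈ e.target, ∀ α β,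
    gaugedDJ (compEnd e fun x => (J x).toLinearMap) (compForm e μ) q α β = 0

/-- A driven cofactor system: a cofactor system `(g, μ, J)` with a smooth distribution `K` of
rank `r` along `τ : TM → M` such that `Φ(K) ⊆ K`, `∇K ⊆ K`, `D^V_Z K ⊆ K` for all `Z`,
`dμ(K, K) = 0`, and `D^H μ(K^⊥, K)` does not vanish identically. -/
structure IsDrivenCofactorSystem [IsManifold 𝓘(ℝ, Coord ι) ∞ M] (r : ℕ) (g : RiemMetric ι M)
    (μ : ∀ x : M, TangentSpace 𝓘(ℝ, Coord ι) x →L[ℝ] ℝ)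
    (J : ∀ x : M, TangentSpace 𝓘(ℝ, Coord ι) x →L[ℝ] TangentSpace 𝓘(ℝ, Coord ι) x)
    (K : ∀ x : M, TangentSpace 𝓘(ℝ, Coord ι) x → Submodule ℝ (TangentSpace 𝓘(ℝ, Coord ι) x)) :
    Prop extends IsCofactorSystem g μ J where
  smooth_dist : ∀ e, IsSmoothChart e → IsSmoothDistribution r e.target (compDist e K)
  jacobi_mem : ∀ e, IsSmoothChart e → ∀ q ∈ e.target, ∀ v, ∀ w ∈ compDist e K q v,
    Matrix.toEuclideanLin (jacobiEndo (compSode e g μ) q v) w ∈ compDist e K q v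
  nabla_mem : ∀ e, IsSmoothChart e → ∀ O X, IsSection e.target (compDist e K) O X →
    ∀ q v, (q, v) ∈ O → nabla (compSode e g μ) X q v ∈ compDist e K q v
  vert_mem : ∀ e, IsSmoothChart e → ∀ O X, IsSection e.target (compDist e K) O X →
    ∀ q v, (q, v) ∈ O → ∀ Z : Coord ι, fderiv ℝ X (q, v) (0, Z) ∈ compDist e K q v
  closed_on : ∀ e, IsSmoothChart e → ∀ q ∈ e.target, ∀ v,
    ∀ X ∈ compDist e K q v, ∀ Y ∈ compDist e K q v,
      ∑ α, ∑ β, (pd (fun x => compForm e μ x β) q α - pd (fun x => compForm e μ x α) q β)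
        * X α * Y β = 0
  coupling : ∃ e, IsSmoothChart e ∧ ∃ q ∈ e.target, ∃ v,
    ∃ X ∈ compDist e (fun x w => perp g x (K x w)) q v, ∃ Y ∈ compDist e K q v,
      ∑ α, ∑ β, horDiff (compSode e g μ) (compForm e μ) q v α β * X α * Y β ≠ 0

end Mfd

/-! ### Adapted coordinates, driving and driven system -/

section Adapted

variable {m n : ℕ}

/-- The index set of the coordinates of an `(m+n)`-dimensional manifold, written as the union of
two parts. The coordinates with index `inl i` are called `y^i` and those with index `inr a` are
called `x^a`; in a chart that is not adapted this is a mere labelling. -/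
abbrev Idx (m n : ℕ) := Fin m ⊕ Fin n

/-- The coordinate vector `(y, x)`. -/
def join (y : Coord (Fin m)) (x : Coord (Fin n)) : Coord (Idx m n) :=
  WithLp.toLp 2 (Sum.elim (fun i => y i) (fun a => x a))

/-- The product domain `V × Ω` in the coordinates `(y, x)`. -/
def box (V : Set (Coord (Fin m))) (Ω : Set (Coord (Fin n))) : Set (Coord (Idx m n)) :=
  {q | ∃ y ∈ V, ∃ x ∈ Ω, q = join y x}

/-- The chart `e` is adapted: `K = span {∂/∂x^a}` and `K^⊥ = span {∂/∂y^i}`. -/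
def IsAdapted {M : Type*} [TopologicalSpace M] [ChartedSpace (Coord (Idx m n)) M]
    [IsManifold 𝓘(ℝ, Coord (Idx m n)) ∞ M] (g : RiemMetric (Idx m n) M)
    (K : ∀ x : M, TangentSpace 𝓘(ℝ, Coord (Idx m n)) x →
      Submodule ℝ (TangentSpace 𝓘(ℝ, Coord (Idx m n)) x))
    (e : OpenPartialHomeomorph M (Coord (Idx m n))) : Prop :=
  ∀ q ∈ e.target, ∀ v,
    compDist e K q v
        = Submodule.span ℝ (Set.range fun a : Fin n => EuclideanSpace.single (Sum.inr a) 1) ∧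
    compDist e (fun x w => perp g x (K x w)) q v
        = Submodule.span ℝ (Set.range fun i : Fin m => EuclideanSpace.single (Sum.inl i) 1)

/-- `(y(t), r(t))`, `t ∈ T`, is a solution of the driving system: the `∂/∂y^i`- and
`∂/∂p_i`-components of the field with components `(X, Y)` on `V × Ω` prescribe its derivative,
whatever the values of the remaining variables `(x, s)`. -/
def IsDrivingSolution (X Y : Coord (Idx m n) → Coord (Idx m n) → Coord (Idx m n))
    (V : Set (Coord (Fin m))) (Ω : Set (Coord (Fin n))) (T : Set ℝ)
    (y r : ℝ → Coord (Fin m)) : Prop :=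
  ∀ t ∈ T, y t ∈ V ∧ ∀ x ∈ Ω, ∀ s : Coord (Fin n), ∀ i : Fin m,
    HasDerivAt (fun u => y u i) (X (join (y t) x) (join (r t) s) (Sum.inl i)) t ∧
    HasDerivAt (fun u => r u i) (Y (join (y t) x) (join (r t) s) (Sum.inl i)) t

/-- `(x(t), s(t))`, `t ∈ T`, is a solution of the driven system along `(y(t), r(t))`, i.e. of the
time-dependent system on `Ω × ℝⁿ` given by the `∂/∂x^a`- and `∂/∂p_a`-components of the field
`(X, Y)` in which `(y(t), r(t))` is inserted. -/
def IsDrivenSolution (X Y : Coord (Idx m n) → Coord (Idx m n) → Coord (Idx m n))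
    (Ω : Set (Coord (Fin n))) (T : Set ℝ) (y r : ℝ → Coord (Fin m))
    (x s : ℝ → Coord (Fin n)) : Prop :=
  ∀ t ∈ T, x t ∈ Ω ∧ ∀ a : Fin n,
    HasDerivAt (fun u => x u a) (X (join (y t) (x t)) (join (r t) (s t)) (Sum.inr a)) t ∧
    HasDerivAt (fun u => s u a) (Y (join (y t) (x t)) (join (r t) (s t)) (Sum.inr a)) t

end Adapted

end DrivenCofactor

end

open DrivenCofactor

set_option linter.unusedSectionVars false

/-! Let `J` be nonsingular with ∇_u J = ½ (c♯ ⊗ u♭ + u ⊗ c). Then d(tr J) = c, and the cofactor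
tensor A of `J` satisfies d(det J) = Aᵀc. If moreover D_J Q = 0, two facts follow by direct
computation: the 1-form AᵀQ is closed (`closed_of_det_ne`), and for H = ½ A^{αβ} p_α p_β + W with
AᵀQ = -dW one has det J · Γ̂ = P_J(dH) (`det_mul_hatQ`, `det_mul_hatP`).

The conditions on `K` provide a second tensor of this kind. Vertical stability makes `K` independent
of the velocity (`proj_const_of_vertical`). Stability under the dynamical covariant derivative makes
the orthogonal projection P onto it parallel (`cov_proj_eq_zero`), so P is a special conformal
Killing tensor with c = 0. At zero velocity the Jacobi endomorphism is -∇(g⁻¹Q); hence Φ(K) ⊆ K says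
that (∇_X Q)(Y) = 0 for X in K and Y in K^⊥. Together with dμ(K, K) = 0 this is D_P Q = 0
(`gaugedForm_parallel_eq_zero`).

All conditions are linear, so J + aP satisfies them with the same c for every a, and it is
nonsingular for all but finitely many a. As P has rank at most n, its determinant and its cofactor
tensor are polynomials of degree at most n in a. Comparing coefficients gives closed forms A_k Q,
hence potentials on convex domains, and det(J + aP) Γ̂ = P_{J+aP}(dH(a)), first for nonsingular J +
aP and then for all a by continuity.

Applied to H(a), this identity gives Γ̂(H(a)) = 0, because the bracket is antisymmetric. So {H(a),
H(b)} vanishes for the bracket of J + aP with a and b independent; exchanging a and b makes it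
vanish for J and P separately (`involution_of_pencil`). No Jacobi identity is needed. The
coefficient of a^(n+1) gives P_P(dH_(n+1)) = 0 (`poisson_last`).

In adapted coordinates P is constant. It commutes with the connection matrices, so the mixed
Christoffel symbols vanish and the y-part of the metric and of Q depends on y only. Moreover P_P is
the canonical Poisson tensor in (x, p_x), which yields the statements on the driving and the driven
system. -/

noncomputable section

namespace DrivenCofactor

open scoped Matrix
open Filter Topology

/-! ### Directional derivatives -/

section Directional

variable {ι : Type} [Fintype ι] [DecidableEq ι]

/-- The derivative of `f` at `q` in the direction with components `u`. -/
def dir (f : Coord ι → ℝ) (q : Coord ι) (u : ι → ℝ) : ℝ :=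
  fderiv ℝ f q (WithLp.toLp 2 u)

theorem toLp_eq_sum_single (u : ι → ℝ) :
    (WithLp.toLp 2 u : Coord ι) = ∑ γ, u γ • EuclideanSpace.single γ (1 : ℝ) := by
  ext β
  simp [Pi.single_apply]

theorem clm_apply_eq_sum {V : Type*} [NormedAddCommGroup V] [NormedSpace ℝ V]
    (L : Coord ι →L[ℝ] V) (w : Coord ι) :
    L w = ∑ γ, w γ • L (EuclideanSpace.single γ 1) := by
  conv_lhs => rw [show w = WithLp.toLp 2 (fun γ => w γ) from rfl, toLp_eq_sum_single]
  simp

theorem dir_eq_sum (f : Coord ι → ℝ) (q : Coord ι) (u : ι → ℝ) :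
    dir f q u = ∑ γ, pd f q γ * u γ := by
  rw [dir, clm_apply_eq_sum]
  simp [pd, mul_comm]

theorem dir_single (f : Coord ι → ℝ) (q : Coord ι) (γ : ι) :
    dir f q (Pi.single γ 1) = pd f q γ := rfl

theorem dir_congr {f h : Coord ι → ℝ} {q : Coord ι} (e : f =ᶠ[𝓝 q] h) (u : ι → ℝ) :
    dir f q u = dir h q u := by
  rw [dir, e.fderiv_eq, dir]

theorem pd_congr {f h : Coord ι → ℝ} {q : Coord ι} (e : f =ᶠ[𝓝 q] h) (γ : ι) :
    pd f q γ = pd h q γ := by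
  rw [pd, e.fderiv_eq, pd]

@[simp]
theorem dir_const (c : ℝ) (q : Coord ι) (u : ι → ℝ) : dir (fun _ => c) q u = 0 := by
  simp [dir]

theorem dir_mul {f h : Coord ι → ℝ} {q : Coord ι} (hf : DifferentiableAt ℝ f q)
    (hh : DifferentiableAt ℝ h q) (u : ι → ℝ) :
    dir (fun x => f x * h x) q u = dir f q u * h q + f q * dir h q u := by
  rw [dir, fderiv_fun_mul hf hh]
  simp [dir]
  ring

theorem dir_add {f h : Coord ι → ℝ} {q : Coord ι} (hf : DifferentiableAt ℝ f q)
    (hh : DifferentiableAt ℝ h q) (u : ι → ℝ) :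
    dir (fun x => f x + h x) q u = dir f q u + dir h q u := by
  rw [dir, fderiv_fun_add hf hh]
  simp [dir]

theorem dir_const_mul {f : Coord ι → ℝ} {q : Coord ι} (hf : DifferentiableAt ℝ f q) (c : ℝ)
    (u : ι → ℝ) : dir (fun x => c * f x) q u = c * dir f q u := by
  rw [dir_mul (differentiableAt_const c) hf]
  simp

theorem dir_sum {κ : Type*} {s : Finset κ} {f : κ → Coord ι → ℝ} {q : Coord ι}
    (hf : ∀ k ∈ s, DifferentiableAt ℝ (f k) q) (u : ι → ℝ) :
    dir (fun x => ∑ k ∈ s, f k x) q u = ∑ k ∈ s, dir (f k) q u := by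
  rw [dir, fderiv_fun_sum hf]
  simp [dir]

theorem pd_sum_const_mul {κ : Type*} {s : Finset κ} (c : κ → ℝ) {f : κ → Coord ι → ℝ}
    {q : Coord ι} (hf : ∀ k ∈ s, DifferentiableAt ℝ (f k) q) (γ : ι) :
    pd (fun x => ∑ k ∈ s, c k * f k x) q γ = ∑ k ∈ s, c k * pd (f k) q γ := by
  rw [← dir_single, dir_sum fun k hk => (hf k hk).const_mul (c k)]
  exact Finset.sum_congr rfl fun k hk => dir_const_mul (hf k hk) _ _

/-- Differentiability of a matrix-valued function, entry by entry. -/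
def DiffMat {κ κ' : Type*} (F : Coord ι → Matrix κ κ' ℝ) (q : Coord ι) : Prop :=
  ∀ α β, DifferentiableAt ℝ (fun x => F x α β) q

/-- The derivative of a matrix-valued function in the direction with components `u`. -/
def dirMat {κ κ' : Type*} (F : Coord ι → Matrix κ κ' ℝ) (q : Coord ι) (u : ι → ℝ) :
    Matrix κ κ' ℝ :=
  fun α β => dir (fun x => F x α β) q u

theorem dirMat_congr {κ κ' : Type*} {F H : Coord ι → Matrix κ κ' ℝ} {q : Coord ι}
    (e : F =ᶠ[𝓝 q] H) (u : ι → ℝ) : dirMat F q u = dirMat H q u := by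
  ext α β
  exact dir_congr (e.mono fun x hx => by simp only [hx]) u

@[simp]
theorem dirMat_const {κ κ' : Type*} (C : Matrix κ κ' ℝ) (q : Coord ι) (u : ι → ℝ) :
    dirMat (fun _ => C) q u = 0 := by
  ext α β
  simp [dirMat]

theorem dirMat_mul {F H : Coord ι → Matrix ι ι ℝ} {q : Coord ι} (hF : DiffMat F q)
    (hH : DiffMat H q) (u : ι → ℝ) :
    dirMat (fun x => F x * H x) q u = dirMat F q u * H q + F q * dirMat H q u := by
  ext α β
  simp only [dirMat, Matrix.mul_apply, Matrix.add_apply]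
  rw [dir_sum (f := fun σ x => F x α σ * H x σ β) fun σ _ => (hF α σ).mul (hH σ β), ← Finset.sum_add_distrib]
  exact Finset.sum_congr rfl fun σ _ => dir_mul (hF α σ) (hH σ β) u

theorem dirMat_add_const_smul {F H : Coord ι → Matrix ι ι ℝ} {q : Coord ι} (hF : DiffMat F q)
    (hH : DiffMat H q) (a : ℝ) (u : ι → ℝ) :
    dirMat (fun x => F x + a • H x) q u = dirMat F q u + a • dirMat H q u := by
  ext α β
  simp only [dirMat, Matrix.add_apply, Matrix.smul_apply, smul_eq_mul]
  rw [dir_add (hF α β) ((hH α β).const_mul a), dir_const_mul (hH α β)]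

theorem dirMat_transpose {F : Coord ι → Matrix ι ι ℝ} (q : Coord ι) (u : ι → ℝ) :
    dirMat (fun x => (F x)ᵀ) q u = (dirMat F q u)ᵀ := rfl

theorem dirMat_scalar {f : Coord ι → ℝ} {q : Coord ι} (u : ι → ℝ) :
    dirMat (fun x => f x • (1 : Matrix ι ι ℝ)) q u = dir f q u • 1 := by
  ext α β
  by_cases h : α = β <;> simp [dirMat, h]

theorem dir_trace {F : Coord ι → Matrix ι ι ℝ} {q : Coord ι} (hF : DiffMat F q) (u : ι → ℝ) :
    dir (fun x => (F x).trace) q u = (dirMat F q u).trace := by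
  simp only [Matrix.trace, Matrix.diag]
  exact dir_sum (fun σ _ => hF σ σ) u

theorem dirMat_eq_sum (F : Coord ι → Matrix ι ι ℝ) (q : Coord ι) (u : ι → ℝ) (α β : ι) :
    dirMat F q u α β = ∑ γ, pd (fun x => F x α β) q γ * u γ :=
  dir_eq_sum _ _ _

/-- The derivative of a covector-valued function in the direction with components `u`. -/
def dirVec (Q : Coord ι → ι → ℝ) (q : Coord ι) (u : ι → ℝ) : ι → ℝ :=
  fun α => dir (fun x => Q x α) q u

theorem dirVec_mulVec {F : Coord ι → Matrix ι ι ℝ} {Q : Coord ι → ι → ℝ} {q : Coord ι}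
    (hF : DiffMat F q) (hQ : ∀ α, DifferentiableAt ℝ (fun x => Q x α) q) (u : ι → ℝ) :
    dirVec (fun x => F x *ᵥ Q x) q u = dirMat F q u *ᵥ Q q + F q *ᵥ dirVec Q q u := by
  ext α
  simp only [dirVec, dirMat, Matrix.mulVec, dotProduct, Pi.add_apply]
  rw [dir_sum (f := fun σ x => F x α σ * Q x σ) fun σ _ => (hF α σ).mul (hQ σ), ← Finset.sum_add_distrib]
  exact Finset.sum_congr rfl fun σ _ => dir_mul (hF α σ) (hQ σ) u

theorem DiffMat.mulVec {F : Coord ι → Matrix ι ι ℝ} {Q : Coord ι → ι → ℝ} {q : Coord ι}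
    (hF : DiffMat F q) (hQ : ∀ α, DifferentiableAt ℝ (fun x => Q x α) q) (α : ι) :
    DifferentiableAt ℝ (fun x => (F x *ᵥ Q x) α) q := by
  simp only [Matrix.mulVec, dotProduct]
  exact DifferentiableAt.fun_sum fun σ _ => (hF α σ).mul (hQ σ)

theorem dirVec_congr {Q R : Coord ι → ι → ℝ} {q : Coord ι} (e : Q =ᶠ[𝓝 q] R) (u : ι → ℝ) :
    dirVec Q q u = dirVec R q u := by
  ext α
  exact dir_congr (e.mono fun x hx => by simp only [hx]) u

/-! ### The Levi-Civita connection in matrix form -/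

/-- The connection matrix `(Γ(u))^α_β = Γ^α_{βγ} u^γ`. -/
def chr (G : Coord ι → Matrix ι ι ℝ) (q : Coord ι) (u : ι → ℝ) : Matrix ι ι ℝ :=
  fun α β => ∑ γ, christoffel G q α β γ * u γ

/-- The covariant derivative of a type (1,1) tensor in the direction with components `u`. -/
def cov (G J : Coord ι → Matrix ι ι ℝ) (q : Coord ι) (u : ι → ℝ) : Matrix ι ι ℝ :=
  dirMat J q u - J q * chr G q u + chr G q u * J q

theorem cov_apply (G J : Coord ι → Matrix ι ι ℝ) (q : Coord ι) (u : ι → ℝ) (α β : ι) :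
    cov G J q u α β = ∑ γ, covDeriv G J q α β γ * u γ := by
  simp only [cov, covDeriv, chr, Matrix.add_apply, Matrix.sub_apply, Matrix.mul_apply,
    dirMat_eq_sum, add_mul, sub_mul, Finset.sum_add_distrib, Finset.sum_sub_distrib,
    Finset.mul_sum, Finset.sum_mul]
  rw [Finset.sum_comm (f := fun σ γ => J q α σ * (christoffel G q σ β γ * u γ)),
    Finset.sum_comm (f := fun σ γ => christoffel G q α σ γ * u γ * J q σ β)]
  refine congrArg₂ _ (congrArg₂ _ rfl ?_) ?_ <;>
  exact Finset.sum_congr rfl fun γ _ => Finset.sum_congr rfl fun σ _ => by ring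

theorem covDeriv_eq_cov (G J : Coord ι → Matrix ι ι ℝ) (q : Coord ι) (α β γ : ι) :
    covDeriv G J q α β γ = cov G J q (Pi.single γ 1) α β := by
  rw [cov_apply]
  simp [Pi.single_apply]

theorem cov_add_const_smul {G J P : Coord ι → Matrix ι ι ℝ} {q : Coord ι} (hJ : DiffMat J q)
    (hP : DiffMat P q) (a : ℝ) (u : ι → ℝ) :
    cov G (fun x => J x + a • P x) q u = cov G J q u + a • cov G P q u := by
  simp only [cov, dirMat_add_const_smul hJ hP, add_mul, mul_add, smul_add, smul_sub,
    Matrix.smul_mul, Matrix.mul_smul]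
  abel

theorem christoffel_symm {G : Coord ι → Matrix ι ι ℝ} {q : Coord ι}
    (hG : ∀ᶠ x in 𝓝 q, (G x).IsSymm) (α β γ : ι) :
    christoffel G q α β γ = christoffel G q α γ β := by
  have h : ∀ δ, pd (fun x => G x β γ) q δ = pd (fun x => G x γ β) q δ := fun δ =>
    pd_congr (hG.mono fun x hx => (hx.apply β γ).symm) δ
  simp only [christoffel, h]
  congr 1
  exact Finset.sum_congr rfl fun δ _ => by ring

/-- This is the vanishing torsion of the connection. It is what makes most connection terms cancel
below. -/
theorem chr_mulVec_comm {G : Coord ι → Matrix ι ι ℝ} {q : Coord ι}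
    (hG : ∀ᶠ x in 𝓝 q, (G x).IsSymm) (u w : ι → ℝ) :
    chr G q u *ᵥ w = chr G q w *ᵥ u := by
  ext α
  simp only [Matrix.mulVec, dotProduct, chr, Finset.sum_mul]
  rw [Finset.sum_comm]
  refine Finset.sum_congr rfl fun γ _ => Finset.sum_congr rfl fun β _ => ?_
  rw [christoffel_symm hG]
  ring

/-- Lowering the upper index cancels the inverse metric and leaves the Christoffel symbols of the
first kind. -/
theorem metric_mul_chr {G : Coord ι → Matrix ι ι ℝ} {q : Coord ι} (hdet : IsUnit (G q).det)
    (u : ι → ℝ) (δ β : ι) :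
    (G q * chr G q u) δ β = (1 / 2) * ∑ γ, (pd (fun x => G x δ β) q γ
      + pd (fun x => G x δ γ) q β - pd (fun x => G x β γ) q δ) * u γ := by
  have key : ∀ γ, ∑ α, G q δ α * christoffel G q α β γ = (1 / 2) * (pd (fun x => G x δ β) q γ
      + pd (fun x => G x δ γ) q β - pd (fun x => G x β γ) q δ) := by
    intro γ
    set b : ι → ℝ := fun δ => pd (fun x => G x δ β) q γ
      + pd (fun x => G x δ γ) q β - pd (fun x => G x β γ) q δ with hb
    have h1 : ∀ α, christoffel G q α β γ = (1 / 2) * ((G q)⁻¹ *ᵥ b) α := fun α => rfl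
    have h2 : (G q *ᵥ ((G q)⁻¹ *ᵥ b)) δ = b δ := by
      rw [Matrix.mulVec_mulVec, Matrix.mul_nonsing_inv _ hdet, Matrix.one_mulVec]
    change _ = (1 / 2) * b δ
    rw [← h2]
    simp only [h1]
    rw [Matrix.mulVec, dotProduct, Finset.mul_sum]
    exact Finset.sum_congr rfl fun α _ => by ring
  simp only [Matrix.mul_apply, chr, Finset.mul_sum]
  rw [Finset.sum_comm]
  refine Finset.sum_congr rfl fun γ _ => ?_
  rw [← mul_assoc (1 / 2 : ℝ), ← key, Finset.sum_mul]
  exact Finset.sum_congr rfl fun α _ => by ring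

/-- This is ∇g = 0: in the sum of a Christoffel symbol of the first kind and its transpose only the
derivative along `u` survives. -/
theorem dirMat_metric {G : Coord ι → Matrix ι ι ℝ} {q : Coord ι}
    (hG : ∀ᶠ x in 𝓝 q, (G x).IsSymm) (hdet : IsUnit (G q).det) (u : ι → ℝ) :
    dirMat G q u = G q * chr G q u + (chr G q u)ᵀ * G q := by
  have hs : ∀ α β δ, pd (fun x => G x α β) q δ = pd (fun x => G x β α) q δ := fun α β δ =>
    pd_congr (hG.mono fun x hx => (hx.apply α β).symm) δ
  have ht : (chr G q u)ᵀ * G q = (G q * chr G q u)ᵀ := by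
    rw [Matrix.transpose_mul, hG.self_of_nhds.eq]
  ext α β
  rw [ht, Matrix.add_apply, Matrix.transpose_apply, metric_mul_chr hdet, metric_mul_chr hdet,
    dirMat_eq_sum, ← mul_add, ← Finset.sum_add_distrib, Finset.mul_sum]
  refine Finset.sum_congr rfl fun γ _ => ?_
  rw [hs β α γ]
  ring

end Directional

/-! ### Smooth matrix-valued functions -/

section SmoothMatrices

variable {ι : Type} [Fintype ι] [DecidableEq ι]
  {E : Type*} [NormedAddCommGroup E] [NormedSpace ℝ E]

/-- Smoothness at a point of a matrix-valued function, entry by entry. -/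
def SmoothMat {κ κ' : Type*} (F : E → Matrix κ κ' ℝ) (x : E) : Prop :=
  ∀ α β, ContDiffAt ℝ ∞ (fun y => F y α β) x

theorem SmoothMat.diffMat {κ κ' : Type*} {F : Coord ι → Matrix κ κ' ℝ} {q : Coord ι}
    (h : SmoothMat F q) : DiffMat F q :=
  fun α β => (h α β).differentiableAt (by simp)

theorem SmoothMat.mul {κ κ' κ'' : Type*} [Fintype κ'] {F : E → Matrix κ κ' ℝ}
    {H : E → Matrix κ' κ'' ℝ} {x : E} (hF : SmoothMat F x) (hH : SmoothMat H x) :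
    SmoothMat (fun y => F y * H y) x := by
  intro α β
  simp only [Matrix.mul_apply]
  exact ContDiffAt.sum fun σ _ => (hF α σ).mul (hH σ β)

theorem SmoothMat.transpose {κ κ' : Type*} {F : E → Matrix κ κ' ℝ} {x : E}
    (hF : SmoothMat F x) : SmoothMat (fun y => (F y)ᵀ) x :=
  fun α β => hF β α

theorem SmoothMat.congr {κ κ' : Type*} {F H : E → Matrix κ κ' ℝ} {x : E}
    (hF : SmoothMat F x) (h : H =ᶠ[𝓝 x] F) : SmoothMat H x :=
  fun α β => (hF α β).congr_of_eventuallyEq (h.mono fun y hy => by simp only [hy])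

theorem SmoothMat.add_const_smul {κ κ' : Type*} {F H : E → Matrix κ κ' ℝ} {x : E}
    (hF : SmoothMat F x) (hH : SmoothMat H x) (a : ℝ) :
    SmoothMat (fun y => F y + a • H y) x :=
  fun α β => (hF α β).add (contDiffAt_const.mul (hH α β))

theorem SmoothMat.det {κ : Type*} [Fintype κ] [DecidableEq κ] {F : E → Matrix κ κ ℝ} {x : E}
    (hF : SmoothMat F x) : ContDiffAt ℝ ∞ (fun y => (F y).det) x := by
  simp only [Matrix.det_apply']
  exact ContDiffAt.sum fun σ _ => contDiffAt_const.mul (contDiffAt_prod fun i _ => hF _ _)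

theorem SmoothMat.adjugate {κ : Type*} [Fintype κ] [DecidableEq κ] {F : E → Matrix κ κ ℝ} {x : E}
    (hF : SmoothMat F x) : SmoothMat (fun y => (F y).adjugate) x := by
  intro α β
  simp only [Matrix.adjugate_apply]
  apply SmoothMat.det
  intro γ δ
  by_cases h : γ = β
  · subst h
    simpa using contDiffAt_const
  · simpa [Matrix.updateRow_ne h] using hF γ δ

theorem SmoothMat.inv {κ : Type*} [Fintype κ] [DecidableEq κ] {F : E → Matrix κ κ ℝ} {x : E}
    (hF : SmoothMat F x) (h : (F x).det ≠ 0) : SmoothMat (fun y => (F y)⁻¹) x := by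
  intro α β
  simp only [Matrix.inv_def, Matrix.smul_apply, smul_eq_mul, Ring.inverse_eq_inv']
  exact (hF.det.inv h).mul (hF.adjugate α β)

theorem SmoothMat.eventually_det_ne_zero {κ : Type*} [Fintype κ] [DecidableEq κ]
    {F : E → Matrix κ κ ℝ} {x : E} (hF : SmoothMat F x) (h : (F x).det ≠ 0) :
    ∀ᶠ y in 𝓝 x, (F y).det ≠ 0 :=
  hF.det.continuousAt.eventually_ne h

end SmoothMatrices

/-! ### Derivatives of determinants, cofactors and inverses -/

section Derivatives

variable {ι : Type} [Fintype ι] [DecidableEq ι]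

/-- Jacobi's formula for the derivative of a determinant. -/
theorem dir_det {J : Coord ι → Matrix ι ι ℝ} {q : Coord ι} (hJ : DiffMat J q) (u : ι → ℝ) :
    dir (fun x => (J x).det) q u = ((J q).adjugate * dirMat J q u).trace := by
  have hp := fun σ : Equiv.Perm ι => HasFDerivAt.finsetProd (u := Finset.univ)
    (g := fun i x => J x (σ i) i) fun i _ => (hJ (σ i) i).hasFDerivAt
  have hd : ∀ σ : Equiv.Perm ι, DifferentiableAt ℝ (fun x => ∏ i, J x (σ i) i) q := fun σ =>
    (hp σ).differentiableAt
  have h1 : dir (fun x => (J x).det) q u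
      = ∑ i, ((J q).updateCol i fun j => dirMat J q u j i).det := by
    simp only [Matrix.det_apply']
    rw [dir_sum fun σ _ => (hd σ).const_mul _, Finset.sum_comm]
    refine Finset.sum_congr rfl fun σ _ => ?_
    rw [dir_const_mul (hd σ), ← Finset.mul_sum]
    congr 1
    rw [dir, (hp σ).fderiv]
    simp only [_root_.sum_apply, _root_.smul_apply, smul_eq_mul]
    refine Finset.sum_congr rfl fun i _ => ?_
    -- The product rule differentiates one factor of the Leibniz term at a time; that factor is
    -- split off to recognise the determinant with column `i` replaced, to which Cramer's rule
    -- applies.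
    rw [← Finset.mul_prod_erase _ _ (Finset.mem_univ i), mul_comm]
    congr 1
    · simp [dirMat, dir]
    · refine Finset.prod_congr rfl fun j hj => ?_
      rw [Matrix.updateCol_ne (Finset.ne_of_mem_erase hj)]
  rw [h1, Matrix.trace]
  refine Finset.sum_congr rfl fun i _ => ?_
  rw [← Matrix.cramer_apply, Matrix.cramer_eq_adjugate_mulVec]
  rfl

/-- Differentiate J · adj J = det J · 1 and multiply by adj J from the left. Keeping the factor det
J avoids dividing by it. -/
theorem dirMat_adjugate {J : Coord ι → Matrix ι ι ℝ} {q : Coord ι} (hJ : SmoothMat J q)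
    (u : ι → ℝ) :
    (J q).det • dirMat (fun x => (J x).adjugate) q u
      = dir (fun x => (J x).det) q u • (J q).adjugate
        - (J q).adjugate * dirMat J q u * (J q).adjugate := by
  have h := dirMat_mul hJ.diffMat hJ.adjugate.diffMat u
  simp only [Matrix.mul_adjugate, dirMat_scalar] at h
  have h2 := congrArg (fun M => (J q).adjugate * M) h
  simp only [Matrix.mul_smul, mul_one, mul_add, ← mul_assoc, Matrix.adjugate_mul,
    Matrix.smul_mul, one_mul] at h2
  rw [h2]
  abel

theorem dirMat_inv {G : Coord ι → Matrix ι ι ℝ} {q : Coord ι} (hG : SmoothMat G q)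
    (hd : (G q).det ≠ 0) (u : ι → ℝ) :
    dirMat (fun x => (G x)⁻¹) q u = -((G q)⁻¹ * dirMat G q u * (G q)⁻¹) := by
  have h := dirMat_mul hG.diffMat (hG.inv hd).diffMat u
  have h1 : (fun x => G x * (G x)⁻¹) =ᶠ[𝓝 q] fun _ => 1 :=
    (hG.eventually_det_ne_zero hd).mono fun x hx => Matrix.mul_nonsing_inv _ hx.isUnit
  rw [dirMat_congr h1, dirMat_const] at h
  have h2 := congrArg (fun M => (G q)⁻¹ * M) h
  simp only [mul_zero, mul_add, ← mul_assoc, Matrix.nonsing_inv_mul _ hd.isUnit, one_mul] at h2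
  exact (neg_eq_of_add_eq_zero_right h2.symm).symm

theorem dirMat_metric_inv {G : Coord ι → Matrix ι ι ℝ} {q : Coord ι}
    (hG : ∀ᶠ x in 𝓝 q, (G x).IsSymm) (hs : SmoothMat G q) (hd : (G q).det ≠ 0) (u : ι → ℝ) :
    dirMat (fun x => (G x)⁻¹) q u = -(chr G q u * (G q)⁻¹) - (G q)⁻¹ * (chr G q u)ᵀ := by
  rw [dirMat_inv hs hd, dirMat_metric hG hd.isUnit]
  simp only [mul_add, add_mul, ← mul_assoc, Matrix.nonsing_inv_mul _ hd.isUnit, one_mul]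
  rw [mul_assoc ((G q)⁻¹ * _), Matrix.mul_nonsing_inv _ hd.isUnit, mul_one]
  abel

theorem dir_quadratic {M : Coord ι → Matrix ι ι ℝ} {q : Coord ι} (hM : DiffMat M q)
    (p u : ι → ℝ) : dir (fun x => p ⬝ᵥ M x *ᵥ p) q u = p ⬝ᵥ dirMat M q u *ᵥ p := by
  simp only [dotProduct, Matrix.mulVec]
  have h : ∀ α, DifferentiableAt ℝ (fun x => ∑ β, M x α β * p β) q := fun α =>
    DifferentiableAt.fun_sum fun β _ => (hM α β).mul_const _
  rw [dir_sum fun α _ => (h α).const_mul _]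
  refine Finset.sum_congr rfl fun α _ => ?_
  rw [dir_const_mul (h α), dir_sum fun β _ => (hM α β).mul_const _]
  congr 1
  refine Finset.sum_congr rfl fun β _ => ?_
  rw [dir_mul (hM α β) (differentiableAt_const _)]
  simp [dirMat]

theorem dot_mulVec (a b : ι → ℝ) (M : Matrix ι ι ℝ) : a ⬝ᵥ M *ᵥ b = Mᵀ *ᵥ a ⬝ᵥ b := by
  rw [Matrix.dotProduct_mulVec, Matrix.mulVec_transpose]

/-! ### Special conformal Killing tensors at a point -/

/-- `J` satisfies the special conformal Killing condition with the 1-form `c` at `q`. -/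
structure IsSCKTAt (G J : Coord ι → Matrix ι ι ℝ) (q : Coord ι) (c : ι → ℝ) : Prop where
  symm : ∀ᶠ x in 𝓝 q, (G x).IsSymm
  det_ne : (G q).det ≠ 0
  smooth_metric : SmoothMat G q
  smooth : SmoothMat J q
  self_adj : (G q * J q).IsSymm
  cov_eq : ∀ u, cov G J q u = (1 / 2 : ℝ) •
    (Matrix.vecMulVec ((G q)⁻¹ *ᵥ c) (G q *ᵥ u) + Matrix.vecMulVec u c)

namespace IsSCKTAt

variable {G J : Coord ι → Matrix ι ι ℝ} {q : Coord ι} {c : ι → ℝ}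

theorem dirMat_eq (h : IsSCKTAt G J q c) (u : ι → ℝ) :
    dirMat J q u = (1 / 2 : ℝ) •
      (Matrix.vecMulVec ((G q)⁻¹ *ᵥ c) (G q *ᵥ u) + Matrix.vecMulVec u c)
      + J q * chr G q u - chr G q u * J q := by
  rw [← h.cov_eq, cov]
  abel

theorem dirMat_mulVec (h : IsSCKTAt G J q c) (u x : ι → ℝ) :
    dirMat J q u *ᵥ x = (1 / 2 : ℝ) • ((G q *ᵥ u ⬝ᵥ x) • ((G q)⁻¹ *ᵥ c) + (c ⬝ᵥ x) • u)
      + J q *ᵥ (chr G q u *ᵥ x) - chr G q u *ᵥ (J q *ᵥ x) := by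
  rw [h.dirMat_eq]
  simp only [Matrix.sub_mulVec, Matrix.add_mulVec, Matrix.smul_mulVec, Matrix.vecMulVec_mulVec,
    Matrix.mulVec_mulVec, op_smul_eq_smul]

theorem metric_symm (h : IsSCKTAt G J q c) : (G q)ᵀ = G q := h.symm.self_of_nhds

theorem inv_symm (h : IsSCKTAt G J q c) : ((G q)⁻¹)ᵀ = (G q)⁻¹ := by
  rw [Matrix.transpose_nonsing_inv, h.metric_symm]

theorem metric_inv (h : IsSCKTAt G J q c) (x : ι → ℝ) : G q *ᵥ ((G q)⁻¹ *ᵥ x) = x := by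
  rw [Matrix.mulVec_mulVec, Matrix.mul_nonsing_inv _ h.det_ne.isUnit, Matrix.one_mulVec]

theorem inv_metric (h : IsSCKTAt G J q c) (x : ι → ℝ) : (G q)⁻¹ *ᵥ (G q *ᵥ x) = x := by
  rw [Matrix.mulVec_mulVec, Matrix.nonsing_inv_mul _ h.det_ne.isUnit, Matrix.one_mulVec]

theorem transpose_metric (h : IsSCKTAt G J q c) (x : ι → ℝ) :
    (J q)ᵀ *ᵥ (G q *ᵥ x) = G q *ᵥ (J q *ᵥ x) := by
  have := h.self_adj.eq
  rw [Matrix.transpose_mul, h.metric_symm] at this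
  rw [Matrix.mulVec_mulVec, Matrix.mulVec_mulVec, this]

theorem dot_metric (h : IsSCKTAt G J q c) (x y : ι → ℝ) : G q *ᵥ x ⬝ᵥ y = G q *ᵥ y ⬝ᵥ x := by
  rw [dotProduct_comm, dot_mulVec, h.metric_symm]

/-- Sandwich JᵀG = GJ between (adj J)ᵀ and adj J: each side collapses to det J times one side of the
claim, and det J can be cancelled. -/
theorem adjugate_self_adj (h : IsSCKTAt G J q c) (hd : (J q).det ≠ 0) :
    ((J q).adjugate)ᵀ * G q = G q * (J q).adjugate := by
  have h1 : (J q)ᵀ * G q = G q * J q := by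
    have := h.self_adj.eq
    rwa [Matrix.transpose_mul, h.metric_symm] at this
  have h2 : ((J q).adjugate)ᵀ * (J q)ᵀ = (J q).det • 1 := by
    rw [← Matrix.transpose_mul, Matrix.mul_adjugate, Matrix.transpose_smul, Matrix.transpose_one]
  have h3 : ((J q).adjugate)ᵀ * ((J q)ᵀ * G q) * (J q).adjugate
      = ((J q).adjugate)ᵀ * (G q * J q) * (J q).adjugate := by rw [h1]
  rw [← mul_assoc, h2, ← mul_assoc, mul_assoc _ (J q), Matrix.mul_adjugate] at h3
  simp only [Matrix.smul_mul, one_mul, Matrix.mul_smul, mul_one] at h3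
  exact (smul_right_injective _ hd h3).symm

theorem adjugate_inv_symm (h : IsSCKTAt G J q c) (hd : (J q).det ≠ 0) :
    ((J q).adjugate * (G q)⁻¹).IsSymm := by
  have h1 := congrArg (fun M => (G q)⁻¹ * M * (G q)⁻¹) (h.adjugate_self_adj hd)
  simp only [← mul_assoc, Matrix.nonsing_inv_mul _ h.det_ne.isUnit, one_mul] at h1
  rw [mul_assoc _ (G q), Matrix.mul_nonsing_inv _ h.det_ne.isUnit, mul_one] at h1
  rw [Matrix.IsSymm, Matrix.transpose_mul, h.inv_symm, h1]

/-- In Jacobi's formula the connection terms cancel under the trace because adj J commutes with J.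
The two rank-one terms of ∇J contribute equally, since adj J is self-adjoint, and this absorbs the
factor ½. -/
theorem dir_det_eq (h : IsSCKTAt G J q c) (hd : (J q).det ≠ 0) (u : ι → ℝ) :
    dir (fun x => (J x).det) q u = c ⬝ᵥ (J q).adjugate *ᵥ u := by
  rw [dir_det h.smooth.diffMat, h.dirMat_eq, mul_sub, mul_add, Matrix.trace_sub, Matrix.trace_add,
    ← mul_assoc, Matrix.adjugate_mul, ← mul_assoc, Matrix.trace_mul_comm (_ * _) (J q),
    ← mul_assoc (J q), Matrix.mul_adjugate, add_sub_assoc, sub_self, add_zero, Matrix.mul_smul,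
    mul_add, Matrix.mul_vecMulVec, Matrix.mul_vecMulVec, Matrix.trace_smul, Matrix.trace_add,
    Matrix.trace_vecMulVec, Matrix.trace_vecMulVec, dotProduct_comm _ (G q *ᵥ u), dot_mulVec,
    Matrix.mulVec_mulVec, h.adjugate_self_adj hd, ← Matrix.mulVec_mulVec, dot_mulVec,
    Matrix.mulVec_mulVec, dotProduct_comm _ c]
  rw [h.inv_symm, Matrix.nonsing_inv_mul _ h.det_ne.isUnit, Matrix.one_mulVec,
    dotProduct_comm _ c, smul_eq_mul]
  ring

/-- The connection terms form a commutator, and each of the two rank-one terms has trace c(u). So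
the gauge term d(tr J) ∧ Q in D_J Q is c ∧ Q. -/
theorem dir_trace_eq (h : IsSCKTAt G J q c) (u : ι → ℝ) :
    dir (fun x => (J x).trace) q u = c ⬝ᵥ u := by
  rw [dir_trace h.smooth.diffMat, h.dirMat_eq, Matrix.trace_sub, Matrix.trace_add,
    Matrix.trace_mul_comm (J q), add_sub_assoc, sub_self, add_zero, Matrix.trace_smul,
    Matrix.trace_add, Matrix.trace_vecMulVec, Matrix.trace_vecMulVec, dotProduct_comm,
    ← h.dot_metric, h.metric_inv, dotProduct_comm u c, smul_eq_mul]
  ring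

end IsSCKTAt

end Derivatives

/-! ### Identities for the cofactor tensor of a special conformal Killing tensor -/

section Identities

variable {ι : Type} [Fintype ι] [DecidableEq ι]

namespace IsSCKTAt

variable {G J : Coord ι → Matrix ι ι ℝ} {q : Coord ι} {c : ι → ℝ}

/-- The direction J u is the one needed for P_J(dH), and along it the derivative simplifies: A J u =
(det J) u, so every term acquires the factor det J that the derivative of the cofactor tensor
requires. -/
theorem dir_quadratic_cofactor (h : IsSCKTAt G J q c) (hd : (J q).det ≠ 0) (p u : ι → ℝ) :
    dir (fun x => p ⬝ᵥ ((J x).adjugate * (G x)⁻¹) *ᵥ p) q (J q *ᵥ u)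
      = (c ⬝ᵥ u) * (p ⬝ᵥ (J q).adjugate *ᵥ ((G q)⁻¹ *ᵥ p))
        - (c ⬝ᵥ (J q).adjugate *ᵥ ((G q)⁻¹ *ᵥ p)) * (p ⬝ᵥ u)
        - 2 * (p ⬝ᵥ chr G q (J q *ᵥ u) *ᵥ ((J q).adjugate *ᵥ ((G q)⁻¹ *ᵥ p))) := by
  have hM := h.smooth.adjugate.mul (h.smooth_metric.inv h.det_ne)
  rw [dir_quadratic hM.diffMat,
    dirMat_mul h.smooth.adjugate.diffMat (h.smooth_metric.inv h.det_ne).diffMat,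
    dirMat_metric_inv h.symm h.smooth_metric h.det_ne]
  -- The derivative of the cofactor tensor is known only after multiplication by det J.
  apply mul_left_cancel₀ hd
  set d := (J q).det with hddef
  set A := (J q).adjugate with hA
  set v := (G q)⁻¹ *ᵥ p with hv
  set w := A *ᵥ v with hw
  set z := J q *ᵥ u with hz
  have hAJ : ∀ x, A *ᵥ (J q *ᵥ x) = d • x := fun x => by
    rw [Matrix.mulVec_mulVec, Matrix.adjugate_mul, Matrix.smul_mulVec, Matrix.one_mulVec]
  have hJA : ∀ x, J q *ᵥ (A *ᵥ x) = d • x := fun x => by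
    rw [Matrix.mulVec_mulVec, Matrix.mul_adjugate, Matrix.smul_mulVec, Matrix.one_mulVec]
  have hp : G q *ᵥ v = p := h.metric_inv p
  have hpA : ∀ x, p ⬝ᵥ A *ᵥ x = G q *ᵥ w ⬝ᵥ x := fun x => by
    rw [dot_mulVec, ← hp, Matrix.mulVec_mulVec, h.adjugate_self_adj hd, ← Matrix.mulVec_mulVec]
  have hGJ : ∀ x, G q *ᵥ w ⬝ᵥ J q *ᵥ x = d * (p ⬝ᵥ x) := fun x => by
    rw [dot_mulVec, h.transpose_metric, hw, hJA, Matrix.mulVec_smul, hp, smul_dotProduct,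
      smul_eq_mul]
  have hGi : ∀ x, G q *ᵥ w ⬝ᵥ (G q)⁻¹ *ᵥ x = w ⬝ᵥ x := fun x => by
    rw [dot_mulVec, h.inv_symm, h.inv_metric]
  have key : d • (dirMat (fun x => (J x).adjugate) q z * (G q)⁻¹) *ᵥ p
      = dir (fun x => (J x).det) q z • w - A *ᵥ (dirMat J q z *ᵥ w) := by
    rw [← Matrix.smul_mulVec, ← Matrix.smul_mul, dirMat_adjugate h.smooth, ← Matrix.mulVec_mulVec,
      Matrix.sub_mulVec, Matrix.smul_mulVec, ← Matrix.mulVec_mulVec, ← Matrix.mulVec_mulVec]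
  have hAG : A *ᵥ ((-(chr G q z * (G q)⁻¹) - (G q)⁻¹ * (chr G q z)ᵀ) *ᵥ p)
      = -(A *ᵥ (chr G q z *ᵥ v)) - A *ᵥ ((G q)⁻¹ *ᵥ ((chr G q z)ᵀ *ᵥ p)) := by
    rw [Matrix.sub_mulVec, Matrix.neg_mulVec, ← Matrix.mulVec_mulVec, ← Matrix.mulVec_mulVec,
      Matrix.mulVec_sub, Matrix.mulVec_neg]
  clear_value w v
  have h1 : d * (p ⬝ᵥ (dirMat (fun x => (J x).adjugate) q z * (G q)⁻¹
      + A * (-(chr G q z * (G q)⁻¹) - (G q)⁻¹ * (chr G q z)ᵀ)) *ᵥ p)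
      = dir (fun x => (J x).det) q z * (p ⬝ᵥ w) - G q *ᵥ w ⬝ᵥ (dirMat J q z *ᵥ w)
        - d * (G q *ᵥ w ⬝ᵥ chr G q z *ᵥ v) - d * (p ⬝ᵥ chr G q z *ᵥ w) := by
    rw [Matrix.add_mulVec, ← Matrix.mulVec_mulVec (M := A), hAG, dotProduct_add, mul_add,
      ← smul_eq_mul, ← dotProduct_smul, key, dotProduct_sub, dotProduct_smul, smul_eq_mul,
      dotProduct_sub, dotProduct_neg, hpA (dirMat J q z *ᵥ w), hpA (chr G q z *ᵥ v),
      hpA ((G q)⁻¹ *ᵥ _), hGi ((chr G q z)ᵀ *ᵥ p), dotProduct_comm w,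
      ← dot_mulVec p]
    ring
  rw [h1, h.dir_det_eq hd, ← hA, hz, hAJ, ← hz, h.dirMat_mulVec, dotProduct_sub, dotProduct_add,
    hGJ, hw, hJA, ← hw, Matrix.mulVec_smul, dotProduct_smul, dotProduct_smul, dotProduct_smul,
    dotProduct_add, dotProduct_smul, dotProduct_smul, hGi, hz, hGJ, ← hz,
    h.dot_metric z, hz, hGJ, ← hz, dotProduct_comm w c]
  simp only [smul_eq_mul]
  ring

/-- Of the four terms of dJ(u)w, those with g(u, w) and with J Γ(u) w are symmetric in u and w and
drop out. The result computes both the p-quadratic part of P_J and the torsion-like term of d_J Q.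
-/
theorem dotProduct_dirMat_antisymm (h : IsSCKTAt G J q c) (p u w : ι → ℝ) :
    p ⬝ᵥ dirMat J q u *ᵥ w - p ⬝ᵥ dirMat J q w *ᵥ u
      = (1 / 2) * ((c ⬝ᵥ w) * (p ⬝ᵥ u) - (c ⬝ᵥ u) * (p ⬝ᵥ w))
        - p ⬝ᵥ chr G q u *ᵥ (J q *ᵥ w) + p ⬝ᵥ chr G q w *ᵥ (J q *ᵥ u) := by
  rw [h.dirMat_mulVec, h.dirMat_mulVec, chr_mulVec_comm h.symm u w, h.dot_metric w u]
  simp only [dotProduct_sub, dotProduct_add, dotProduct_smul, smul_eq_mul]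
  ring

/-- The cofactor tensor of a nonsingular special conformal Killing tensor turns `Q` into a closed
form when `D_J Q = 0`. -/
theorem closed_of_det_ne (h : IsSCKTAt G J q c) (hd : (J q).det ≠ 0) {Q : Coord ι → ι → ℝ}
    (hQ : ∀ α, DifferentiableAt ℝ (fun x => Q x α) q)
    (hg : ∀ x y, dirVec Q q (J q *ᵥ y) ⬝ᵥ x - dirVec Q q (J q *ᵥ x) ⬝ᵥ y
      - Q q ⬝ᵥ (dirMat J q y *ᵥ x - dirMat J q x *ᵥ y)
      + ((c ⬝ᵥ y) * (Q q ⬝ᵥ x) - (c ⬝ᵥ x) * (Q q ⬝ᵥ y)) = 0) (x y : ι → ℝ) :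
    dirVec (fun z => ((J z).adjugate)ᵀ *ᵥ Q z) q x ⬝ᵥ y
      = dirVec (fun z => ((J z).adjugate)ᵀ *ᵥ Q z) q y ⬝ᵥ x := by
  set d := (J q).det with hddef
  set A := (J q).adjugate with hA
  set θ : Coord ι → ι → ℝ := fun z => ((J z).adjugate)ᵀ *ᵥ Q z with hθ
  have hθd : ∀ α, DifferentiableAt ℝ (fun x => θ x α) q :=
    h.smooth.adjugate.transpose.diffMat.mulVec hQ
  have hJθ : ∀ z, (J z)ᵀ *ᵥ θ z = ((J z).det • (1 : Matrix ι ι ℝ)) *ᵥ Q z := fun z => by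
    rw [hθ, Matrix.mulVec_mulVec, ← Matrix.transpose_mul, Matrix.adjugate_mul,
      Matrix.transpose_smul, Matrix.transpose_one]
  have hdd : DiffMat (fun z => (J z).det • (1 : Matrix ι ι ℝ)) q := fun α β =>
    (h.smooth.det.differentiableAt (by simp)).mul_const ((1 : Matrix ι ι ℝ) α β)
  -- The product rule for Jᵀθ = (det J) Q, which gives the derivative of θ without inverting J.
  have hder : ∀ z x, θ q ⬝ᵥ dirMat J q z *ᵥ x + dirVec θ q z ⬝ᵥ J q *ᵥ x
      = (c ⬝ᵥ A *ᵥ z) * (Q q ⬝ᵥ x) + d * (dirVec Q q z ⬝ᵥ x) := fun z x => by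
    have h1 := dirVec_mulVec h.smooth.transpose.diffMat hθd z
    have h2 := dirVec_mulVec hdd hQ z
    have h3 : (fun x => (J x)ᵀ *ᵥ θ x) = fun z => ((J z).det • (1 : Matrix ι ι ℝ)) *ᵥ Q z :=
      funext hJθ
    rw [h3, h2, dirMat_scalar, dirMat_transpose, h.dir_det_eq hd] at h1
    have h4 := congrArg (fun a => a ⬝ᵥ x) h1
    simp only [Matrix.smul_mulVec, Matrix.one_mulVec, add_dotProduct, smul_dotProduct,
      smul_eq_mul] at h4
    rw [dot_mulVec, dot_mulVec, ← h4]
  have hAJ : ∀ x, A *ᵥ (J q *ᵥ x) = d • x := fun x => by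
    rw [Matrix.mulVec_mulVec, Matrix.adjugate_mul, Matrix.smul_mulVec, Matrix.one_mulVec]
  have hθJ : ∀ x, θ q ⬝ᵥ J q *ᵥ x = d * (Q q ⬝ᵥ x) := fun x => by
    rw [dot_mulVec, hJθ, Matrix.smul_mulVec, Matrix.one_mulVec, smul_dotProduct, smul_eq_mul]
  have hGJ : ∀ x y, G q *ᵥ (J q *ᵥ y) ⬝ᵥ x = G q *ᵥ (J q *ᵥ x) ⬝ᵥ y := fun x y => by
    rw [h.dot_metric, dot_mulVec, h.transpose_metric]
  have main : ∀ x y, dirVec θ q (J q *ᵥ y) ⬝ᵥ J q *ᵥ x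
      = dirVec θ q (J q *ᵥ x) ⬝ᵥ J q *ᵥ y := fun x y => by
    have h1 := hder (J q *ᵥ y) x
    have h2 := hder (J q *ᵥ x) y
    have h3 := hg x y
    rw [dotProduct_sub, h.dotProduct_dirMat_antisymm] at h3
    simp only [hAJ, h.dirMat_mulVec, dotProduct_sub, dotProduct_add, dotProduct_smul, hθJ,
      smul_eq_mul] at h1 h2
    rw [hGJ x y, chr_mulVec_comm h.symm (J q *ᵥ y) (J q *ᵥ x),
      chr_mulVec_comm h.symm (J q *ᵥ y) x] at h1
    rw [chr_mulVec_comm h.symm (J q *ᵥ x) y] at h2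
    -- Evaluated along J y and J x, all terms carry the factor det J; antisymmetrising leaves det J
    -- times the condition D_J Q = 0.
    linear_combination h1 - h2 + d * h3
  -- As J is invertible, closedness on vectors of the form J x, J y is closedness.
  have hsurj : ∀ x, J q *ᵥ (d⁻¹ • A *ᵥ x) = x := fun x => by
    rw [Matrix.mulVec_smul, Matrix.mulVec_mulVec, Matrix.mul_adjugate, Matrix.smul_mulVec,
      Matrix.one_mulVec, smul_smul, inv_mul_cancel₀ hd, one_smul]
  have := main (d⁻¹ • A *ᵥ y) (d⁻¹ • A *ᵥ x)
  rwa [hsurj, hsurj] at this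

end IsSCKTAt

end Identities

/-! ### The Hamiltonian form of the equations of motion -/

section Hamiltonian

variable {ι : Type} [Fintype ι] [DecidableEq ι]

/-- The coordinate sums become a derivative along J ∂_β and an antisymmetrised derivative of J
paired with p, the two quantities computed above. -/
theorem poissonP_eq (J : Coord ι → Matrix ι ι ℝ) (F : Coord ι → Coord ι → ℝ) (q p : Coord ι)
    (β : ι) :
    poissonP J F q p β = -dir (fun x => F x p) q (J q *ᵥ Pi.single β 1)
      - (p.ofLp ⬝ᵥ dirMat J q (Pi.single β 1) *ᵥ (fun α => pd (fun s => F q s) p α)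
        - p.ofLp ⬝ᵥ dirMat J q (fun α => pd (fun s => F q s) p α) *ᵥ Pi.single β 1) := by
  have h1 : dir (fun x => F x p) q (J q *ᵥ Pi.single β 1)
      = ∑ α, J q α β * pd (fun x => F x p) q α := by
    rw [dir_eq_sum]
    exact Finset.sum_congr rfl fun α _ => by simp [mul_comm]
  have h2 : p.ofLp ⬝ᵥ dirMat J q (Pi.single β 1) *ᵥ (fun α => pd (fun s => F q s) p α)
      = ∑ α, ∑ γ, p γ * pd (fun x => J x γ α) q β * pd (fun s => F q s) p α := by
    simp only [dotProduct, Matrix.mulVec, Finset.mul_sum]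
    rw [Finset.sum_comm]
    exact Finset.sum_congr rfl fun α _ => Finset.sum_congr rfl fun γ _ => by
      rw [dirMat, dir_single, mul_assoc]
  have h3 : p.ofLp ⬝ᵥ dirMat J q (fun α => pd (fun s => F q s) p α) *ᵥ Pi.single β 1
      = ∑ α, ∑ γ, p γ * pd (fun x => J x γ β) q α * pd (fun s => F q s) p α := by
    rw [Finset.sum_comm]
    simp only [dotProduct, Matrix.mulVec_single_one, Matrix.col_apply, dirMat_eq_sum,
      Finset.mul_sum]
    exact Finset.sum_congr rfl fun α _ => Finset.sum_congr rfl fun γ _ => by ring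
  rw [poissonP, h1, h2, h3, ← Finset.sum_sub_distrib]
  congr 1
  refine Finset.sum_congr rfl fun α _ => ?_
  rw [← Finset.sum_sub_distrib]
  exact Finset.sum_congr rfl fun γ _ => by ring

/-- Differentiating the metric along v gives, by ∇g = 0, the terms G Γ(v) v and Γ(v)ᵀ G v. The first
cancels the geodesic part of the force, the second is Γ(v)ᵀ p, and vanishing torsion moves ∂_α into
the connection. -/
theorem hatP_eq {G : Coord ι → Matrix ι ι ℝ} {q : Coord ι}
    (hG : ∀ᶠ x in 𝓝 q, (G x).IsSymm) (hd : (G q).det ≠ 0) (Q : Coord ι → ι → ℝ) (p : Coord ι)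
    (α : ι) :
    hatP G Q q p α
      = p.ofLp ⬝ᵥ chr G q (Pi.single α 1) *ᵥ ((G q)⁻¹ *ᵥ p.ofLp) + Q q α := by
  set v : ι → ℝ := (G q)⁻¹ *ᵥ p.ofLp with hv
  have h1 : (∑ β, ∑ γ, pd (fun x => G x α β) q γ * hatQ G q p γ * hatQ G q p β)
      = (dirMat G q v *ᵥ v) α := by
    simp only [Matrix.mulVec, dotProduct, dirMat_eq_sum, Finset.sum_mul]
    rfl
  have h2 : (sode G Q q (hatQ G q p)).ofLp = -(chr G q v *ᵥ v) + (G q)⁻¹ *ᵥ Q q := by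
    ext δ
    simp only [sode, Pi.add_apply, Pi.neg_apply, Matrix.mulVec, dotProduct, chr, Finset.sum_mul]
    congr 2
    exact Finset.sum_congr rfl fun β _ => Finset.sum_congr rfl fun γ _ => by
      change _ * v β * v γ = _
      ring
  have h3 : ∑ β, G q α β * sode G Q q (hatQ G q p) β
      = (G q *ᵥ (sode G Q q (hatQ G q p)).ofLp) α := rfl
  have hGv : G q *ᵥ v = p.ofLp := by
    rw [Matrix.mulVec_mulVec, Matrix.mul_nonsing_inv _ hd.isUnit, Matrix.one_mulVec]
  change (∑ β, ∑ γ, pd (fun x => G x α β) q γ * hatQ G q p γ * hatQ G q p β)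
      + ∑ β, G q α β * sode G Q q (hatQ G q p) β = _
  rw [h1, h3, h2, dirMat_metric hG hd.isUnit, Matrix.add_mulVec, Matrix.mulVec_add,
    Matrix.mulVec_mulVec (Q q), Matrix.mul_nonsing_inv _ hd.isUnit, Matrix.one_mulVec,
    ← Matrix.mulVec_mulVec, ← Matrix.mulVec_mulVec, hGv, Matrix.mulVec_neg,
    chr_mulVec_comm hG (Pi.single α 1), dot_mulVec, dotProduct_single, mul_one]
  simp only [Pi.add_apply, Pi.neg_apply, Matrix.mulVec_mulVec]
  ring

/-- The function `½ A^{αβ} p_α p_β + W` of the cofactor tensor `A` of `J`. -/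
def cofactorHamiltonian (G J : Coord ι → Matrix ι ι ℝ) (W : Coord ι → ℝ) (q p : Coord ι) : ℝ :=
  (1 / 2) * (p.ofLp ⬝ᵥ ((J q).adjugate * (G q)⁻¹) *ᵥ p.ofLp) + W q

theorem pd_quadratic (M : Matrix ι ι ℝ) (hM : M.IsSymm) (c : ℝ) (p : Coord ι) (α : ι) :
    pd (fun s : Coord ι => (1 / 2) * (s.ofLp ⬝ᵥ M *ᵥ s.ofLp) + c) p α = (M *ᵥ p.ofLp) α := by
  have h1 : ∀ β, HasFDerivAt (fun s : Coord ι => s.ofLp β)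
      (EuclideanSpace.proj β : Coord ι →L[ℝ] ℝ) p := fun β =>
    (EuclideanSpace.proj β : Coord ι →L[ℝ] ℝ).hasFDerivAt
  have h2 : HasFDerivAt (fun s : Coord ι => (1 / 2) * (s.ofLp ⬝ᵥ M *ᵥ s.ofLp) + c) _ p :=
    ((HasFDerivAt.fun_sum (u := Finset.univ) fun β _ => (h1 β).mul
      (HasFDerivAt.fun_sum (u := Finset.univ) fun γ _ => (h1 γ).const_mul (M β γ))).const_mul
        (1 / 2)).add_const c
  have h3 : ∑ β, p.ofLp β * M β α = (M *ᵥ p.ofLp) α := by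
    rw [Matrix.mulVec, dotProduct]
    exact Finset.sum_congr rfl fun β _ => by rw [hM.apply, mul_comm]
  have hproj : ∀ β, (EuclideanSpace.proj β : Coord ι →L[ℝ] ℝ) (EuclideanSpace.single α 1)
      = if β = α then 1 else 0 := fun β => PiLp.single_apply 2 ℝ α 1 β
  rw [pd, h2.fderiv]
  simp only [_root_.smul_apply, _root_.add_apply, _root_.sum_apply, hproj, smul_eq_mul, mul_ite,
    mul_one, mul_zero, Finset.sum_ite_eq', Finset.mem_univ, if_true, Finset.sum_add_distrib, h3]
  rw [Matrix.mulVec, dotProduct]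
  ring

namespace IsSCKTAt

variable {G J : Coord ι → Matrix ι ι ℝ} {q : Coord ι} {c : ι → ℝ}

theorem pd_cofactorHamiltonian (h : IsSCKTAt G J q c) (hd : (J q).det ≠ 0) (W : Coord ι → ℝ)
    (p : Coord ι) :
    (fun α => pd (fun s => cofactorHamiltonian G J W q s) p α)
      = (J q).adjugate *ᵥ ((G q)⁻¹ *ᵥ p.ofLp) := by
  ext α
  rw [Matrix.mulVec_mulVec]
  exact pd_quadratic _ (h.adjugate_inv_symm hd) _ _ _

/-- By symmetry of A g⁻¹ the momentum gradient of H is A g⁻¹ p, and J A = det J. -/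
theorem det_mul_hatQ (h : IsSCKTAt G J q c) (hd : (J q).det ≠ 0) (W : Coord ι → ℝ)
    (p : Coord ι) (α : ι) :
    (J q).det * hatQ G q p α = poissonQ J (cofactorHamiltonian G J W) q p α := by
  change _ = (J q *ᵥ fun α => pd (fun s => cofactorHamiltonian G J W q s) p α) α
  rw [h.pd_cofactorHamiltonian hd, Matrix.mulVec_mulVec, Matrix.mul_adjugate, Matrix.smul_mulVec,
    Matrix.one_mulVec]
  rfl

/-- The terms with c coming from the quadratic part of H cancel those from the antisymmetrised
derivative of J, and so do the connection terms along J ∂_α. What remains is det J times p · Γ(∂_α)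
g⁻¹p + Q_α. -/
theorem det_mul_hatP (h : IsSCKTAt G J q c) (hd : (J q).det ≠ 0) {Q : Coord ι → ι → ℝ}
    {W : Coord ι → ℝ} (hW : DifferentiableAt ℝ W q)
    (hWQ : ∀ β, pd W q β = -(((J q).adjugate)ᵀ *ᵥ Q q) β) (p : Coord ι) (α : ι) :
    (J q).det * hatP G Q q p α = poissonP J (cofactorHamiltonian G J W) q p α := by
  have hM := (h.smooth.adjugate.mul (h.smooth_metric.inv h.det_ne)).diffMat
  have hMd : DifferentiableAt ℝ
      (fun x => p.ofLp ⬝ᵥ ((J x).adjugate * (G x)⁻¹) *ᵥ p.ofLp) q := by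
    simp only [dotProduct, Matrix.mulVec]
    exact DifferentiableAt.fun_sum fun β _ => (DifferentiableAt.fun_sum fun γ _ =>
      (hM β γ).mul_const _).const_mul _
  -- Here dW = -AᵀQ is evaluated on J u, and A J = det J.
  have hWd : ∀ u, dir W q (J q *ᵥ u) = -((J q).det * (Q q ⬝ᵥ u)) := fun u => by
    have h1 : dir W q (J q *ᵥ u) = -((((J q).adjugate)ᵀ *ᵥ Q q) ⬝ᵥ J q *ᵥ u) := by
      rw [dir_eq_sum, dotProduct, ← Finset.sum_neg_distrib]
      exact Finset.sum_congr rfl fun β _ => by rw [hWQ]; ring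
    rw [h1, ← dot_mulVec, Matrix.mulVec_mulVec, Matrix.adjugate_mul, Matrix.smul_mulVec,
      Matrix.one_mulVec, dotProduct_smul, smul_eq_mul]
  have hJA : ∀ x, J q *ᵥ ((J q).adjugate *ᵥ x) = (J q).det • x := fun x => by
    rw [Matrix.mulVec_mulVec, Matrix.mul_adjugate, Matrix.smul_mulVec, Matrix.one_mulVec]
  rw [poissonP_eq, h.pd_cofactorHamiltonian hd, h.dotProduct_dirMat_antisymm, hJA,
    hatP_eq h.symm h.det_ne]
  have h1 : dir (fun x => cofactorHamiltonian G J W x p) q (J q *ᵥ Pi.single α 1)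
      = (1 / 2) * dir (fun x => p.ofLp ⬝ᵥ ((J x).adjugate * (G x)⁻¹) *ᵥ p.ofLp) q
          (J q *ᵥ Pi.single α 1) + dir W q (J q *ᵥ Pi.single α 1) := by
    simp only [cofactorHamiltonian]
    rw [dir_add (hMd.const_mul _) hW, dir_const_mul hMd]
  rw [h1, h.dir_quadratic_cofactor hd, hWd,
    chr_mulVec_comm h.symm _ (J q *ᵥ Pi.single α 1), Matrix.mulVec_smul, dotProduct_smul,
    smul_eq_mul, dotProduct_single (Q q), mul_one]
  ring

end IsSCKTAt

end Hamiltonian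

/-! ### The pencil `J + X P` -/

section Pencil

variable {ι : Type} [Fintype ι] [DecidableEq ι]

/-- The matrix `J + X P` over the polynomial ring. -/
def pencil (J P : Matrix ι ι ℝ) : Matrix ι ι ℝ[X] :=
  J.map Polynomial.C + (Polynomial.X : ℝ[X]) • P.map Polynomial.C

theorem eval_pencil (J P : Matrix ι ι ℝ) (a : ℝ) :
    (pencil J P).map (Polynomial.evalRingHom a) = J + a • P := by
  ext α β
  simp [pencil]
  exact mul_comm _ _

theorem eval_det_pencil (J P : Matrix ι ι ℝ) (a : ℝ) :
    (pencil J P).det.eval a = (J + a • P).det := by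
  rw [← eval_pencil, ← RingHom.mapMatrix_apply, ← RingHom.map_det]
  rfl

theorem det_pencil_ne_zero {J : Matrix ι ι ℝ} (hJ : J.det ≠ 0) (P : Matrix ι ι ℝ) :
    (pencil J P).det ≠ 0 := by
  intro h
  apply hJ
  have := eval_det_pencil J P 0
  rwa [h, Polynomial.eval_zero, zero_smul, add_zero, eq_comm] at this

/-- By the Schur complement, det(J + X A B) is the determinant of the block matrix with rows (J, -A)
and (X B, 1), in which only n rows contain X, each to degree at most one. -/
theorem natDegree_det_pencil_le {n : ℕ} (J : Matrix ι ι ℝ) (A : Matrix ι (Fin n) ℝ)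
    (B : Matrix (Fin n) ι ℝ) : (pencil J (A * B)).det.natDegree ≤ n := by
  set M : Matrix (ι ⊕ Fin n) (ι ⊕ Fin n) ℝ[X] := Matrix.fromBlocks (J.map Polynomial.C)
    (-(A.map Polynomial.C)) ((Polynomial.X : ℝ[X]) • B.map Polynomial.C) 1 with hM
  have h1 : (pencil J (A * B)).det = M.det := by
    rw [hM, Matrix.det_fromBlocks_one₂₂, pencil, Matrix.map_mul]
    simp
  have h2 : ∀ i j, (M i j).natDegree ≤ Sum.elim (fun _ => 0) (fun _ => 1) i := by
    rintro (i | i) (j | j)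
    · simp [hM]
    · simp [hM, ← map_neg]
    · simp only [hM, Matrix.fromBlocks_apply₂₁, Matrix.smul_apply, Matrix.map_apply, smul_eq_mul,
        Sum.elim_inr]
      exact (Polynomial.natDegree_mul_C_le _ _).trans Polynomial.natDegree_X_le
    · by_cases h : i = j <;> simp [hM, h]
  -- The degree bound depends on the row; after transposition each factor of a Leibniz term is
  -- labelled by its row.
  rw [h1, ← Matrix.det_transpose, Matrix.det_apply]
  refine Polynomial.natDegree_sum_le_of_forall_le _ _ fun σ _ => ?_
  refine (Polynomial.natDegree_smul_le _ _).trans ?_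
  refine (Polynomial.natDegree_prod_le _ _).trans ?_
  refine (Finset.sum_le_sum fun i _ => h2 i (σ i)).trans ?_
  simp

/-- A cofactor is the determinant of the pencil with row `j` replaced by a constant unit row.
Setting row `j` of `A` to zero shows that this is again a pencil whose second matrix factors through
n dimensions. -/
theorem natDegree_adjugate_pencil_le {n : ℕ} (J : Matrix ι ι ℝ) (A : Matrix ι (Fin n) ℝ)
    (B : Matrix (Fin n) ι ℝ) (i j : ι) :
    ((pencil J (A * B)).adjugate i j).natDegree ≤ n := by
  have h : (pencil J (A * B)).updateRow j (Pi.single i 1)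
      = pencil (J.updateRow j (Pi.single i 1)) (A.updateRow j 0 * B) := by
    ext1 α β
    by_cases hα : α = j
    · subst hα
      by_cases hβ : β = i <;> simp [pencil, Matrix.mul_apply, hβ]
    · simp [pencil, Matrix.mul_apply, Matrix.updateRow_ne hα]
  rw [Matrix.adjugate_apply, h]
  exact natDegree_det_pencil_le _ _ _

theorem adjugate_add_smul_eq_sum {n : ℕ} (J : Matrix ι ι ℝ) (A : Matrix ι (Fin n) ℝ)
    (B : Matrix (Fin n) ι ℝ) (a : ℝ) :
    (J + a • (A * B)).adjugate
      = ∑ k : Fin (n + 1), a ^ (k : ℕ) • cofCoeff J (A * B) k := by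
  ext α β
  rw [← eval_pencil, ← RingHom.mapMatrix_apply, ← RingHom.map_adjugate, RingHom.mapMatrix_apply,
    Matrix.map_apply, Polynomial.coe_evalRingHom, Polynomial.eval_eq_sum_range'
      (Nat.lt_succ_of_le (natDegree_adjugate_pencil_le J A B α β)), Matrix.sum_apply,
    Finset.sum_range]
  exact Finset.sum_congr rfl fun k _ => mul_comm _ _

theorem det_add_smul_eq_sum {n : ℕ} (J : Matrix ι ι ℝ) (A : Matrix ι (Fin n) ℝ)
    (B : Matrix (Fin n) ι ℝ) (a : ℝ) :
    (J + a • (A * B)).det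
      = ∑ k : Fin (n + 1), a ^ (k : ℕ) * (pencil J (A * B)).det.coeff k := by
  rw [← eval_det_pencil, Polynomial.eval_eq_sum_range'
    (Nat.lt_succ_of_le (natDegree_det_pencil_le J A B)), Finset.sum_range]
  exact Finset.sum_congr rfl fun k _ => mul_comm _ _

end Pencil

/-! ### Comparison of coefficients in the pencil parameter -/

section PolynomialFunctions

theorem sum_pow_coeff {N : ℕ} (c : Fin N → ℝ) (k : Fin N) :
    (∑ i : Fin N, Polynomial.C (c i) * Polynomial.X ^ (i : ℕ)).coeff k = c k := by
  simp [Polynomial.coeff_C_mul, Polynomial.coeff_X_pow,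
    Fin.val_inj]

/-- The product of `d` with the polynomial vanishes at every real number, and `d` is nonzero. With
`d` = det(J + XP) this extracts coefficients from identities known only where J + aP is nonsingular.
-/
theorem eq_zero_of_sum_pow {N : ℕ} {d : ℝ[X]} (hd : d ≠ 0) {c : Fin N → ℝ}
    (h : ∀ a : ℝ, d.eval a ≠ 0 → ∑ k : Fin N, a ^ (k : ℕ) * c k = 0) (k : Fin N) : c k = 0 := by
  set f : ℝ[X] := ∑ i : Fin N, Polynomial.C (c i) * Polynomial.X ^ (i : ℕ) with hf
  have h1 : d * f = 0 := by
    apply Polynomial.funext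
    intro a
    by_cases ha : d.eval a = 0
    · simp [ha]
    · have : f.eval a = 0 := by
        rw [← h a ha, hf, Polynomial.eval_finsetSum]
        exact Finset.sum_congr rfl fun i _ => by simp [mul_comm (c i)]
      simp [this]
  have h2 := (mul_eq_zero.mp h1).resolve_left hd
  rw [← sum_pow_coeff c k, ← hf, h2, Polynomial.coeff_zero]

/-- The complement of the finite root set of `d` is dense. -/
theorem eq_of_continuous_of_eval_ne_zero {d : ℝ[X]} (hd : d ≠ 0) {f h : ℝ → ℝ}
    (hf : Continuous f) (hh : Continuous h) (e : ∀ a : ℝ, d.eval a ≠ 0 → f a = h a) : f = h := by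
  refine Continuous.ext_on (s := {a | d.eval a ≠ 0}) ?_ hf hh e
  have : {a | d.eval a ≠ 0} = (d.rootSet ℝ)ᶜ := by
    ext a
    simp [Polynomial.mem_rootSet, hd]
  rw [this]
  exact (Polynomial.rootSet_finite d ℝ).countable.dense_compl ℝ

/-- The right-hand side has degree at most n, and on the left a^(n+1) occurs only with the
coefficient `y (Fin.last n)`. -/
theorem last_eq_zero_of_sum_pow {n : ℕ} {x y z : Fin (n + 1) → ℝ}
    (h : ∀ a : ℝ, ∑ k : Fin (n + 1), a ^ (k : ℕ) * (x k + a * y k)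
      = ∑ k : Fin (n + 1), a ^ (k : ℕ) * z k) : y (Fin.last n) = 0 := by
  set f : ℝ[X] := ∑ i : Fin (n + 1), Polynomial.C (x i - z i) * Polynomial.X ^ (i : ℕ) with hf
  set f' : ℝ[X] := ∑ i : Fin (n + 1), Polynomial.C (y i) * Polynomial.X ^ (i : ℕ) with hf'
  have h1 : f + f' * Polynomial.X = 0 := by
    apply Polynomial.funext
    intro a
    simp only [hf, hf', Polynomial.eval_add, Polynomial.eval_mul, Polynomial.eval_X,
      Polynomial.eval_finsetSum, Polynomial.eval_C, Polynomial.eval_pow, Polynomial.eval_zero,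
      Finset.sum_mul]
    rw [← Finset.sum_add_distrib, ← sub_eq_zero.mpr (h a), ← Finset.sum_sub_distrib]
    exact Finset.sum_congr rfl fun k _ => by ring
  have h2 : f.coeff (n + 1) = 0 := by
    rw [hf, Polynomial.finsetSum_coeff]
    refine Finset.sum_eq_zero fun i _ => ?_
    rw [Polynomial.coeff_C_mul_X_pow, if_neg]
    have := i.2
    omega
  have h3 : f'.coeff n = y (Fin.last n) := sum_pow_coeff y (Fin.last n)
  have h4 := congrArg (fun r : ℝ[X] => r.coeff (n + 1)) h1
  simp only [Polynomial.coeff_add, Polynomial.coeff_mul_X, h2, h3, zero_add,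
    Polynomial.coeff_zero] at h4
  exact h4

end PolynomialFunctions

/-! ### Smooth dependence of the cofactor coefficients on the point -/

section SmoothPolynomials

variable {ι : Type} [Fintype ι] [DecidableEq ι]
  {E : Type*} [NormedAddCommGroup E] [NormedSpace ℝ E]

/-- Smoothness at a point of a polynomial-valued function, coefficient by coefficient. -/
def SmoothPoly (f : E → ℝ[X]) (x : E) : Prop :=
  ∀ k, ContDiffAt ℝ ∞ (fun y => (f y).coeff k) x

theorem SmoothPoly.const (c : ℝ[X]) (x : E) : SmoothPoly (fun _ => c) x :=
  fun _ => contDiffAt_const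

theorem SmoothPoly.mul {f h : E → ℝ[X]} {x : E} (hf : SmoothPoly f x) (hh : SmoothPoly h x) :
    SmoothPoly (fun y => f y * h y) x := by
  intro k
  simp only [Polynomial.coeff_mul]
  exact ContDiffAt.sum fun i _ => (hf i.1).mul (hh i.2)

theorem SmoothPoly.sum {κ : Type*} {s : Finset κ} {f : κ → E → ℝ[X]} {x : E}
    (hf : ∀ i ∈ s, SmoothPoly (f i) x) : SmoothPoly (fun y => ∑ i ∈ s, f i y) x := by
  intro k
  simp only [Polynomial.finsetSum_coeff]
  exact ContDiffAt.sum fun i hi => hf i hi k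

theorem SmoothPoly.prod {κ : Type*} {s : Finset κ} {f : κ → E → ℝ[X]} {x : E}
    (hf : ∀ i ∈ s, SmoothPoly (f i) x) : SmoothPoly (fun y => ∏ i ∈ s, f i y) x := by
  classical
  induction s using Finset.induction_on with
  | empty => simpa using SmoothPoly.const 1 x
  | insert i s hi ih =>
    simp only [Finset.prod_insert hi]
    exact (hf i (Finset.mem_insert_self i s)).mul
      (ih fun j hj => hf j (Finset.mem_insert_of_mem hj))

/-- Coefficients of sums and products of polynomials are polynomial in the coefficients, and a
cofactor is built from the entries of the pencil, whose coefficients are entries of `J` and `P` or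
zero. -/
theorem SmoothMat.cofCoeff {J P : E → Matrix ι ι ℝ} {x : E} (hJ : SmoothMat J x)
    (hP : SmoothMat P x) (k : ℕ) : SmoothMat (fun y => cofCoeff (J y) (P y) k) x := by
  have hpen : ∀ i j, SmoothPoly (fun y => pencil (J y) (P y) i j) x := by
    intro i j k
    rcases k with _ | k
    · simpa [pencil] using hJ i j
    · rcases k with _ | k
      · simpa [pencil, Polynomial.coeff_C] using hP i j
      · simpa [pencil, Polynomial.coeff_C] using contDiffAt_const
  intro α β
  have : SmoothPoly (fun y => (pencil (J y) (P y)).adjugate α β) x := by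
    simp only [Matrix.adjugate_apply, Matrix.det_apply']
    refine SmoothPoly.sum fun σ _ => (SmoothPoly.const _ x).mul (SmoothPoly.prod fun i _ => ?_)
    by_cases h : σ i = β
    · simp only [h, Matrix.updateRow_self]
      exact SmoothPoly.const _ x
    · simp only [Matrix.updateRow_ne h]
      exact hpen _ _
  exact this k

end SmoothPolynomials

/-! ### Brackets and the involution argument -/

section Brackets

variable {ι : Type} [Fintype ι] [DecidableEq ι]

theorem alongField_sum_left {κ : Type*} (s : Finset κ) (c : κ → ℝ) (x y : κ → ι → ℝ)
    (F : Coord ι → Coord ι → ℝ) (q p : Coord ι) :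
    alongField (fun α => ∑ k ∈ s, c k * x k α) (fun α => ∑ k ∈ s, c k * y k α) F q p
      = ∑ k ∈ s, c k * alongField (x k) (y k) F q p := by
  simp only [alongField, mul_add, Finset.sum_add_distrib, Finset.sum_mul, Finset.mul_sum]
  congr 1 <;>
  · rw [Finset.sum_comm]
    exact Finset.sum_congr rfl fun k _ => Finset.sum_congr rfl fun α _ => by ring

theorem alongField_add_smul (a : ℝ) (x y x' y' : ι → ℝ) (F : Coord ι → Coord ι → ℝ)
    (q p : Coord ι) :
    alongField (fun α => x α + a * x' α) (fun α => y α + a * y' α) F q p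
      = alongField x y F q p + a * alongField x' y' F q p := by
  simp only [alongField, mul_add, add_mul, Finset.sum_add_distrib, Finset.mul_sum, mul_assoc]
  ring

theorem alongField_const_mul (a : ℝ) (x y : ι → ℝ) (F : Coord ι → Coord ι → ℝ)
    (q p : Coord ι) :
    alongField (fun α => a * x α) (fun α => a * y α) F q p = a * alongField x y F q p := by
  simp only [alongField, mul_add, Finset.mul_sum, mul_assoc]

/-- The first two sums are exchanged with opposite sign; the last has a kernel antisymmetric in the
indices of the two momentum derivatives. -/
theorem bracket_antisymm (J : Coord ι → Matrix ι ι ℝ) (F H : Coord ι → Coord ι → ℝ)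
    (q p : Coord ι) : bracket J F H q p = -bracket J H F q p := by
  have h : ∀ F H : Coord ι → Coord ι → ℝ, bracket J F H q p
      = (∑ α, ∑ β, J q α β * pd (fun s => F q s) p β * pd (fun x => H x p) q α)
        - (∑ α, ∑ β, J q α β * pd (fun x => F x p) q α * pd (fun s => H q s) p β)
        - ∑ β, ∑ α, ∑ γ, p γ * (pd (fun x => J x γ α) q β - pd (fun x => J x γ β) q α)
          * pd (fun s => F q s) p α * pd (fun s => H q s) p β := by
    intro F H
    simp only [bracket, alongField, poissonQ, poissonP, sub_mul, neg_mul, Finset.sum_mul,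
      Finset.sum_sub_distrib, Finset.sum_neg_distrib]
    rw [Finset.sum_comm (f := fun β α => J q α β * pd (fun x => F x p) q α
      * pd (fun s => H q s) p β)]
    ring
  have h3 : (∑ β, ∑ α, ∑ γ, p γ * (pd (fun x => J x γ α) q β - pd (fun x => J x γ β) q α)
          * pd (fun s => F q s) p α * pd (fun s => H q s) p β)
      = -∑ β, ∑ α, ∑ γ, p γ * (pd (fun x => J x γ α) q β - pd (fun x => J x γ β) q α)
          * pd (fun s => H q s) p α * pd (fun s => F q s) p β := by
    rw [Finset.sum_comm, ← Finset.sum_neg_distrib]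
    refine Finset.sum_congr rfl fun β _ => ?_
    rw [← Finset.sum_neg_distrib]
    refine Finset.sum_congr rfl fun α _ => ?_
    rw [← Finset.sum_neg_distrib]
    exact Finset.sum_congr rfl fun γ _ => by ring
  have h1 : ∀ F H : Coord ι → Coord ι → ℝ,
      (∑ α, ∑ β, J q α β * pd (fun s => F q s) p β * pd (fun x => H x p) q α)
      = ∑ α, ∑ β, J q α β * pd (fun x => H x p) q α * pd (fun s => F q s) p β := fun F H =>
    Finset.sum_congr rfl fun α _ => Finset.sum_congr rfl fun β _ => by ring
  rw [h F H, h H F, h1 F H, h1 H F, h3]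
  ring

/-- An antisymmetric double sum weighted by a symmetric kernel vanishes. -/
theorem sum_sum_antisymm {κ : Type*} (s : Finset κ) (w b : κ → κ → ℝ)
    (hw : ∀ k l, w k l = w l k) (hb : ∀ k l, b k l = -b l k) :
    ∑ k ∈ s, ∑ l ∈ s, w k l * b k l = 0 := by
  have h : ∑ k ∈ s, ∑ l ∈ s, w k l * b k l = -∑ k ∈ s, ∑ l ∈ s, w k l * b k l := by
    conv_lhs => rw [Finset.sum_comm]
    rw [← Finset.sum_neg_distrib]
    refine Finset.sum_congr rfl fun k _ => ?_
    rw [← Finset.sum_neg_distrib]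
    exact Finset.sum_congr rfl fun l _ => by rw [hw, hb]; ring
  linarith

/-- Functions which generate one and the same vector field with respect to a pencil of brackets are
integrals of that field, and are in involution with respect to all brackets of the pencil. -/
theorem involution_of_pencil {N : ℕ} {d : ℝ[X]} (hd : d ≠ 0) (br br' : Fin N → Fin N → ℝ)
    (f : Fin N → ℝ) (h : ∀ k l, br k l = -br l k) (h' : ∀ k l, br' k l = -br' l k)
    (hp : ∀ a l, ∑ k : Fin N, a ^ (k : ℕ) * (br k l + a * br' k l) = d.eval a * f l) :
    (∀ l, f l = 0) ∧ (∀ k l, br k l = 0) ∧ ∀ k l, br' k l = 0 := by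
  -- Weighting by a^l and summing turns the left side of `hp` into the bracket of H(a) with itself,
  -- which is zero; so the polynomial with coefficients `f l` vanishes wherever `d` does not.
  have hf : ∀ l, f l = 0 := by
    refine eq_zero_of_sum_pow hd fun a ha => ?_
    apply mul_left_cancel₀ ha
    rw [mul_zero, ← sum_sum_antisymm Finset.univ
      (fun k l : Fin N => a ^ (k : ℕ) * a ^ (l : ℕ)) (fun k l => br k l + a * br' k l)
      (fun k l => mul_comm _ _) (fun k l => by rw [h, h']; ring), Finset.sum_comm, Finset.mul_sum]
    refine Finset.sum_congr rfl fun l _ => ?_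
    rw [mul_left_comm, ← hp a l, Finset.mul_sum]
    exact Finset.sum_congr rfl fun k _ => by ring
  simp only [hf, mul_zero] at hp
  -- The bracket of H(a) and H(b) with respect to J + aP, with independent parameters a and b.
  have hS : ∀ a b, (∑ k : Fin N, ∑ l : Fin N, a ^ (k : ℕ) * b ^ (l : ℕ) * br k l)
      + a * ∑ k : Fin N, ∑ l : Fin N, a ^ (k : ℕ) * b ^ (l : ℕ) * br' k l = 0 := fun a b => by
    rw [Finset.mul_sum, ← Finset.sum_add_distrib]
    simp only [Finset.mul_sum, ← Finset.sum_add_distrib]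
    rw [Finset.sum_comm]
    refine Finset.sum_eq_zero fun l _ => ?_
    rw [← mul_zero (b ^ (l : ℕ)), ← hp a l, Finset.mul_sum]
    exact Finset.sum_congr rfl fun k _ => by ring
  have hanti : ∀ c : Fin N → Fin N → ℝ, (∀ k l, c k l = -c l k) → ∀ a b : ℝ,
      (∑ k : Fin N, ∑ l : Fin N, a ^ (k : ℕ) * b ^ (l : ℕ) * c k l)
        = -∑ k : Fin N, ∑ l : Fin N, b ^ (k : ℕ) * a ^ (l : ℕ) * c k l := fun c hc a b => by
    rw [Finset.sum_comm, ← Finset.sum_neg_distrib]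
    refine Finset.sum_congr rfl fun k _ => ?_
    rw [← Finset.sum_neg_distrib]
    exact Finset.sum_congr rfl fun l _ => by rw [hc]; ring
  -- By antisymmetry the bracket of H(a) and H(b) vanishes for J + bP as well as for J + aP. The
  -- difference is (b - a) times the bracket for P; the polynomial X - a excludes b = a.
  have hS' : ∀ (a : ℝ) l, ∑ k : Fin N, a ^ (k : ℕ) * br' k l = 0 := fun a => by
    refine eq_zero_of_sum_pow (Polynomial.X_sub_C_ne_zero a) fun b hb => ?_
    have e1 := hS a b
    have e2 := hS b a
    rw [hanti br h b a, hanti br' h' b a] at e2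
    have e3 : (b - a) * ∑ k : Fin N, ∑ l : Fin N, a ^ (k : ℕ) * b ^ (l : ℕ) * br' k l = 0 := by
      linear_combination -e1 - e2
    have hba : b - a ≠ 0 := by simpa using hb
    rw [← (mul_eq_zero.mp e3).resolve_left hba, Finset.sum_comm]
    refine Finset.sum_congr rfl fun l _ => ?_
    rw [Finset.mul_sum]
    exact Finset.sum_congr rfl fun k _ => by ring
  have hbr' : ∀ k l, br' k l = 0 := fun k l =>
    eq_zero_of_sum_pow one_ne_zero (fun a _ => hS' a l) k
  refine ⟨hf, fun k l => ?_, hbr'⟩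
  refine eq_zero_of_sum_pow (c := fun k => br k l) one_ne_zero (fun a _ => ?_) k
  simpa [hbr'] using hp a l

end Brackets

/-! ### Parallel pairs: closed forms and potentials -/

section Pairs

variable {ι : Type} [Fintype ι] [DecidableEq ι]

/-- The bilinear form `D_J Q` of a tensor `J` satisfying the special conformal Killing condition
with 1-form `c`. -/
def gaugedForm (J : Coord ι → Matrix ι ι ℝ) (Q : Coord ι → ι → ℝ) (c : ι → ℝ) (q : Coord ι)
    (y x : ι → ℝ) : ℝ :=
  dirVec Q q (J q *ᵥ y) ⬝ᵥ x - dirVec Q q (J q *ᵥ x) ⬝ᵥ y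
    - Q q ⬝ᵥ (dirMat J q y *ᵥ x - dirMat J q x *ᵥ y)
    + ((c ⬝ᵥ y) * (Q q ⬝ᵥ x) - (c ⬝ᵥ x) * (Q q ⬝ᵥ y))

theorem dirVec_add (Q : Coord ι → ι → ℝ) (q : Coord ι) (u w : ι → ℝ) :
    dirVec Q q (u + w) = dirVec Q q u + dirVec Q q w := by
  ext α
  simp [dirVec, dir]

theorem dirVec_smul (Q : Coord ι → ι → ℝ) (q : Coord ι) (a : ℝ) (u : ι → ℝ) :
    dirVec Q q (a • u) = a • dirVec Q q u := by
  ext α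
  simp [dirVec, dir]

/-- The form is linear in the tensor and the 1-form jointly, and the 1-form belonging to `P` is
zero; so `c` serves the whole pencil. -/
theorem gaugedForm_pencil {J P : Coord ι → Matrix ι ι ℝ} (Q : Coord ι → ι → ℝ) (c : ι → ℝ)
    {q : Coord ι} (hJ : DiffMat J q) (hP : DiffMat P q) (a : ℝ) (y x : ι → ℝ) :
    gaugedForm (fun z => J z + a • P z) Q c q y x
      = gaugedForm J Q c q y x + a * gaugedForm P Q 0 q y x := by
  simp only [gaugedForm, dirMat_add_const_smul hJ hP, Matrix.add_mulVec, Matrix.smul_mulVec,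
    dirVec_add, dirVec_smul, add_dotProduct, smul_dotProduct, dotProduct_sub, dotProduct_add,
    dotProduct_smul, zero_dotProduct, smul_eq_mul]
  ring

/-- The data `(G, J, P, Q)` on the open set `U` are those of a cofactor pair `(J, P)`, where `P` is
parallel of rank at most `n` and `J` is nonsingular. -/
structure IsParallelPair (n : ℕ) (U : Set (Coord ι)) (G J P : Coord ι → Matrix ι ι ℝ)
    (Q : Coord ι → ι → ℝ) (c : Coord ι → ι → ℝ) : Prop where
  isOpen : IsOpen U
  sckt : ∀ q ∈ U, IsSCKTAt G J q (c q)
  parallel : ∀ q ∈ U, IsSCKTAt G P q 0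
  smooth_form : ∀ q ∈ U, ∀ α, ContDiffAt ℝ ∞ (fun x => Q x α) q
  det_ne : ∀ q ∈ U, (J q).det ≠ 0
  rank_le : ∀ q ∈ U, ∃ (A : Matrix ι (Fin n) ℝ) (B : Matrix (Fin n) ι ℝ), P q = A * B
  gauged : ∀ q ∈ U, ∀ y x, gaugedForm J Q (c q) q y x = 0
  gauged_parallel : ∀ q ∈ U, ∀ y x, gaugedForm P Q 0 q y x = 0

namespace IsParallelPair

variable {n : ℕ} {U : Set (Coord ι)} {G J P : Coord ι → Matrix ι ι ℝ} {Q : Coord ι → ι → ℝ}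
  {c : Coord ι → ι → ℝ}

theorem mono (h : IsParallelPair n U G J P Q c) {O : Set (Coord ι)} (hO : IsOpen O)
    (hOU : O ⊆ U) : IsParallelPair n O G J P Q c where
  isOpen := hO
  sckt q hq := h.sckt q (hOU hq)
  parallel q hq := h.parallel q (hOU hq)
  smooth_form q hq := h.smooth_form q (hOU hq)
  det_ne q hq := h.det_ne q (hOU hq)
  rank_le q hq := h.rank_le q (hOU hq)
  gauged q hq := h.gauged q (hOU hq)
  gauged_parallel q hq := h.gauged_parallel q (hOU hq)

theorem sckt_pencil (h : IsParallelPair n U G J P Q c) {q : Coord ι} (hq : q ∈ U) (a : ℝ) :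
    IsSCKTAt G (fun x => J x + a • P x) q (c q) where
  symm := (h.sckt q hq).symm
  det_ne := (h.sckt q hq).det_ne
  smooth_metric := (h.sckt q hq).smooth_metric
  smooth := (h.sckt q hq).smooth.add_const_smul (h.parallel q hq).smooth a
  self_adj := by
    rw [mul_add, Matrix.mul_smul]
    exact (h.sckt q hq).self_adj.add ((h.parallel q hq).self_adj.smul a)
  cov_eq u := by
    rw [cov_add_const_smul (h.sckt q hq).smooth.diffMat (h.parallel q hq).smooth.diffMat,
      (h.sckt q hq).cov_eq, (h.parallel q hq).cov_eq]
    simp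

theorem adjugate_eq (h : IsParallelPair n U G J P Q c) {q : Coord ι} (hq : q ∈ U) (a : ℝ) :
    (J q + a • P q).adjugate
      = ∑ k : Fin (n + 1), a ^ (k : ℕ) • cofCoeff (J q) (P q) k := by
  obtain ⟨A, B, hAB⟩ := h.rank_le q hq
  rw [hAB]
  exact adjugate_add_smul_eq_sum _ _ _ _

theorem smooth_cofCoeff (h : IsParallelPair n U G J P Q c) {q : Coord ι} (hq : q ∈ U) (k : ℕ) :
    SmoothMat (fun x => cofCoeff (J x) (P x) k) q :=
  (h.sckt q hq).smooth.cofCoeff (h.parallel q hq).smooth k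

theorem smooth_form_cofCoeff (h : IsParallelPair n U G J P Q c) {q : Coord ι} (hq : q ∈ U)
    (k : ℕ) (β : ι) :
    ContDiffAt ℝ ∞ (fun x => ((cofCoeff (J x) (P x) k)ᵀ *ᵥ Q x) β) q := by
  simp only [Matrix.mulVec, dotProduct, Matrix.transpose_apply]
  exact ContDiffAt.sum fun α _ => (h.smooth_cofCoeff hq k α β).mul (h.smooth_form q hq α)

/-- For every a with J + aP nonsingular the form A(a)ᵀQ is closed. Its antisymmetrised derivative is
a polynomial in a, so each coefficient vanishes. -/
theorem closed_cofCoeff (h : IsParallelPair n U G J P Q c) {q : Coord ι} (hq : q ∈ U)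
    (k : Fin (n + 1)) (x y : ι → ℝ) :
    dirVec (fun z => (cofCoeff (J z) (P z) k)ᵀ *ᵥ Q z) q x ⬝ᵥ y
      = dirVec (fun z => (cofCoeff (J z) (P z) k)ᵀ *ᵥ Q z) q y ⬝ᵥ x := by
  set θ : Fin (n + 1) → Coord ι → ι → ℝ := fun k z => (cofCoeff (J z) (P z) k)ᵀ *ᵥ Q z with hθ
  have hθd : ∀ k β, DifferentiableAt ℝ (fun z => θ k z β) q := fun k β =>
    (h.smooth_form_cofCoeff hq k β).differentiableAt (by simp)
  have hsum : ∀ (a : ℝ) u, dirVec (fun z => ((J z + a • P z).adjugate)ᵀ *ᵥ Q z) q u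
      = ∑ k : Fin (n + 1), a ^ (k : ℕ) • dirVec (θ k) q u := fun a u => by
    have e : (fun z => ((J z + a • P z).adjugate)ᵀ *ᵥ Q z)
        =ᶠ[𝓝 q] fun z => ∑ k : Fin (n + 1), a ^ (k : ℕ) • θ k z := by
      filter_upwards [h.isOpen.mem_nhds hq] with z hz
      rw [h.adjugate_eq hz, Matrix.transpose_sum, Matrix.sum_mulVec]
      simp [hθ, Matrix.transpose_smul, Matrix.smul_mulVec]
    rw [dirVec_congr e]
    ext β
    simp only [dirVec, Finset.sum_apply, Pi.smul_apply, smul_eq_mul]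
    rw [dir_sum fun k _ => (hθd k β).const_mul _]
    exact Finset.sum_congr rfl fun k _ => dir_const_mul (hθd k β) _ _
  have hz := eq_zero_of_sum_pow (det_pencil_ne_zero (h.det_ne q hq) (P q))
    (c := fun k : Fin (n + 1) => dirVec (θ k) q x ⬝ᵥ y - dirVec (θ k) q y ⬝ᵥ x) (fun a ha => by
      rw [eval_det_pencil] at ha
      have := (h.sckt_pencil hq a).closed_of_det_ne ha (Q := Q)
        (fun α => (h.smooth_form q hq α).differentiableAt (by simp)) (fun x y => by
          have := gaugedForm_pencil Q (c q) (h.sckt q hq).smooth.diffMat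
            (h.parallel q hq).smooth.diffMat a y x
          rw [h.gauged q hq, h.gauged_parallel q hq] at this
          simpa [gaugedForm] using this) x y
      rw [hsum, hsum, sum_dotProduct, sum_dotProduct, ← sub_eq_zero,
        ← Finset.sum_sub_distrib] at this
      rw [← this]
      exact Finset.sum_congr rfl fun k _ => by
        rw [smul_dotProduct, smul_dotProduct, smul_eq_mul, smul_eq_mul, mul_sub]) k
  exact sub_eq_zero.mp hz

theorem exists_potentials (h : IsParallelPair n U G J P Q c) (hU : Convex ℝ U) :
    ∃ W : Fin (n + 1) → Coord ι → ℝ, IsPotentialFamily J P Q U W := by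
  have key : ∀ k : Fin (n + 1), ∃ W : Coord ι → ℝ, ContDiffOn ℝ ∞ W U ∧
      ∀ q ∈ U, ∀ β, ((cofCoeff (J q) (P q) k)ᵀ *ᵥ Q q) β = -pd W q β := by
    intro k
    set θ : Coord ι → ι → ℝ := fun z => (cofCoeff (J z) (P z) k)ᵀ *ᵥ Q z with hθ
    -- The negative of the 1-form A_kᵀQ as a field of functionals; closedness is the symmetry of its
    -- derivative, and the Poincaré lemma applies on the convex set.
    set σ : Coord ι → Coord ι →L[ℝ] ℝ := fun z =>
      ∑ β, (-θ z β) • (EuclideanSpace.proj β : Coord ι →L[ℝ] ℝ) with hσ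
    have hθs : ∀ q ∈ U, ∀ β, ContDiffAt ℝ ∞ (fun z => θ z β) q := fun q hq β =>
      h.smooth_form_cofCoeff hq k β
    have hσs : ∀ q ∈ U, ContDiffAt ℝ ∞ σ q := fun q hq =>
      ContDiffAt.sum fun β _ => (hθs q hq β).neg.smul contDiffAt_const
    have hσf : ∀ q ∈ U, ∀ u w, fderiv ℝ σ q u w = -(dirVec θ q u.ofLp ⬝ᵥ w.ofLp) := by
      intro q hq u w
      have hd : HasFDerivAt σ (∑ β, (-fderiv ℝ (fun z => θ z β) q).smulRight
          (EuclideanSpace.proj β : Coord ι →L[ℝ] ℝ)) q :=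
        HasFDerivAt.fun_sum fun β _ =>
          ((hθs q hq β).differentiableAt (by simp)).hasFDerivAt.fun_neg.smul_const
            (EuclideanSpace.proj β : Coord ι →L[ℝ] ℝ)
      rw [hd.fderiv, dotProduct, ← Finset.sum_neg_distrib]
      simp [dirVec, dir]
    obtain ⟨W, hW⟩ := hU.exists_forall_hasFDerivAt_of_fderiv_symmetric h.isOpen
      (show DifferentiableOn ℝ σ U from
        fun q hq => ((hσs q hq).differentiableAt (by simp)).differentiableWithinAt)
      (fun q hq u w => by rw [hσf q hq, hσf q hq, h.closed_cofCoeff hq])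
    refine ⟨W, ?_, fun q hq β => ?_⟩
    · rw [contDiffOn_infty_iff_fderiv_of_isOpen h.isOpen]
      refine ⟨fun q hq => (hW q hq).differentiableAt.differentiableWithinAt, ?_⟩
      exact ContDiffOn.congr (fun q hq => (hσs q hq).contDiffWithinAt)
        fun q hq => (hW q hq).fderiv
    · rw [pd, (hW q hq).fderiv, hσ]
      simp [hθ]
  choose W hW using key
  exact ⟨W, fun k => ⟨(hW k).1, fun q hq β => (hW k).2 q hq β⟩⟩

end IsParallelPair

end Pairs

/-! ### Phase space calculus and the Poisson tensor of the pencil -/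

section JointlyDifferentiable

variable {ι : Type} [Fintype ι] [DecidableEq ι]

/-- A function on phase space is differentiable at `(q, p)`. -/
def DiffAt₂ (F : Coord ι → Coord ι → ℝ) (q p : Coord ι) : Prop :=
  DifferentiableAt ℝ (fun z : Coord ι × Coord ι => F z.1 z.2) (q, p)

variable {F : Coord ι → Coord ι → ℝ} {q p : Coord ι}

theorem DiffAt₂.hasFDerivAt_left (h : DiffAt₂ F q p) :
    HasFDerivAt (fun x => F x p)
      ((fderiv ℝ (fun z : Coord ι × Coord ι => F z.1 z.2) (q, p)).comp
        (ContinuousLinearMap.inl ℝ (Coord ι) (Coord ι))) q :=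
  HasFDerivAt.comp (g := fun z : Coord ι × Coord ι => F z.1 z.2) (f := fun x => (x, p)) q
    (DifferentiableAt.hasFDerivAt h) (hasFDerivAt_prodMk_left q p)

theorem DiffAt₂.hasFDerivAt_right (h : DiffAt₂ F q p) :
    HasFDerivAt (fun s => F q s)
      ((fderiv ℝ (fun z : Coord ι × Coord ι => F z.1 z.2) (q, p)).comp
        (ContinuousLinearMap.inr ℝ (Coord ι) (Coord ι))) p :=
  HasFDerivAt.comp (g := fun z : Coord ι × Coord ι => F z.1 z.2) (f := fun s => (q, s)) p
    (DifferentiableAt.hasFDerivAt h) (hasFDerivAt_prodMk_right q p)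

theorem DiffAt₂.fderiv_eq_alongField (h : DiffAt₂ F q p) (u w : Coord ι) :
    fderiv ℝ (fun z : Coord ι × Coord ι => F z.1 z.2) (q, p) (u, w)
      = alongField u w F q p := by
  have h1 : ((u, w) : Coord ι × Coord ι) = (u, 0) + (0, w) := by simp
  rw [h1, map_add, alongField]
  congr 1
  · have := clm_apply_eq_sum ((fderiv ℝ (fun z : Coord ι × Coord ι => F z.1 z.2) (q, p)).comp
        (ContinuousLinearMap.inl ℝ (Coord ι) (Coord ι))) u
    simpa [pd, h.hasFDerivAt_left.fderiv] using this
  · have := clm_apply_eq_sum ((fderiv ℝ (fun z : Coord ι × Coord ι => F z.1 z.2) (q, p)).comp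
        (ContinuousLinearMap.inr ℝ (Coord ι) (Coord ι))) w
    simpa [pd, h.hasFDerivAt_right.fderiv] using this

theorem DiffAt₂.hasDerivAt_comp {x s : ℝ → Coord ι} {t : ℝ} {u w : Coord ι}
    (h : DiffAt₂ F (x t) (s t)) (hx : ∀ α, HasDerivAt (fun τ => x τ α) (u α) t)
    (hs : ∀ α, HasDerivAt (fun τ => s τ α) (w α) t) :
    HasDerivAt (fun τ => F (x τ) (s τ)) (alongField u w F (x t) (s t)) t := by
  have hcoord : ∀ {y : ℝ → Coord ι} {v : Coord ι},
      (∀ α, HasDerivAt (fun τ => y τ α) (v α) t) → HasDerivAt y v t := fun {y v} hy => by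
    rw [hasDerivAt_iff_hasFDerivAt, ← hasFDerivWithinAt_univ, hasFDerivWithinAt_euclidean]
    intro α
    rw [hasFDerivWithinAt_univ]
    refine (hy α).hasFDerivAt.congr_fderiv ?_
    ext
    simp
  have := HasFDerivAt.comp_hasDerivAt (l := fun z : Coord ι × Coord ι => F z.1 z.2)
    (f := fun τ => (x τ, s τ)) t
    (DifferentiableAt.hasFDerivAt h) ((hcoord hx).prodMk (hcoord hs))
  rwa [h.fderiv_eq_alongField] at this

theorem poissonQ_pencil {N : ℕ} {J P : Coord ι → Matrix ι ι ℝ}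
    {H : Fin N → Coord ι → Coord ι → ℝ} (hH : ∀ k, DiffAt₂ (H k) q p) (a : ℝ) (α : ι) :
    poissonQ (fun x => J x + a • P x)
        (fun x s => ∑ k : Fin N, a ^ (k : ℕ) * H k x s) q p α
      = ∑ k : Fin N, a ^ (k : ℕ) * (poissonQ J (H k) q p α + a * poissonQ P (H k) q p α) := by
  have h1 : ∀ β, pd (fun s => ∑ k : Fin N, a ^ (k : ℕ) * H k q s) p β
      = ∑ k : Fin N, a ^ (k : ℕ) * pd (fun s => H k q s) p β := fun β =>
    pd_sum_const_mul _ (fun k _ => (hH k).hasFDerivAt_right.differentiableAt) β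
  simp only [poissonQ, h1, Matrix.add_apply, Matrix.smul_apply, smul_eq_mul, mul_add,
    Finset.mul_sum, ← Finset.sum_add_distrib]
  rw [Finset.sum_comm]
  exact Finset.sum_congr rfl fun k _ => Finset.sum_congr rfl fun β _ => by ring

theorem poissonP_add_const_smul {J P : Coord ι → Matrix ι ι ℝ} (hJ : DiffMat J q)
    (hP : DiffMat P q) (F : Coord ι → Coord ι → ℝ) (a : ℝ) (β : ι) :
    poissonP (fun x => J x + a • P x) F q p β = poissonP J F q p β + a * poissonP P F q p β := by
  have h : ∀ u w : ι → ℝ, dir (fun x => F x p) q (u + a • w)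
      = dir (fun x => F x p) q u + a * dir (fun x => F x p) q w := fun u w => by
    simp [dir]
  simp only [poissonP_eq, dirMat_add_const_smul hJ hP, Matrix.add_mulVec, Matrix.smul_mulVec, h,
    dotProduct_add, dotProduct_smul, smul_eq_mul]
  ring

theorem poissonP_sum {N : ℕ} (J : Coord ι → Matrix ι ι ℝ)
    {H : Fin N → Coord ι → Coord ι → ℝ} (hH : ∀ k, DiffAt₂ (H k) q p) (c : Fin N → ℝ) (β : ι) :
    poissonP J (fun x s => ∑ k, c k * H k x s) q p β = ∑ k, c k * poissonP J (H k) q p β := by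
  have h1 : ∀ β, pd (fun s => ∑ k : Fin N, c k * H k q s) p β
      = ∑ k : Fin N, c k * pd (fun s => H k q s) p β := fun β =>
    pd_sum_const_mul _ (fun k _ => (hH k).hasFDerivAt_right.differentiableAt) β
  have h2 : ∀ β, pd (fun x => ∑ k : Fin N, c k * H k x p) q β
      = ∑ k : Fin N, c k * pd (fun x => H k x p) q β := fun β =>
    pd_sum_const_mul _ (fun k _ => (hH k).hasFDerivAt_left.differentiableAt) β
  simp only [poissonP, h1, h2, ← Finset.sum_mul, mul_sub, mul_neg, Finset.sum_sub_distrib,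
    Finset.sum_neg_distrib]
  simp only [Finset.mul_sum]
  congr 1
  · rw [Finset.sum_comm]
    congr 1
    exact Finset.sum_congr rfl fun k _ => Finset.sum_congr rfl fun α _ => by ring
  · rw [Finset.sum_comm]
    exact Finset.sum_congr rfl fun k _ => Finset.sum_congr rfl fun α _ => by ring

theorem poissonP_pencil {N : ℕ} {J P : Coord ι → Matrix ι ι ℝ} (hJ : DiffMat J q)
    (hP : DiffMat P q) {H : Fin N → Coord ι → Coord ι → ℝ} (hH : ∀ k, DiffAt₂ (H k) q p)
    (a : ℝ) (β : ι) :
    poissonP (fun x => J x + a • P x)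
        (fun x s => ∑ k : Fin N, a ^ (k : ℕ) * H k x s) q p β
      = ∑ k : Fin N, a ^ (k : ℕ) * (poissonP J (H k) q p β + a * poissonP P (H k) q p β) := by
  rw [poissonP_sum _ hH]
  exact Finset.sum_congr rfl fun k _ => by rw [poissonP_add_const_smul hJ hP]

end JointlyDifferentiable

/-! ### Equations of motion, first integrals and involution for a parallel pair -/

namespace IsParallelPair

variable {ι : Type} [Fintype ι] [DecidableEq ι]
variable {n : ℕ} {U : Set (Coord ι)} {G J P : Coord ι → Matrix ι ι ℝ} {Q : Coord ι → ι → ℝ}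
  {c : Coord ι → ι → ℝ} {W : Fin (n + 1) → Coord ι → ℝ} {q : Coord ι}

theorem quadFun_eq (G J P : Coord ι → Matrix ι ι ℝ) (k : ℕ) (w : Coord ι → ℝ) (x s : Coord ι) :
    quadFun G J P k w x s
      = (1 / 2) * (s.ofLp ⬝ᵥ (cofCoeff (J x) (P x) k * (G x)⁻¹) *ᵥ s.ofLp) + w x := by
  rw [quadFun]
  congr 2
  simp only [dotProduct, Matrix.mulVec, Finset.mul_sum]
  exact Finset.sum_congr rfl fun α _ => Finset.sum_congr rfl fun β _ => by ring

/-- The expansion of the cofactor tensor in powers of a identifies H(a) as the Hamiltonian of the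
single tensor J + aP, so the results for one tensor apply to it. -/
theorem sum_quadFun (h : IsParallelPair n U G J P Q c) (hq : q ∈ U) (a : ℝ) (s : Coord ι) :
    ∑ k : Fin (n + 1), a ^ (k : ℕ) * quadFun G J P k (W k) q s
      = cofactorHamiltonian G (fun x => J x + a • P x)
        (fun x => ∑ k : Fin (n + 1), a ^ (k : ℕ) * W k x) q s := by
  simp only [quadFun_eq, cofactorHamiltonian]
  rw [h.adjugate_eq hq, Matrix.sum_mul, Matrix.sum_mulVec, dotProduct_sum, Finset.mul_sum,
    ← Finset.sum_add_distrib]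
  refine Finset.sum_congr rfl fun k _ => ?_
  rw [Matrix.smul_mul, Matrix.smul_mulVec, dotProduct_smul, smul_eq_mul]
  ring

theorem differentiableAt_potential (h : IsParallelPair n U G J P Q c)
    (hW : IsPotentialFamily J P Q U W) (hq : q ∈ U) (k : Fin (n + 1)) :
    DifferentiableAt ℝ (W k) q :=
  ((hW k).1.contDiffAt (h.isOpen.mem_nhds hq)).differentiableAt (by simp)

theorem diffAt₂_quadFun (h : IsParallelPair n U G J P Q c) (hW : IsPotentialFamily J P Q U W)
    (hq : q ∈ U) (p : Coord ι) (k : Fin (n + 1)) :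
    DiffAt₂ (quadFun G J P k (W k)) q p := by
  have hM := ((h.smooth_cofCoeff hq k).mul
    ((h.sckt q hq).smooth_metric.inv (h.sckt q hq).det_ne)).diffMat
  have hfst : DifferentiableAt ℝ (Prod.fst : Coord ι × Coord ι → Coord ι) (q, p) :=
    differentiableAt_fst
  have hsnd : ∀ α, DifferentiableAt ℝ (fun z : Coord ι × Coord ι => z.2 α) (q, p) := fun α =>
    differentiableAt_euclidean.mp differentiableAt_snd α
  have h1 : ∀ α β, DifferentiableAt ℝ (fun z : Coord ι × Coord ι =>
      (cofCoeff (J z.1) (P z.1) k * (G z.1)⁻¹) α β) (q, p) := fun α β =>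
    DifferentiableAt.comp (g := fun x => (cofCoeff (J x) (P x) k * (G x)⁻¹) α β)
      (f := Prod.fst) (q, p) (hM α β) hfst
  have h2 : DifferentiableAt ℝ (fun z : Coord ι × Coord ι => W k z.1) (q, p) :=
    DifferentiableAt.comp (g := W k) (f := Prod.fst) (q, p)
      (h.differentiableAt_potential hW hq k) hfst
  unfold DiffAt₂ quadFun
  exact ((DifferentiableAt.fun_sum fun α _ => DifferentiableAt.fun_sum fun β _ =>
    ((h1 α β).mul (hsnd α)).mul (hsnd β)).const_mul _).add h2

theorem pd_sum_potential (h : IsParallelPair n U G J P Q c) (hW : IsPotentialFamily J P Q U W)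
    (hq : q ∈ U) (a : ℝ) (β : ι) :
    pd (fun x => ∑ k : Fin (n + 1), a ^ (k : ℕ) * W k x) q β
      = -(((J q + a • P q).adjugate)ᵀ *ᵥ Q q) β := by
  rw [pd_sum_const_mul _ fun k _ => h.differentiableAt_potential hW hq k, h.adjugate_eq hq,
    Matrix.transpose_sum, Matrix.sum_mulVec, Finset.sum_apply, ← Finset.sum_neg_distrib]
  refine Finset.sum_congr rfl fun k _ => ?_
  rw [← neg_eq_iff_eq_neg.mpr ((hW k).2 q hq β), Matrix.transpose_smul, Matrix.smul_mulVec,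
    Pi.smul_apply, smul_eq_mul, mul_neg]
  rfl

/-- `det (J + a P) Γ̂ = P_{J + a P} (dH(a))`, for all `a`. -/
theorem det_mul_hat (h : IsParallelPair n U G J P Q c) (hW : IsPotentialFamily J P Q U W)
    (hq : q ∈ U) (p : Coord ι) (a : ℝ) (α : ι) :
    (J q + a • P q).det * hatQ G q p α
      = poissonQ (fun x => J x + a • P x)
        (fun x s => ∑ k : Fin (n + 1), a ^ (k : ℕ) * quadFun G J P k (W k) x s) q p α ∧
    (J q + a • P q).det * hatP G Q q p α
      = poissonP (fun x => J x + a • P x)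
        (fun x s => ∑ k : Fin (n + 1), a ^ (k : ℕ) * quadFun G J P k (W k) x s) q p α := by
  have hd := det_pencil_ne_zero (h.det_ne q hq) (P q)
  have hH := h.diffAt₂_quadFun hW hq p
  have hdet : Continuous fun a : ℝ => (J q + a • P q).det :=
    Continuous.matrix_det (by fun_prop)
  have hnear : ∀ a : ℝ, (fun x => ∑ k : Fin (n + 1), a ^ (k : ℕ) * quadFun G J P k (W k) x p)
      =ᶠ[𝓝 q] fun x => cofactorHamiltonian G (fun x => J x + a • P x)
        (fun x => ∑ k : Fin (n + 1), a ^ (k : ℕ) * W k x) x p := fun a => by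
    filter_upwards [h.isOpen.mem_nhds hq] with x hx using h.sum_quadFun hx a p
  have hat : ∀ a : ℝ, (fun s => ∑ k : Fin (n + 1), a ^ (k : ℕ) * quadFun G J P k (W k) q s)
      = fun s => cofactorHamiltonian G (fun x => J x + a • P x)
        (fun x => ∑ k : Fin (n + 1), a ^ (k : ℕ) * W k x) q s := fun a =>
    funext fun s => h.sum_quadFun hq a s
  have hWd : ∀ a : ℝ, DifferentiableAt ℝ (fun x => ∑ k : Fin (n + 1), a ^ (k : ℕ) * W k x) q :=
    fun a => DifferentiableAt.fun_sum fun k _ =>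
      (h.differentiableAt_potential hW hq k).const_mul _
  constructor
  · simp only [poissonQ_pencil hH]
    revert a
    -- Expanded in powers of a, both sides are continuous in a, which reduces the claim to
    -- nonsingular J + aP.
    refine congrFun (eq_of_continuous_of_eval_ne_zero hd
      (f := fun a : ℝ => (J q + a • P q).det * hatQ G q p α) (hdet.mul_const _)
      ?_ fun a ha => ?_)
    · fun_prop
    rw [eval_det_pencil] at ha
    rw [← poissonQ_pencil hH]
    have := (h.sckt_pencil hq a).det_mul_hatQ ha
      (fun x => ∑ k : Fin (n + 1), a ^ (k : ℕ) * W k x) p α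
    rw [this, poissonQ, poissonQ, hat]
  · have hJd := (h.sckt q hq).smooth.diffMat
    have hPd := (h.parallel q hq).smooth.diffMat
    simp only [poissonP_pencil hJd hPd hH]
    revert a
    refine congrFun (eq_of_continuous_of_eval_ne_zero hd
      (f := fun a : ℝ => (J q + a • P q).det * hatP G Q q p α) (hdet.mul_const _)
      ?_ fun a ha => ?_)
    · fun_prop
    rw [eval_det_pencil] at ha
    rw [← poissonP_pencil hJd hPd hH]
    have := (h.sckt_pencil hq a).det_mul_hatP ha (hWd a) (h.pd_sum_potential hW hq a) p α
    rw [this, poissonP, poissonP, hat]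
    simp only [pd_congr (hnear a)]

theorem pencil_det_mul_hat (h : IsParallelPair n U G J P Q c)
    (hW : IsPotentialFamily J P Q U W) (hq : q ∈ U) (p : Coord ι) (a : ℝ) (α : ι) :
    (J q + a • P q).det * hatQ G q p α
      = ∑ k : Fin (n + 1), a ^ (k : ℕ) * (poissonQ J (quadFun G J P k (W k)) q p α
        + a * poissonQ P (quadFun G J P k (W k)) q p α) ∧
    (J q + a • P q).det * hatP G Q q p α
      = ∑ k : Fin (n + 1), a ^ (k : ℕ) * (poissonP J (quadFun G J P k (W k)) q p α
        + a * poissonP P (quadFun G J P k (W k)) q p α) := by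
  have hH := h.diffAt₂_quadFun hW hq p
  obtain ⟨h1, h2⟩ := h.det_mul_hat hW hq p a α
  rw [h1, h2]
  exact ⟨poissonQ_pencil hH a α,
    poissonP_pencil (h.sckt q hq).smooth.diffMat (h.parallel q hq).smooth.diffMat hH a α⟩

/-- The functions `H_k` are first integrals of `Γ̂`, and are in involution with respect to both
brackets. -/
theorem integrals_and_involution (h : IsParallelPair n U G J P Q c)
    (hW : IsPotentialFamily J P Q U W) (hq : q ∈ U) (p : Coord ι) :
    (∀ k : Fin (n + 1),
      alongField (hatQ G q p) (hatP G Q q p) (quadFun G J P k (W k)) q p = 0) ∧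
    (∀ k l : Fin (n + 1), bracket J (quadFun G J P k (W k)) (quadFun G J P l (W l)) q p = 0) ∧
    ∀ k l : Fin (n + 1), bracket P (quadFun G J P k (W k)) (quadFun G J P l (W l)) q p = 0 := by
  refine involution_of_pencil (det_pencil_ne_zero (h.det_ne q hq) (P q)) _ _ _
    (fun k l => bracket_antisymm _ _ _ _ _) (fun k l => bracket_antisymm _ _ _ _ _) fun a l => ?_
  have h1 := h.pencil_det_mul_hat hW hq p a
  -- Applying the vector field identity to H_l gives the hypothesis on the pencil of brackets, with
  -- `f l` = Γ̂(H_l).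
  rw [eval_det_pencil, ← alongField_const_mul]
  simp only [(h1 _).1, (h1 _).2]
  rw [alongField_sum_left]
  exact Finset.sum_congr rfl fun k _ => by rw [alongField_add_smul]; rfl

/-- Since det(J + aP) has degree at most n in a, the coefficient of a^(n+1) in det(J + aP) Γ̂ =
P_{J+aP}(dH(a)) is zero on the left and P_P of the top differential on the right. -/
theorem poisson_last (h : IsParallelPair n U G J P Q c) (hW : IsPotentialFamily J P Q U W)
    (hq : q ∈ U) (p : Coord ι) (α : ι) :
    poissonQ P (quadFun G J P n (W (Fin.last n))) q p α = 0 ∧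
      poissonP P (quadFun G J P n (W (Fin.last n))) q p α = 0 := by
  obtain ⟨A, B, hAB⟩ := h.rank_le q hq
  have h1 := fun a => h.pencil_det_mul_hat hW hq p a α
  simp only [hAB, det_add_smul_eq_sum, Finset.sum_mul, mul_assoc] at h1
  exact ⟨last_eq_zero_of_sum_pow fun a => (h1 a).1.symm,
    last_eq_zero_of_sum_pow fun a => (h1 a).2.symm⟩

end IsParallelPair

/-! ### From component conditions to identities along vectors -/

section Components

variable {ι : Type} [Fintype ι] [DecidableEq ι]

theorem gaugedDJ_eq_gaugedForm {J : Coord ι → Matrix ι ι ℝ} (Q : Coord ι → ι → ℝ) {c : ι → ℝ}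
    {q : Coord ι} (hc : ∀ u, dir (fun x => (J x).trace) q u = c ⬝ᵥ u) (α β : ι) :
    gaugedDJ J Q q α β = gaugedForm J Q c q (Pi.single α 1) (Pi.single β 1) := by
  have h1 : ∀ α β, dirVec Q q (J q *ᵥ Pi.single α 1) ⬝ᵥ Pi.single β 1
      = ∑ σ, J q σ α * pd (fun x => Q x β) q σ := fun α β => by
    rw [dotProduct_single, mul_one, dirVec, dir_eq_sum]
    exact Finset.sum_congr rfl fun σ _ => by simp [mul_comm]
  have h2 : Q q ⬝ᵥ (dirMat J q (Pi.single α 1) *ᵥ Pi.single β 1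
      - dirMat J q (Pi.single β 1) *ᵥ Pi.single α 1)
      = ∑ σ, Q q σ * (pd (fun x => J x σ β) q α - pd (fun x => J x σ α) q β) := by
    simp only [Matrix.mulVec_single_one, dotProduct]
    rfl
  rw [gaugedForm, h1, h1, h2, ← hc, ← hc, dir_single, dir_single, dotProduct_single,
    dotProduct_single, mul_one, mul_one]
  rfl

theorem gaugedForm_eq_sum (J : Coord ι → Matrix ι ι ℝ) (Q : Coord ι → ι → ℝ) (c : ι → ℝ)
    (q : Coord ι) (y x : ι → ℝ) :
    gaugedForm J Q c q y x
      = ∑ α, ∑ β, gaugedForm J Q c q (Pi.single α 1) (Pi.single β 1) * y α * x β := by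
  have hadd : ∀ y y' x, gaugedForm J Q c q (y + y') x
      = gaugedForm J Q c q y x + gaugedForm J Q c q y' x := fun y y' x => by
    have : dirMat J q (y + y') = dirMat J q y + dirMat J q y' := by
      ext; simp [dirMat, dir]
    simp only [gaugedForm, this, Matrix.mulVec_add, Matrix.add_mulVec, dirVec_add,
      add_dotProduct, dotProduct_add, dotProduct_sub]
    ring
  have hsmul : ∀ (a : ℝ) y x, gaugedForm J Q c q (a • y) x = a * gaugedForm J Q c q y x :=
    fun a y x => by
    have : dirMat J q (a • y) = a • dirMat J q y := by
      ext; simp [dirMat, dir]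
    simp only [gaugedForm, this, Matrix.mulVec_smul, Matrix.smul_mulVec, dirVec_smul,
      smul_dotProduct, dotProduct_smul, dotProduct_sub, smul_eq_mul]
    ring
  have hanti : ∀ y x, gaugedForm J Q c q y x = -gaugedForm J Q c q x y := fun y x => by
    simp only [gaugedForm, dotProduct_sub]
    ring
  have hsum : ∀ y x, gaugedForm J Q c q y x
      = ∑ α, y α * gaugedForm J Q c q (Pi.single α 1) x := fun y x => by
    let L : (ι → ℝ) →ₗ[ℝ] ℝ :=
      { toFun := fun y => gaugedForm J Q c q y x
        map_add' := fun y y' => hadd y y' x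
        map_smul' := fun a y => by simpa using hsmul a y x }
    have hy : y = ∑ α, y α • (Pi.single α 1 : ι → ℝ) := by
      ext β
      simp [Pi.single_apply]
    change L y = ∑ α, y α * L (Pi.single α 1)
    conv_lhs => rw [hy]
    simp
  rw [hsum]
  refine Finset.sum_congr rfl fun α _ => ?_
  rw [hanti, hsum, ← Finset.sum_neg_distrib, Finset.mul_sum]
  refine Finset.sum_congr rfl fun β _ => ?_
  rw [hanti (Pi.single α 1)]
  ring

/-- Contract the component condition with u and raise the first index. -/
theorem cov_eq_of_covDeriv {G J : Coord ι → Matrix ι ι ℝ} {q : Coord ι} {a : ι → ℝ}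
    (hG : IsUnit (G q).det)
    (h : ∀ α β γ, ∑ ρ, G q α ρ * covDeriv G J q ρ β γ
      = (1 / 2) * (a α * G q β γ + a β * G q α γ)) (u : ι → ℝ) :
    cov G J q u = (1 / 2 : ℝ) •
      (Matrix.vecMulVec ((G q)⁻¹ *ᵥ a) (G q *ᵥ u) + Matrix.vecMulVec u a) := by
  have h1 : G q * cov G J q u = (1 / 2 : ℝ) •
      (Matrix.vecMulVec a (G q *ᵥ u) + Matrix.vecMulVec (G q *ᵥ u) a) := by
    ext α β
    have : (G q * cov G J q u) α β = ∑ γ, (∑ ρ, G q α ρ * covDeriv G J q ρ β γ) * u γ := by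
      simp only [Matrix.mul_apply, cov_apply, Finset.mul_sum, Finset.sum_mul]
      rw [Finset.sum_comm]
      exact Finset.sum_congr rfl fun γ _ => Finset.sum_congr rfl fun ρ _ => by ring
    rw [this]
    simp only [h, Matrix.smul_apply, Matrix.add_apply, Matrix.vecMulVec_apply, Matrix.mulVec,
      dotProduct, smul_eq_mul, Finset.mul_sum, Finset.sum_mul, ← Finset.sum_add_distrib]
    exact Finset.sum_congr rfl fun γ _ => by ring
  have h2 := congrArg (fun M => (G q)⁻¹ * M) h1
  simp only [← mul_assoc, Matrix.nonsing_inv_mul _ hG, one_mul, Matrix.mul_smul, mul_add,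
    Matrix.mul_vecMulVec, Matrix.mulVec_mulVec, Matrix.one_mulVec] at h2
  exact h2

theorem isSCKTAt_of_isSCKT {U : Set (Coord ι)} {G J : Coord ι → Matrix ι ι ℝ} (hU : IsOpen U)
    (hGs : ∀ q ∈ U, SmoothMat G q) (hGp : ∀ q ∈ U, (G q).PosDef) (hJs : ∀ q ∈ U, SmoothMat J q)
    (h : IsSCKT U G J) : ∃ c : Coord ι → ι → ℝ, ∀ q ∈ U, IsSCKTAt G J q (c q) := by
  obtain ⟨hsymm, a, ha⟩ := h
  refine ⟨a, fun q hq => ⟨?_, (hGp q hq).det_pos.ne', hGs q hq, hJs q hq, hsymm q hq,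
    cov_eq_of_covDeriv (hGp q hq).det_pos.ne'.isUnit (ha q hq)⟩⟩
  filter_upwards [hU.mem_nhds hq] with x hx
  have := (hGp x hx).isHermitian
  rwa [Matrix.IsHermitian, Matrix.conjTranspose_eq_transpose_of_trivial] at this

/-! ### The connection and the Jacobi endomorphism of the second-order field -/

theorem conn_sode {G : Coord ι → Matrix ι ι ℝ} {q : Coord ι}
    (hG : ∀ᶠ x in 𝓝 q, (G x).IsSymm) (Q : Coord ι → ι → ℝ) (v : Coord ι) :
    conn (sode G Q) q v = chr G q v.ofLp := by
  ext α β
  -- The force is the quadratic form ½ wᵀMw plus a constant; the symmetry of the Christoffel symbols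
  -- makes its gradient M w, and the factor -½ in the definition of the connection removes the -2.
  set M : Matrix ι ι ℝ := fun δ γ => -2 * christoffel G q α δ γ with hM
  have hMs : M.IsSymm := by
    ext δ γ
    change -2 * christoffel G q α γ δ = -2 * christoffel G q α δ γ
    rw [christoffel_symm hG]
  have h1 : (fun w => sode G Q q w α)
      = fun w : Coord ι => (1 / 2) * (w.ofLp ⬝ᵥ M *ᵥ w.ofLp) + ∑ β, (G q)⁻¹ α β * Q q β := by
    ext w
    simp only [sode, hM, dotProduct, Matrix.mulVec, Finset.mul_sum]
    congr 1
    rw [← Finset.sum_neg_distrib]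
    refine Finset.sum_congr rfl fun δ _ => ?_
    rw [← Finset.sum_neg_distrib]
    exact Finset.sum_congr rfl fun γ _ => by ring
  rw [conn, h1, pd_quadratic M hMs]
  simp only [hM, chr, Matrix.mulVec, dotProduct, Finset.mul_sum]
  exact Finset.sum_congr rfl fun γ _ => by ring

theorem differentiableAt_christoffel {G : Coord ι → Matrix ι ι ℝ} {q : Coord ι}
    (hs : SmoothMat G q) (hd : (G q).det ≠ 0) (α β γ : ι) :
    DifferentiableAt ℝ (fun x => christoffel G x α β γ) q := by
  have hp : ∀ α β γ, DifferentiableAt ℝ (fun x => pd (fun z => G z α β) x γ) q := fun α β γ => by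
    have : DifferentiableAt ℝ (fderiv ℝ fun z => G z α β) q :=
      ((hs α β).fderiv_right (m := 1) (by norm_cast)).differentiableAt (by simp)
    exact this.clm_apply (differentiableAt_const _)
  have hi := (hs.inv hd).diffMat
  unfold christoffel
  exact (DifferentiableAt.fun_sum fun δ _ =>
    (hi α δ).mul (((hp _ _ _).add (hp _ _ _)).sub (hp _ _ _))).const_mul _

/-- At zero velocity the connection coefficients vanish and the force is g⁻¹Q, so the Jacobi
endomorphism sends w to -∇_w(g⁻¹Q), which equals -g⁻¹∇_w Q because the metric is parallel. This is
all that is used of Φ. -/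
theorem jacobiEndo_zero_mulVec {G : Coord ι → Matrix ι ι ℝ} {q : Coord ι}
    (hG : ∀ᶠ x in 𝓝 q, (G x).IsSymm) (hs : SmoothMat G q) (hd : (G q).det ≠ 0)
    {Q : Coord ι → ι → ℝ} (hQ : ∀ α, DifferentiableAt ℝ (fun x => Q x α) q) (w : ι → ℝ) :
    jacobiEndo (sode G Q) q 0 *ᵥ w
      = (G q)⁻¹ *ᵥ ((chr G q w)ᵀ *ᵥ Q q - dirVec Q q w) := by
  have hf0 : ∀ x, (sode G Q x 0).ofLp = (G x)⁻¹ *ᵥ Q x := fun x => by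
    ext α
    simp [sode, Matrix.mulVec, dotProduct]
  have hc0 : ∀ x, chr G x (0 : Coord ι).ofLp = 0 := fun x => by
    ext α β
    simp [chr]
  have hconn : ∀ α β, alongSode (sode G Q) (fun z => conn (sode G Q) z.1 z.2 α β) q 0
      = chr G q ((G q)⁻¹ *ᵥ Q q) α β := fun α β => by
    have e : (fun z : Coord ι × Coord ι => conn (sode G Q) z.1 z.2 α β)
        =ᶠ[𝓝 (q, 0)] fun z => chr G z.1 z.2.ofLp α β := by
      have h1 : ∀ᶠ x in 𝓝 q, ∀ᶠ y in 𝓝 x, (G y).IsSymm := hG.eventually_nhds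
      have h2 := (continuousAt_fst (p := ((q, 0) : Coord ι × Coord ι))).eventually h1
      filter_upwards [h2] with z hz
      rw [conn_sode hz]
    have hd2 : DiffAt₂ (fun x s => chr G x s.ofLp α β) q 0 := by
      unfold DiffAt₂ chr
      refine DifferentiableAt.fun_sum fun γ _ => ?_
      refine DifferentiableAt.mul ?_ (differentiableAt_euclidean.mp differentiableAt_snd γ)
      exact DifferentiableAt.comp (g := fun x => christoffel G x α β γ) (f := Prod.fst)
        ((q, 0) : Coord ι × Coord ι) (differentiableAt_christoffel hs hd α β γ)
        differentiableAt_fst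
    rw [alongSode, e.fderiv_eq, hd2.fderiv_eq_alongField, alongField, ← hf0]
    have hpd : ∀ γ, pd (fun s : Coord ι => chr G q s.ofLp α β) 0 γ = christoffel G q α β γ :=
      fun γ => by
      have : HasFDerivAt (fun s : Coord ι => chr G q s.ofLp α β)
          (∑ δ, christoffel G q α β δ • (EuclideanSpace.proj δ : Coord ι →L[ℝ] ℝ)) 0 :=
        HasFDerivAt.fun_sum fun δ _ =>
          (EuclideanSpace.proj δ : Coord ι →L[ℝ] ℝ).hasFDerivAt.const_mul _
      rw [pd, this.fderiv]
      simp
    simp only [hpd]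
    simp [chr, mul_comm]
  have hJ : jacobiEndo (sode G Q) q 0 *ᵥ w
      = -dirVec (fun x => (G x)⁻¹ *ᵥ Q x) q w - chr G q ((G q)⁻¹ *ᵥ Q q) *ᵥ w := by
    ext α
    simp only [Matrix.mulVec, dotProduct, jacobiEndo, hconn, Pi.sub_apply, Pi.neg_apply, dirVec,
      dir_eq_sum, sub_mul, Finset.sum_sub_distrib, neg_mul, Finset.sum_neg_distrib,
      conn_sode hG, hc0]
    have : ∀ x, (sode G Q x 0).ofLp α = ((G x)⁻¹ *ᵥ Q x) α := fun x => congrFun (hf0 x) α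
    simp only [this, Matrix.mulVec, dotProduct]
    simp
  rw [hJ, dirVec_mulVec (hs.inv hd).diffMat hQ, dirMat_metric_inv hG hs hd,
    chr_mulVec_comm hG _ w]
  simp only [Matrix.sub_mulVec, Matrix.neg_mulVec, ← Matrix.mulVec_mulVec, Matrix.mulVec_sub]
  abel

end Components

/-! ### Orthogonal projections onto distributions along `τ` -/

section Projection

variable {ι : Type} [Fintype ι] [DecidableEq ι]

/-- `R` is the matrix of the `G`-orthogonal projection onto `S`. -/
structure IsOrthProj (G R : Matrix ι ι ℝ) (S : Submodule ℝ (Coord ι)) : Prop where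
  self_adj : (G * R).IsSymm
  mem : ∀ w, WithLp.toLp 2 (R *ᵥ w) ∈ S
  eq_self : ∀ w ∈ S, R *ᵥ w.ofLp = w.ofLp

namespace IsOrthProj

variable {G R R' : Matrix ι ι ℝ} {S : Submodule ℝ (Coord ι)}

theorem mem_iff (h : IsOrthProj G R S) (w : Coord ι) : w ∈ S ↔ R *ᵥ w.ofLp = w.ofLp := by
  refine ⟨h.eq_self w, fun hw => ?_⟩
  have := h.mem w.ofLp
  rwa [hw] at this

theorem mul_of_mem (h : IsOrthProj G R S) {N : Matrix ι ι ℝ}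
    (hN : ∀ i, WithLp.toLp 2 (N *ᵥ Pi.single i 1) ∈ S) : R * N = N := by
  apply Matrix.ext_of_mulVec_single
  intro i
  rw [← Matrix.mulVec_mulVec]
  exact h.eq_self _ (hN i)

theorem idem (h : IsOrthProj G R S) : R * R = R := h.mul_of_mem fun _ => h.mem _

/-- Two projections with the same range satisfy RR' = R' and R'R = R; taking adjoints in the first
gives R'R = R', hence R = R'. This allows local projections to be glued. -/
theorem unique (h : IsOrthProj G R S) (h' : IsOrthProj G R' S) (hG : Gᵀ = G)
    (hd : G.det ≠ 0) : R = R' := by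
  have h1 : R * R' = R' := h.mul_of_mem fun _ => h'.mem _
  have h2 : R' * R = R := h'.mul_of_mem fun _ => h.mem _
  have h3 : G * R' = G * R := by
    have e1 := h.self_adj.eq
    have e2 := h'.self_adj.eq
    rw [Matrix.transpose_mul, hG] at e1 e2
    rw [← e2, ← h1, Matrix.transpose_mul, mul_assoc, e1, ← mul_assoc, e2, mul_assoc, h2]
  have h4 := congrArg (fun M => G⁻¹ * M) h3
  simp only [← mul_assoc, Matrix.nonsing_inv_mul _ hd.isUnit, one_mul] at h4
  exact h4.symm

end IsOrthProj

/-- The derivative of a self-adjoint projection vanishes if its values lie in the range of the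
projection. -/
theorem deriv_proj_eq_zero {G R N : Matrix ι ι ℝ} (hd : G.det ≠ 0) (hR : (G * R).IsSymm)
    (hG : Gᵀ = G) (hN : (G * N).IsSymm) (hRN : R * N = N)
    (hder : N = N * R + R * N) : N = 0 := by
  -- The product rule reduces to N = N R + N, hence N R = 0; the adjoint of this equation is R N =
  -- 0.
  have h1 : N * R = 0 := by
    rw [hRN] at hder
    simpa using hder
  have e1 := hR.eq
  have e2 := hN.eq
  rw [Matrix.transpose_mul, hG] at e1 e2
  have h2 : G * (R * N) = 0 := by
    have := congrArg (fun M => G * M) h1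
    simp only [mul_zero, ← mul_assoc] at this
    have h3 := congrArg Matrix.transpose this
    rw [Matrix.transpose_mul, Matrix.transpose_zero, Matrix.transpose_mul, hG, e2, ← mul_assoc,
      e1, mul_assoc] at h3
    exact h3
  rw [hRN] at h2
  have h4 := congrArg (fun M => G⁻¹ * M) h2
  simpa only [← mul_assoc, Matrix.nonsing_inv_mul _ hd.isUnit, one_mul, mul_zero] using h4

theorem isSymm_of_posDef {G : Matrix ι ι ℝ} (h : G.PosDef) : Gᵀ = G := by
  have := h.isHermitian
  rwa [Matrix.IsHermitian, Matrix.conjTranspose_eq_transpose_of_trivial] at this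

/-- The Gram matrix of independent vectors with respect to a positive definite form is positive
definite. -/
theorem isUnit_gram {n : ℕ} {G : Matrix ι ι ℝ} (hG : G.PosDef) {X : Fin n → Coord ι}
    (hX : LinearIndependent ℝ X) :
    ((Matrix.of fun α i => X i α)ᵀ * G * (Matrix.of fun α i => X i α)).det ≠ 0 := by
  set A : Matrix ι (Fin n) ℝ := Matrix.of fun α i => X i α with hA
  have hinj : Function.Injective A.mulVec := by
    rw [Matrix.mulVec_injective_iff]
    have : A.col = fun i => (WithLp.linearEquiv 2 ℝ (ι → ℝ)) (X i) := rfl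
    rw [this]
    exact hX.map' (WithLp.linearEquiv 2 ℝ (ι → ℝ)).toLinearMap (LinearEquiv.ker _)
  have := hG.conjTranspose_mul_mul_same hinj
  rw [Matrix.conjTranspose_eq_transpose_of_trivial] at this
  exact this.det_pos.ne'

/-- The orthogonal projection onto the span of linearly independent vectors. -/
def frameProj {n : ℕ} (G : Matrix ι ι ℝ) (A : Matrix ι (Fin n) ℝ) : Matrix ι ι ℝ :=
  A * ((Aᵀ * G * A)⁻¹ * (Aᵀ * G))

theorem isOrthProj_frameProj {n : ℕ} {G : Matrix ι ι ℝ} (hG : G.PosDef) {X : Fin n → Coord ι}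
    (hX : LinearIndependent ℝ X) :
    IsOrthProj G (frameProj G (Matrix.of fun α i => X i α))
      (Submodule.span ℝ (Set.range X)) := by
  have hu := (isUnit_gram hG hX).isUnit
  set A : Matrix ι (Fin n) ℝ := Matrix.of fun α i => X i α with hA
  have hGs := isSymm_of_posDef hG
  have hA' : ∀ c : Fin n → ℝ, WithLp.toLp 2 (A *ᵥ c) = ∑ i, c i • X i := fun c => by
    ext α
    simp [hA, Matrix.mulVec, dotProduct, mul_comm]
  have hSs : (Aᵀ * G * A)ᵀ = Aᵀ * G * A := by
    rw [Matrix.transpose_mul, Matrix.transpose_mul, Matrix.transpose_transpose, hGs, Matrix.mul_assoc]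
  refine ⟨?_, fun w => ?_, fun w hw => ?_⟩
  · rw [Matrix.IsSymm, frameProj, Matrix.transpose_mul, Matrix.transpose_mul,
      Matrix.transpose_mul, Matrix.transpose_mul, Matrix.transpose_transpose,
      Matrix.transpose_nonsing_inv, hSs, hGs]
    simp only [Matrix.mul_assoc]
  · rw [frameProj, ← Matrix.mulVec_mulVec, hA']
    exact Submodule.sum_mem _ fun i _ =>
      Submodule.smul_mem _ _ (Submodule.subset_span (Set.mem_range_self i))
  · obtain ⟨c, hc⟩ := (Submodule.mem_span_range_iff_exists_fun ℝ).mp hw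
    rw [← hc, ← hA', frameProj]
    simp only [Matrix.mulVec_mulVec]
    rw [Matrix.mul_assoc, Matrix.mul_assoc, Matrix.nonsing_inv_mul _ hu, Matrix.mul_one]

theorem smoothMat_frameProj {E : Type*} [NormedAddCommGroup E] [NormedSpace ℝ E] {n : ℕ}
    {G : E → Matrix ι ι ℝ} {A : E → Matrix ι (Fin n) ℝ} {z : E} (hG : SmoothMat G z)
    (hA : SmoothMat A z) (hd : ((A z)ᵀ * G z * A z).det ≠ 0) :
    SmoothMat (fun y => frameProj (G y) (A y)) z :=
  hA.mul ((((hA.transpose.mul hG).mul hA).inv hd).mul (hA.transpose.mul hG))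

theorem SmoothMat.comp {E F : Type*} [NormedAddCommGroup E] [NormedSpace ℝ E]
    [NormedAddCommGroup F] [NormedSpace ℝ F] {κ κ' : Type*} {H : F → Matrix κ κ' ℝ} {f : E → F}
    {x : E} (hH : SmoothMat H (f x)) (hf : ContDiffAt ℝ ∞ f x) :
    SmoothMat (fun y => H (f y)) x :=
  fun α β => ContDiffAt.comp x (hH α β) hf

variable {n : ℕ} {U : Set (Coord ι)} {G : Coord ι → Matrix ι ι ℝ}
  {D : Coord ι → Coord ι → Submodule ℝ (Coord ι)}

/-- A smooth distribution along `τ` has locally a smooth orthogonal projection of bounded rank. -/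
theorem IsSmoothDistribution.exists_proj (hGs : ∀ q ∈ U, SmoothMat G q)
    (hGp : ∀ q ∈ U, (G q).PosDef) (hD : IsSmoothDistribution n U D) :
    ∃ R : Coord ι × Coord ι → Matrix ι ι ℝ, ∀ z, z.1 ∈ U →
      IsOrthProj (G z.1) (R z) (D z.1 z.2) ∧ SmoothMat R z ∧
        ∃ (A : Matrix ι (Fin n) ℝ) (B : Matrix (Fin n) ι ℝ), R z = A * B := by
  have hloc : ∀ z₀ : Coord ι × Coord ι, z₀.1 ∈ U → ∃ R₀ : Coord ι × Coord ι → Matrix ι ι ℝ,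
      ∃ O : Set (Coord ι × Coord ι), IsOpen O ∧ z₀ ∈ O ∧
        ∀ z ∈ O, z.1 ∈ U ∧ IsOrthProj (G z.1) (R₀ z) (D z.1 z.2) ∧ SmoothMat R₀ z ∧
        ∃ (A : Matrix ι (Fin n) ℝ) (B : Matrix (Fin n) ι ℝ), R₀ z = A * B := by
    rintro ⟨q, v⟩ hq
    obtain ⟨O, hO, hz, hOU, X, hX, hXD⟩ := hD q hq v
    refine ⟨fun z => frameProj (G z.1) (Matrix.of fun α i => X i z α), O, hO, hz, fun z hzO => ?_⟩
    have hzU : z.1 ∈ U := (hOU hzO).1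
    refine ⟨hzU, ?_, ?_, _, _, rfl⟩
    · rw [← (hXD z hzO).2]
      exact isOrthProj_frameProj (hGp _ hzU) (hXD z hzO).1
    · refine smoothMat_frameProj ((hGs _ hzU).comp contDiffAt_fst) (fun α i => ?_)
        (isUnit_gram (hGp _ hzU) (hXD z hzO).1)
      exact contDiffAt_euclidean.mp ((hX i).contDiffAt (hO.mem_nhds hzO)) α
  have hex : ∀ z : Coord ι × Coord ι, ∃ R : Matrix ι ι ℝ, z.1 ∈ U →
      IsOrthProj (G z.1) R (D z.1 z.2) ∧
        ∃ (A : Matrix ι (Fin n) ℝ) (B : Matrix (Fin n) ι ℝ), R = A * B := by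
    intro z
    by_cases hz : z.1 ∈ U
    · obtain ⟨R₀, O, -, hzO, h⟩ := hloc z hz
      exact ⟨R₀ z, fun _ => ⟨(h z hzO).2.1, (h z hzO).2.2.2⟩⟩
    · exact ⟨0, fun h => absurd h hz⟩
  choose R hR using hex
  refine ⟨R, fun z hz => ⟨(hR z hz).1, ?_, (hR z hz).2⟩⟩
  obtain ⟨R₀, O, hO, hzO, h⟩ := hloc z hz
  -- By uniqueness the pointwise choices agree near `z` with the projection built from a smooth
  -- local frame.
  refine (h z hzO).2.2.1.congr ?_
  filter_upwards [hO.mem_nhds hzO] with y hy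
  obtain ⟨hyU, hy1, -⟩ := h y hy
  exact (hR y hyU).1.unique hy1 (isSymm_of_posDef (hGp _ hyU)) (hGp _ hyU).det_pos.ne'

/-- A distribution along `τ` whose sections are stable under vertical derivatives does not depend
on the velocity. -/
theorem proj_const_of_vertical (hU : IsOpen U) (hGp : ∀ q ∈ U, (G q).PosDef)
    {R : Coord ι × Coord ι → Matrix ι ι ℝ}
    (hR : ∀ z : Coord ι × Coord ι, z.1 ∈ U → IsOrthProj (G z.1) (R z) (D z.1 z.2))
    (hRs : ∀ z : Coord ι × Coord ι, z.1 ∈ U → SmoothMat R z)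
    (hvert : ∀ O X, IsSection U D O X → ∀ q v, (q, v) ∈ O →
      ∀ Z : Coord ι, fderiv ℝ X (q, v) (0, Z) ∈ D q v)
    {q : Coord ι} (hq : q ∈ U) (v : Coord ι) : R (q, v) = R (q, 0) := by
  -- The columns of the projection are sections of the distribution, so their vertical derivatives
  -- lie in it. The derivative N of R along the fibre thus satisfies R N = N.
  have hsec : ∀ i, IsSection U D (U ×ˢ Set.univ)
      (fun z => WithLp.toLp 2 (R z *ᵥ Pi.single i 1)) := fun i => by
    refine ⟨hU.prod isOpen_univ, subset_rfl, fun z hz => ?_, fun z hz => (hR z hz.1).mem _⟩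
    refine (contDiffAt_euclidean.mpr fun α => ?_).contDiffWithinAt
    simpa using hRs z hz.1 α i
  have hFs : ∀ v, SmoothMat (fun w => R (q, w)) v := fun v =>
    (hRs (q, v) hq).comp (contDiffAt_const.prodMk contDiffAt_id)
  have hz : ∀ v u, dirMat (fun w => R (q, w)) v u = 0 := fun v u => by
    have hRz := hR (q, v) hq
    have hGs := isSymm_of_posDef (hGp q hq)
    refine deriv_proj_eq_zero (hGp q hq).det_pos.ne' hRz.self_adj hGs ?_ ?_ ?_
    · have h1 := dirMat_mul (F := fun _ => G q) (H := fun w => R (q, w)) (q := v)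
        (fun _ _ => differentiableAt_const _) (hFs v).diffMat u
      rw [dirMat_const, zero_mul, zero_add] at h1
      rw [← h1, Matrix.IsSymm, ← dirMat_transpose]
      congr 1
      ext1 w
      exact (hR (q, w) hq).self_adj.eq
    · refine hRz.mul_of_mem fun i => ?_
      have hmem := hvert _ _ (hsec i) q v ⟨hq, trivial⟩ (WithLp.toLp 2 u)
      have hX : HasFDerivAt (fun z => (WithLp.toLp 2 (R z *ᵥ Pi.single i 1) : Coord ι))
          (fderiv ℝ (fun z => (WithLp.toLp 2 (R z *ᵥ Pi.single i 1) : Coord ι)) (q, v)) (q, v) :=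
        (((hsec i).2.2.1.contDiffAt ((hsec i).1.mem_nhds ⟨hq, trivial⟩)).differentiableAt
          (by simp)).hasFDerivAt
      convert! hmem using 1
      ext α
      have hc := HasFDerivAt.comp (g := fun z => (WithLp.toLp 2 (R z *ᵥ Pi.single i 1) : Coord ι))
        (f := fun w => (q, w)) v hX (hasFDerivAt_prodMk_right q v)
      have hc' := (EuclideanSpace.proj α : Coord ι →L[ℝ] ℝ).hasFDerivAt.comp v hc
      have he : (fun w => R (q, w) α i) = (EuclideanSpace.proj α : Coord ι →L[ℝ] ℝ) ∘
          ((fun z => (WithLp.toLp 2 (R z *ᵥ Pi.single i 1) : Coord ι)) ∘ fun w => (q, w)) := by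
        ext w
        simp
      rw [← he] at hc'
      simp [dirMat, dir, hc'.fderiv]
    · have h1 := dirMat_mul (hFs v).diffMat (hFs v).diffMat u
      rw [← h1]
      congr 1
      ext1 w
      exact (hR (q, w) hq).idem.symm
  ext α β
  refine is_const_of_fderiv_eq_zero (𝕜 := ℝ) (f := fun w => R (q, w) α β)
    (fun w => (hFs w α β).differentiableAt (by simp)) (fun w => ?_) v 0
  ext u
  have := congrFun (congrFun (hz w u.ofLp) α) β
  exact this

/-- A distribution on the base whose sections are stable under the dynamical covariant derivative
is parallel. -/
theorem cov_proj_eq_zero (hU : IsOpen U) (hGp : ∀ q ∈ U, (G q).PosDef)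
    (hGs : ∀ q ∈ U, SmoothMat G q) (Q : Coord ι → ι → ℝ) {P : Coord ι → Matrix ι ι ℝ}
    (hP : ∀ q ∈ U, ∀ v, IsOrthProj (G q) (P q) (D q v)) (hPs : ∀ q ∈ U, SmoothMat P q)
    (hnabla : ∀ O X, IsSection U D O X → ∀ q v, (q, v) ∈ O → nabla (sode G Q) X q v ∈ D q v)
    {q : Coord ι} (hq : q ∈ U) (u : ι → ℝ) : cov G P q u = 0 := by
  have hGn : ∀ᶠ x in 𝓝 q, (G x).IsSymm := by
    filter_upwards [hU.mem_nhds hq] with x hx using isSymm_of_posDef (hGp x hx)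
  have hGq := isSymm_of_posDef (hGp q hq)
  have hdG := (hGp q hq).det_pos.ne'
  have hPq := hP q hq 0
  have hGP : (P q)ᵀ * G q = G q * P q := by
    have := hPq.self_adj.eq
    rwa [Matrix.transpose_mul, hGq] at this
  refine deriv_proj_eq_zero hdG hPq.self_adj hGq ?_ ?_ ?_
  -- Self-adjointness of ∇_u P: differentiate the symmetric matrix G P and remove the connection
  -- terms, which form a symmetric matrix together.
  · have h1 := dirMat_mul (hGs q hq).diffMat (hPs q hq).diffMat u
    have h2 : (dirMat (fun x => G x * P x) q u)ᵀ = dirMat (fun x => G x * P x) q u := by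
      rw [← dirMat_transpose]
      refine dirMat_congr ?_ u
      filter_upwards [hU.mem_nhds hq] with x hx using (hP x hx 0).self_adj.eq
    have h3 : G q * cov G P q u = dirMat (fun x => G x * P x) q u
        - ((chr G q u)ᵀ * (G q * P q) + (G q * P q) * chr G q u) := by
      rw [h1, dirMat_metric hGn hdG.isUnit, cov]
      simp only [mul_add, mul_sub, add_mul, ← mul_assoc]
      abel
    rw [h3, Matrix.IsSymm, Matrix.transpose_sub, h2, Matrix.transpose_add, Matrix.transpose_mul,
      Matrix.transpose_mul (G q * P q), Matrix.transpose_transpose, hPq.self_adj.eq]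
    abel
  · have key : P q * (dirMat P q u + chr G q u * P q) = dirMat P q u + chr G q u * P q := by
      refine hPq.mul_of_mem fun i => ?_
      set X : Coord ι × Coord ι → Coord ι :=
        fun z => WithLp.toLp 2 (P z.1 *ᵥ Pi.single i 1) with hX
      have hXs : ∀ x ∈ U, ∀ v, ContDiffAt ℝ ∞ X (x, v) := fun x hx v =>
        contDiffAt_euclidean.mpr fun α => by
          simpa [hX, Function.comp_def] using ContDiffAt.comp (g := fun x => P x α i)
            (f := Prod.fst) ((x, v) : Coord ι × Coord ι) (hPs x hx α i) contDiffAt_fst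
      have hsec : IsSection U D (U ×ˢ Set.univ) X :=
        ⟨hU.prod isOpen_univ, subset_rfl, fun z hz => (hXs z.1 hz.1 z.2).contDiffWithinAt,
          fun z hz => (hP z.1 hz.1 z.2).mem _⟩
      -- The section does not depend on the velocity, so at velocity u its dynamical covariant
      -- derivative is the ordinary one in the direction u.
      have hmem := hnabla _ _ hsec q (WithLp.toLp 2 u) ⟨hq, trivial⟩
      rw [(hP q hq _).mem_iff, ← hPq.mem_iff] at hmem
      convert! hmem using 1
      ext α
      rw [nabla, conn_sode hGn]
      have hder : (alongSode (sode G Q) X q (WithLp.toLp 2 u)) α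
          = (dirMat P q u *ᵥ Pi.single i 1) α := by
        have h1 := (EuclideanSpace.proj α : Coord ι →L[ℝ] ℝ).hasFDerivAt.comp _
          ((hXs q hq (WithLp.toLp 2 u)).differentiableAt (by simp)).hasFDerivAt
        have h2 : HasFDerivAt (fun z : Coord ι × Coord ι => P z.1 α i)
            ((fderiv ℝ (fun x => P x α i) q).comp
              (ContinuousLinearMap.fst ℝ (Coord ι) (Coord ι))) (q, WithLp.toLp 2 u) :=
          HasFDerivAt.comp (g := fun x => P x α i) (f := Prod.fst)
            ((q, WithLp.toLp 2 u) : Coord ι × Coord ι)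
            ((hPs q hq).diffMat α i).hasFDerivAt hasFDerivAt_fst
        have he : (fun z : Coord ι × Coord ι => P z.1 α i)
            = (EuclideanSpace.proj α : Coord ι →L[ℝ] ℝ) ∘ X := by
          ext z
          simp [hX]
        rw [← he] at h1
        have h3 := DFunLike.congr_fun (h1.unique h2)
          (WithLp.toLp 2 u, sode G Q q (WithLp.toLp 2 u))
        simpa [alongSode, dirMat, dir] using h3
      rw [PiLp.add_apply, hder, Matrix.add_mulVec]
      simp only [hX, Pi.add_apply, ← Matrix.mulVec_mulVec]
      rfl
    -- The remaining term P Γ(u) of ∇_u P has values in the range of P, so all of ∇_u P does.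
    have h1 : P q * cov G P q u = P q * (dirMat P q u + chr G q u * P q)
        - P q * P q * chr G q u := by
      rw [cov]
      simp only [mul_add, mul_sub, ← mul_assoc, hPq.idem]
      abel
    rw [h1, key, hPq.idem, cov]
    abel
  · have h1 := dirMat_mul (hPs q hq).diffMat (hPs q hq).diffMat u
    have h2 : dirMat (fun x => P x * P x) q u = dirMat P q u := by
      refine dirMat_congr ?_ u
      filter_upwards [hU.mem_nhds hq] with x hx using (hP x hx 0).idem
    rw [h2] at h1
    have h3 : cov G P q u * P q + P q * cov G P q u
        = (dirMat P q u * P q + P q * dirMat P q u) - (P q * P q) * chr G q u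
          + chr G q u * (P q * P q) := by
      simp only [cov, mul_add, mul_sub, add_mul, sub_mul, ← mul_assoc]
      abel
    rw [h3, ← h1, hPq.idem, cov]

theorem isSCKTAt_of_parallel (hU : IsOpen U) (hGp : ∀ q ∈ U, (G q).PosDef)
    (hGs : ∀ q ∈ U, SmoothMat G q) {P : Coord ι → Matrix ι ι ℝ} {q : Coord ι} (hq : q ∈ U)
    (hP : (G q * P q).IsSymm) (hPs : SmoothMat P q) (hc : ∀ u, cov G P q u = 0) :
    IsSCKTAt G P q 0 where
  symm := by filter_upwards [hU.mem_nhds hq] with x hx using isSymm_of_posDef (hGp x hx)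
  det_ne := (hGp q hq).det_pos.ne'
  smooth_metric := hGs q hq
  smooth := hPs
  self_adj := hP
  cov_eq u := by simp [hc]

/-- If the range of a parallel projection is stable under the Jacobi endomorphism, the covariant
differential of `Q` vanishes on that range and its orthogonal complement. -/
theorem dirVec_eq_of_jacobi {P : Coord ι → Matrix ι ι ℝ} {q : Coord ι}
    (hp : IsSCKTAt G P q 0) {S : Submodule ℝ (Coord ι)} (hP : IsOrthProj (G q) (P q) S)
    {Q : Coord ι → ι → ℝ} (hQ : ∀ α, DifferentiableAt ℝ (fun x => Q x α) q)
    (hjac : ∀ w ∈ S, Matrix.toEuclideanLin (jacobiEndo (sode G Q) q 0) w ∈ S) (x y : ι → ℝ) :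
    dirVec Q q (P q *ᵥ y) ⬝ᵥ (x - P q *ᵥ x)
      = Q q ⬝ᵥ chr G q (P q *ᵥ y) *ᵥ (x - P q *ᵥ x) := by
  set Φ := jacobiEndo (sode G Q) q 0 with hΦ
  have h1 : P q *ᵥ (Φ *ᵥ (P q *ᵥ y)) = Φ *ᵥ (P q *ᵥ y) := hP.eq_self _ (hjac _ (hP.mem y))
  -- Φ P y lies in the distribution and x - P x is orthogonal to it; by the formula for Φ at zero
  -- velocity this says that ∇_{Py} Q vanishes on x - P x.
  have h2 : G q *ᵥ (Φ *ᵥ (P q *ᵥ y)) ⬝ᵥ (x - P q *ᵥ x) = 0 := by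
    rw [← h1, ← hp.transpose_metric, ← dot_mulVec, Matrix.mulVec_sub,
      Matrix.mulVec_mulVec x, hP.idem, sub_self, dotProduct_zero]
  rw [hΦ, jacobiEndo_zero_mulVec hp.symm hp.smooth_metric hp.det_ne hQ, hp.metric_inv,
    sub_dotProduct, ← dot_mulVec] at h2
  linarith

/-- For parallel P, D_P Q(y, x) = (∇_{Py} Q)(x) - (∇_{Px} Q)(y). Splitting x and y by P, the parts
mixing the range and its complement vanish by the Jacobi condition, and the rest is dQ(Py, Px), zero
by assumption. -/
theorem gaugedForm_parallel_eq_zero {P : Coord ι → Matrix ι ι ℝ} {q : Coord ι}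
    (hp : IsSCKTAt G P q 0) {S : Submodule ℝ (Coord ι)} (hP : IsOrthProj (G q) (P q) S)
    {Q : Coord ι → ι → ℝ} (hQ : ∀ α, DifferentiableAt ℝ (fun x => Q x α) q)
    (hjac : ∀ w ∈ S, Matrix.toEuclideanLin (jacobiEndo (sode G Q) q 0) w ∈ S)
    (hcl : ∀ X ∈ S, ∀ Y ∈ S, dirVec Q q X.ofLp ⬝ᵥ Y.ofLp = dirVec Q q Y.ofLp ⬝ᵥ X.ofLp)
    (y x : ι → ℝ) : gaugedForm P Q 0 q y x = 0 := by
  have h1 := dirVec_eq_of_jacobi hp hP hQ hjac x y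
  have h2 := dirVec_eq_of_jacobi hp hP hQ hjac y x
  have h3 := hcl _ (hP.mem x) _ (hP.mem y)
  have h4 : chr G q (P q *ᵥ y) *ᵥ (P q *ᵥ x) = chr G q (P q *ᵥ x) *ᵥ (P q *ᵥ y) :=
    chr_mulVec_comm hp.symm _ _
  have h5 := hp.dotProduct_dirMat_antisymm (Q q) y x
  rw [chr_mulVec_comm hp.symm y, chr_mulVec_comm hp.symm x] at h5
  simp only [Matrix.mulVec_sub, dotProduct_sub, zero_dotProduct] at h1 h2 h5
  simp only [gaugedForm, zero_dotProduct, dotProduct_sub]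
  rw [h4] at h1
  change dirVec Q q (P q *ᵥ x) ⬝ᵥ (P q *ᵥ y) = dirVec Q q (P q *ᵥ y) ⬝ᵥ (P q *ᵥ x) at h3
  linear_combination h1 - h2 - h3 - h5

end Projection

/-! ### Components of geometric objects in a smooth chart -/

section Chart

variable {ι : Type} [Fintype ι] [DecidableEq ι]
  {M : Type*} [TopologicalSpace M] [ChartedSpace (Coord ι) M] [IsManifold 𝓘(ℝ, Coord ι) ∞ M]
  {e : OpenPartialHomeomorph M (Coord ι)}

theorem inner_frame (e : OpenPartialHomeomorph M (Coord ι)) (g : RiemMetric ι M)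
    (q x y : Coord ι) :
    g.inner (e.symm q) (frame e q x) (frame e q y) = x.ofLp ⬝ᵥ compMetric e g q *ᵥ y.ofLp := by
  have hx : ∀ x : Coord ι, x = ∑ α, x α • EuclideanSpace.single α (1 : ℝ) := fun x => by
    ext β
    simp [Pi.single_apply]
  conv_lhs => rw [hx x, hx y]
  simp only [map_sum, map_smul, sum_apply, smul_apply,
    smul_eq_mul, dotProduct, Matrix.mulVec, Finset.mul_sum, compMetric]
  rw [Finset.sum_comm]
  exact Finset.sum_congr rfl fun _ _ => Finset.sum_congr rfl fun _ _ => by ring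

namespace IsSmoothChart

variable (he : IsSmoothChart e) {q : Coord ι}
include he

theorem mdifferentiable : e.MDifferentiable 𝓘(ℝ, Coord ι) 𝓘(ℝ, Coord ι) :=
  ⟨(contMDiffOn_of_mem_maximalAtlas he).mdifferentiableOn (by simp),
    (contMDiffOn_symm_of_mem_maximalAtlas he).mdifferentiableOn (by simp)⟩

theorem coframe_frame (hq : q ∈ e.target) (w : Coord ι) : coframe e q (frame e q w) = w :=
  DFunLike.congr_fun (he.mdifferentiable.comp_symm_deriv hq) w

theorem frame_coframe (hq : q ∈ e.target) (w : TangentSpace 𝓘(ℝ, Coord ι) (e.symm q)) :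
    frame e q (coframe e q w) = w := by
  have h := he.mdifferentiable.symm_comp_deriv (e.map_target hq)
  rw [e.right_inv hq] at h
  exact DFunLike.congr_fun h w

/-- The frame is the tangent map of the inverse chart applied to a constant vector field. -/
theorem contMDiffAt_frame (hq : q ∈ e.target) (w : Coord ι) :
    ContMDiffAt 𝓘(ℝ, Coord ι) (𝓘(ℝ, Coord ι).prod 𝓘(ℝ, Coord ι)) ∞
      (fun q => Bundle.TotalSpace.mk' (Coord ι)
        (E := fun x : M => TangentSpace 𝓘(ℝ, Coord ι) x) (e.symm q) (frame e q w)) q := by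
  have h1 := (contMDiffOn_symm_of_mem_maximalAtlas he).contMDiffOn_tangentMapWithin
    (m := ∞) (by simp) e.open_target.uniqueMDiffOn
  have h2 : ContMDiffAt 𝓘(ℝ, Coord ι) 𝓘(ℝ, Coord ι).tangent ∞
      (fun q => Bundle.TotalSpace.mk' (Coord ι)
        (E := fun x : Coord ι => TangentSpace 𝓘(ℝ, Coord ι) x) q w) q :=
    contMDiffAt_vectorSpace_iff_contDiffAt.mpr contDiffAt_const
  have h3 := (h1 (Bundle.TotalSpace.mk' (Coord ι) q w) hq)
  have h4 := h3.comp_of_eq (x := q) (s := e.target) h2.contMDiffWithinAt (fun x hx => hx) rfl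
  refine (h4.contMDiffAt (e.open_target.mem_nhds hq)).congr_of_eventuallyEq ?_
  filter_upwards [e.open_target.mem_nhds hq] with x hx
  simp only [Function.comp, tangentMapWithin, frame,
    mfderivWithin_of_isOpen e.open_target hx]
  rfl

theorem contDiffAt_compForm (hq : q ∈ e.target)
    {μ : ∀ x : M, TangentSpace 𝓘(ℝ, Coord ι) x →L[ℝ] ℝ} (hμ : SmoothForm μ) (α : ι) :
    ContDiffAt ℝ ∞ (fun x => compForm e μ x α) q := by
  have h := ContMDiffAt.clm_bundle_apply (F₁ := Coord ι) (F₂ := ℝ)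
    (E₁ := fun x : M => TangentSpace 𝓘(ℝ, Coord ι) x) (E₂ := Bundle.Trivial M ℝ)
    (ϕ := fun q => μ (e.symm q))
    (ContMDiffAt.comp q hμ.contMDiffAt (contMDiffAt_symm_of_mem_maximalAtlas he hq))
    (he.contMDiffAt_frame hq (EuclideanSpace.single α 1))
  simp only [Bundle.contMDiffAt_totalSpace] at h
  exact h.2.contDiffAt

theorem contDiffAt_inner (hq : q ∈ e.target) (g : RiemMetric ι M)
    {X Y : ∀ q, TangentSpace 𝓘(ℝ, Coord ι) (e.symm q)}
    (hX : ContMDiffAt 𝓘(ℝ, Coord ι) (𝓘(ℝ, Coord ι).prod 𝓘(ℝ, Coord ι)) ∞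
      (fun q => Bundle.TotalSpace.mk' (Coord ι)
        (E := fun x : M => TangentSpace 𝓘(ℝ, Coord ι) x) (e.symm q) (X q)) q)
    (hY : ContMDiffAt 𝓘(ℝ, Coord ι) (𝓘(ℝ, Coord ι).prod 𝓘(ℝ, Coord ι)) ∞
      (fun q => Bundle.TotalSpace.mk' (Coord ι)
        (E := fun x : M => TangentSpace 𝓘(ℝ, Coord ι) x) (e.symm q) (Y q)) q) :
    ContDiffAt ℝ ∞ (fun x => g.inner (e.symm x) (X x) (Y x)) q := by
  have h := ContMDiffAt.clm_bundle_apply₂ (F₁ := Coord ι) (F₂ := Coord ι) (F₃ := ℝ)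
    (E₁ := fun x : M => TangentSpace 𝓘(ℝ, Coord ι) x)
    (E₂ := fun x : M => TangentSpace 𝓘(ℝ, Coord ι) x) (E₃ := Bundle.Trivial M ℝ)
    (ψ := fun q => g.inner (e.symm q))
    (ContMDiffAt.comp q g.contMDiff.contMDiffAt (contMDiffAt_symm_of_mem_maximalAtlas he hq))
    hX hY
  simp only [Bundle.contMDiffAt_totalSpace] at h
  exact h.2.contDiffAt

theorem smoothMat_compMetric (hq : q ∈ e.target) (g : RiemMetric ι M) :
    SmoothMat (compMetric e g) q := fun α β =>
  he.contDiffAt_inner hq g (he.contMDiffAt_frame hq (EuclideanSpace.single α 1))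
    (he.contMDiffAt_frame hq (EuclideanSpace.single β 1))

theorem frame_injective (hq : q ∈ e.target) : Function.Injective (frame e q) :=
  Function.LeftInverse.injective (he.coframe_frame hq)

theorem posDef_compMetric (hq : q ∈ e.target) (g : RiemMetric ι M) :
    (compMetric e g q).PosDef := by
  refine Matrix.PosDef.of_dotProduct_mulVec_pos ?_ fun x hx => ?_
  · ext α β
    simp only [Matrix.conjTranspose_apply, star_trivial]
    exact g.symm _ _ _
  · rw [star_trivial]
    change 0 < (WithLp.toLp 2 x : Coord ι).ofLp ⬝ᵥ
      compMetric e g q *ᵥ (WithLp.toLp 2 x : Coord ι).ofLp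
    rw [← inner_frame]
    refine g.pos _ _ fun h => hx ?_
    have : (WithLp.toLp 2 x : Coord ι) = 0 := he.frame_injective hq (by rw [h, map_zero])
    exact congrArg WithLp.ofLp this

/-- The matrix of a (1,1) tensor field represents it in the coordinate frame. -/
theorem frame_compEnd (hq : q ∈ e.target)
    (J : ∀ x : M, TangentSpace 𝓘(ℝ, Coord ι) x →ₗ[ℝ] TangentSpace 𝓘(ℝ, Coord ι) x) (w : Coord ι) :
    frame e q (WithLp.toLp 2 (compEnd e J q *ᵥ w.ofLp)) = J (e.symm q) (frame e q w) := by
  rw [← he.frame_coframe hq (J (e.symm q) (frame e q w))]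
  congr 1
  let L : Coord ι →ₗ[ℝ] Coord ι :=
    (coframe e q).toLinearMap ∘ₗ J (e.symm q) ∘ₗ (frame e q).toLinearMap
  change _ = L w
  have hx : w = ∑ α, w α • EuclideanSpace.single α (1 : ℝ) := by
    ext β
    simp [Pi.single_apply]
  conv_rhs => rw [hx]
  ext α
  simp only [map_sum, map_smul, Matrix.mulVec, dotProduct]
  rw [WithLp.ofLp_sum, Finset.sum_apply]
  exact Finset.sum_congr rfl fun β _ => mul_comm _ _

theorem metric_mul_compEnd (hq : q ∈ e.target) (g : RiemMetric ι M)
    (J : ∀ x : M, TangentSpace 𝓘(ℝ, Coord ι) x →ₗ[ℝ] TangentSpace 𝓘(ℝ, Coord ι) x) (α β : ι) :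
    (compMetric e g q * compEnd e J q) α β = g.inner (e.symm q)
      (frame e q (EuclideanSpace.single α 1))
      (J (e.symm q) (frame e q (EuclideanSpace.single β 1))) := by
  rw [← he.frame_compEnd hq J, inner_frame]
  simp only [PiLp.ofLp_single, Matrix.mulVec_single_one, single_one_dotProduct]
  rfl

/-- The entries g(∂_α, J ∂_β) are smooth and form the matrix G J; multiplying by the smooth matrix
G⁻¹ recovers the components of J. -/
theorem smoothMat_compEnd (hq : q ∈ e.target) (g : RiemMetric ι M)
    {J : ∀ x : M, TangentSpace 𝓘(ℝ, Coord ι) x →L[ℝ] TangentSpace 𝓘(ℝ, Coord ι) x}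
    (hJ : SmoothEnd J) : SmoothMat (compEnd e fun x => (J x).toLinearMap) q := by
  set N : Coord ι → Matrix ι ι ℝ := fun q α β => g.inner (e.symm q)
    (frame e q (EuclideanSpace.single α 1)) (J (e.symm q) (frame e q (EuclideanSpace.single β 1)))
    with hN
  have hNs : SmoothMat N q := fun α β => by
    have h := ContMDiffAt.clm_bundle_apply (F₁ := Coord ι) (F₂ := Coord ι)
      (E₁ := fun x : M => TangentSpace 𝓘(ℝ, Coord ι) x)
      (E₂ := fun x : M => TangentSpace 𝓘(ℝ, Coord ι) x)
      (ϕ := fun q => J (e.symm q))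
      (ContMDiffAt.comp q hJ.contMDiffAt (contMDiffAt_symm_of_mem_maximalAtlas he hq))
      (he.contMDiffAt_frame hq (EuclideanSpace.single β 1))
    exact he.contDiffAt_inner hq g (he.contMDiffAt_frame hq (EuclideanSpace.single α 1)) h
  have hd : ∀ x ∈ e.target, (compMetric e g x).det ≠ 0 := fun x hx =>
    (he.posDef_compMetric hx g).det_pos.ne'
  refine SmoothMat.congr (((he.smoothMat_compMetric hq g).inv (hd q hq)).mul hNs) ?_
  filter_upwards [e.open_target.mem_nhds hq] with x hx
  have hG : compMetric e g x * compEnd e (fun x => (J x).toLinearMap) x = N x := by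
    ext α β
    exact he.metric_mul_compEnd hx g _ α β
  rw [← hG, ← mul_assoc, Matrix.nonsing_inv_mul _ (hd x hx).isUnit, one_mul]

theorem det_compEnd_ne_zero (hq : q ∈ e.target)
    {J : ∀ x : M, TangentSpace 𝓘(ℝ, Coord ι) x →ₗ[ℝ] TangentSpace 𝓘(ℝ, Coord ι) x}
    (hJ : LinearMap.det (J (e.symm q)) ≠ 0) : (compEnd e J q).det ≠ 0 := by
  intro h0
  obtain ⟨w, hw, hw0⟩ := Matrix.exists_mulVec_eq_zero_iff.mpr h0
  have h1 := he.frame_compEnd hq J (WithLp.toLp 2 w)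
  rw [WithLp.ofLp_toLp, hw0, WithLp.toLp_zero, map_zero] at h1
  have h2 : frame e q (WithLp.toLp 2 w) = 0 := by
    have : FiniteDimensional ℝ (TangentSpace 𝓘(ℝ, Coord ι) (e.symm q)) :=
      inferInstanceAs (FiniteDimensional ℝ (Coord ι))
    have hinj : Function.Injective (J (e.symm q)) :=
      ((LinearMap.isUnit_iff_isUnit_det _).mpr hJ.isUnit |> (Module.End.isUnit_iff _).mp).1
    exact hinj (by rw [← h1, map_zero])
  have : (WithLp.toLp 2 w : Coord ι) = 0 := he.frame_injective hq (by rw [h2, map_zero])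
  exact hw (congrArg WithLp.ofLp this)

theorem isOrthProj_compEnd_projK (hq : q ∈ e.target) (g : RiemMetric ι M)
    (K : ∀ x : M, TangentSpace 𝓘(ℝ, Coord ι) x → Submodule ℝ (TangentSpace 𝓘(ℝ, Coord ι) x)) :
    IsOrthProj (compMetric e g q) (compEnd e (projK g K) q) (compDist e K q 0) := by
  set S := K (e.symm q) 0 with hS
  have hD : ∀ w, w ∈ compDist e K q 0 ↔ frame e q w ∈ S := fun w => by
    rw [compDist, Submodule.mem_comap, map_zero]
    rfl
  have hfr := he.frame_compEnd hq (projK g K)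
  have hmem : ∀ x, projK g K (e.symm q) x ∈ S := fun x => by
    simp [projK, orthProj, hS]
  have hperp : ∀ x, x - projK g K (e.symm q) x ∈ perp g (e.symm q) S := fun x => by
    have := Submodule.projection_apply_mem (isCompl_perp g (e.symm q) S).symm x
    rwa [Submodule.projection_eq_self_sub_projection] at this
  refine ⟨?_, fun w => ?_, fun w hw => ?_⟩
  -- Since x - P x is orthogonal to P y, the form g(x, P y) equals the symmetric expression g(P x, P
  -- y).
  · have hsymm : ∀ x y, g.inner (e.symm q) x (projK g K (e.symm q) y)
        = g.inner (e.symm q) (projK g K (e.symm q) x) (projK g K (e.symm q) y) := fun x y => by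
      have := hperp x _ (hmem y)
      rw [g.symm, map_sub, sub_apply, sub_eq_zero] at this
      exact this
    ext α β
    rw [Matrix.transpose_apply, he.metric_mul_compEnd hq, he.metric_mul_compEnd hq, hsymm,
      hsymm (frame e q (EuclideanSpace.single α 1)), g.symm]
  · rw [hD]
    exact (hfr (WithLp.toLp 2 w)).symm ▸ hmem _
  · rw [hD] at hw
    have h1 : projK g K (e.symm q) (frame e q w) = frame e q w := by
      exact Submodule.projection_apply_of_mem_left _ hw
    have h2 := he.frame_injective hq ((hfr w).trans h1)
    exact congrArg WithLp.ofLp h2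

end IsSmoothChart

/-! ### The cofactor pair of a driven cofactor system -/

theorem dirVec_dotProduct_eq_sum (Q : Coord ι → ι → ℝ) (q : Coord ι) (x y : ι → ℝ) :
    dirVec Q q x ⬝ᵥ y = ∑ α, ∑ β, pd (fun z => Q z β) q α * x α * y β := by
  simp only [dirVec, dotProduct, dir_eq_sum, Finset.sum_mul]
  rw [Finset.sum_comm]

namespace IsDrivenCofactorSystem

variable {n : ℕ} {g : RiemMetric ι M} {μ : ∀ x : M, TangentSpace 𝓘(ℝ, Coord ι) x →L[ℝ] ℝ}
  {J : ∀ x : M, TangentSpace 𝓘(ℝ, Coord ι) x →L[ℝ] TangentSpace 𝓘(ℝ, Coord ι) x}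
  {K : ∀ x : M, TangentSpace 𝓘(ℝ, Coord ι) x → Submodule ℝ (TangentSpace 𝓘(ℝ, Coord ι) x)}

theorem exists_proj (h : IsDrivenCofactorSystem n g μ J K) (he : IsSmoothChart e) :
    ∃ R : Coord ι → Matrix ι ι ℝ, ∀ q ∈ e.target,
      (∀ v, IsOrthProj (compMetric e g q) (R q) (compDist e K q v)) ∧ SmoothMat R q ∧
        ∃ (A : Matrix ι (Fin n) ℝ) (B : Matrix (Fin n) ι ℝ), R q = A * B := by
  obtain ⟨R, hR⟩ := IsSmoothDistribution.exists_proj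
    (fun _ hq => he.smoothMat_compMetric hq g) (fun _ hq => he.posDef_compMetric hq g)
    (h.smooth_dist e he)
  refine ⟨fun q => R (q, 0), fun q hq => ⟨fun v => ?_, ?_, (hR (q, 0) hq).2.2⟩⟩
  · beta_reduce
    rw [← proj_const_of_vertical e.open_target (fun _ hq => he.posDef_compMetric hq g)
      (fun z hz => (hR z hz).1) (fun z hz => (hR z hz).2.1) (h.vert_mem e he) hq v]
    exact (hR (q, v) hq).1
  · exact SmoothMat.comp (f := fun q => (q, 0)) (hR (q, 0) hq).2.1
      (contDiffAt_id.prodMk contDiffAt_const)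

/-- By uniqueness of orthogonal projections the one defined pointwise from `K` at zero velocity is
the smooth local one, and inherits its smoothness, its rank bound and its range at every velocity.
-/
theorem proj_spec (h : IsDrivenCofactorSystem n g μ J K) (he : IsSmoothChart e) {q : Coord ι}
    (hq : q ∈ e.target) :
    (∀ v, IsOrthProj (compMetric e g q) (compEnd e (projK g K) q) (compDist e K q v)) ∧
      SmoothMat (compEnd e (projK g K)) q ∧
        ∃ (A : Matrix ι (Fin n) ℝ) (B : Matrix (Fin n) ι ℝ),
          compEnd e (projK g K) q = A * B := by
  obtain ⟨R, hR⟩ := h.exists_proj he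
  have heq : ∀ x ∈ e.target, compEnd e (projK g K) x = R x := fun x hx =>
    (he.isOrthProj_compEnd_projK hx g K).unique ((hR x hx).1 0)
      (isSymm_of_posDef (he.posDef_compMetric hx g)) (he.posDef_compMetric hx g).det_pos.ne'
  rw [heq q hq]
  refine ⟨(hR q hq).1, (hR q hq).2.1.congr ?_, (hR q hq).2.2⟩
  filter_upwards [e.open_target.mem_nhds hq] with x hx using heq x hx

/-- For each velocity the subspace is the fixed space of one and the same projection matrix. -/
theorem dist_const_of_chart (h : IsDrivenCofactorSystem n g μ J K) (he : IsSmoothChart e)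
    {q : Coord ι} (hq : q ∈ e.target) (v : TangentSpace 𝓘(ℝ, Coord ι) (e.symm q)) :
    K (e.symm q) v = K (e.symm q) 0 := by
  ext u
  have h1 := ((h.proj_spec he hq).1 (coframe e q v)).mem_iff (coframe e q u)
  rw [← ((h.proj_spec he hq).1 0).mem_iff, compDist, compDist, Submodule.mem_comap,
    Submodule.mem_comap, map_zero] at h1
  change frame e q (coframe e q u) ∈ _ ↔ frame e q (coframe e q u) ∈ _ at h1
  rwa [he.frame_coframe hq, he.frame_coframe hq] at h1

theorem dist_const (h : IsDrivenCofactorSystem n g μ J K) (x : M)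
    (v : TangentSpace 𝓘(ℝ, Coord ι) x) : K x v = K x 0 := by
  have he : IsSmoothChart (ι := ι) (chartAt (Coord ι) x) :=
    IsManifold.chart_mem_maximalAtlas x
  have hx := mem_chart_source (Coord ι) x
  revert v
  rw [← (chartAt (Coord ι) x).left_inv hx]
  exact h.dist_const_of_chart he ((chartAt (Coord ι) x).map_source hx)

theorem cov_proj (h : IsDrivenCofactorSystem n g μ J K) (he : IsSmoothChart e) {q : Coord ι}
    (hq : q ∈ e.target) (u : ι → ℝ) :
    cov (compMetric e g) (compEnd e (projK g K)) q u = 0 :=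
  cov_proj_eq_zero e.open_target (fun _ hq => he.posDef_compMetric hq g)
    (fun _ hq => he.smoothMat_compMetric hq g) (compForm e μ)
    (fun _ hq => (h.proj_spec he hq).1) (fun _ hq => (h.proj_spec he hq).2.1)
    (h.nabla_mem e he) hq u

theorem isSCKTAt_proj (h : IsDrivenCofactorSystem n g μ J K) (he : IsSmoothChart e)
    {q : Coord ι} (hq : q ∈ e.target) :
    IsSCKTAt (compMetric e g) (compEnd e (projK g K)) q 0 :=
  isSCKTAt_of_parallel e.open_target (fun _ hq => he.posDef_compMetric hq g)
    (fun _ hq => he.smoothMat_compMetric hq g) hq ((h.proj_spec he hq).1 0).self_adj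
    (h.proj_spec he hq).2.1 (h.cov_proj he hq)

theorem dirVec_form (h : IsDrivenCofactorSystem n g μ J K) (he : IsSmoothChart e)
    {q : Coord ι} (hq : q ∈ e.target) (x y : ι → ℝ) :
    dirVec (compForm e μ) q (compEnd e (projK g K) q *ᵥ y) ⬝ᵥ
        (x - compEnd e (projK g K) q *ᵥ x)
      = compForm e μ q ⬝ᵥ chr (compMetric e g) q (compEnd e (projK g K) q *ᵥ y) *ᵥ
        (x - compEnd e (projK g K) q *ᵥ x) :=
  dirVec_eq_of_jacobi (h.isSCKTAt_proj he hq) ((h.proj_spec he hq).1 0)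
    (fun α => (he.contDiffAt_compForm hq h.smooth_form α).differentiableAt (by simp))
    (h.jacobi_mem e he q hq 0) x y

theorem gaugedForm_proj (h : IsDrivenCofactorSystem n g μ J K) (he : IsSmoothChart e)
    {q : Coord ι} (hq : q ∈ e.target) (y x : ι → ℝ) :
    gaugedForm (compEnd e (projK g K)) (compForm e μ) 0 q y x = 0 := by
  refine gaugedForm_parallel_eq_zero (h.isSCKTAt_proj he hq) ((h.proj_spec he hq).1 0)
    (fun α => (he.contDiffAt_compForm hq h.smooth_form α).differentiableAt (by simp))
    (h.jacobi_mem e he q hq 0) (fun X hX Y hY => ?_) y x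
  have h1 := h.closed_on e he q hq 0 X hX Y hY
  simp only [sub_mul, Finset.sum_sub_distrib] at h1
  rw [← dirVec_dotProduct_eq_sum, sub_eq_zero] at h1
  rw [h1, dirVec_dotProduct_eq_sum, Finset.sum_comm]
  exact Finset.sum_congr rfl fun _ _ => Finset.sum_congr rfl fun _ _ => by ring

theorem exists_isParallelPair (h : IsDrivenCofactorSystem n g μ J K) (he : IsSmoothChart e) :
    ∃ c, IsParallelPair n e.target (compMetric e g) (compEnd e fun x => (J x).toLinearMap)
      (compEnd e (projK g K)) (compForm e μ) c := by
  obtain ⟨c, hc⟩ := isSCKTAt_of_isSCKT e.open_target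
    (fun _ hq => he.smoothMat_compMetric hq g) (fun _ hq => he.posDef_compMetric hq g)
    (fun q hq => he.smoothMat_compEnd hq g h.smooth_end) (h.sckt e he)
  refine ⟨c, e.open_target, hc, fun q hq => h.isSCKTAt_proj he hq,
    fun q hq => he.contDiffAt_compForm hq h.smooth_form,
    fun q hq => he.det_compEnd_ne_zero hq (h.nonsingular _),
    fun q hq => (h.proj_spec he hq).2.2, fun q hq y x => ?_,
    fun q hq => h.gaugedForm_proj he hq⟩
  -- By bilinearity it suffices to treat coordinate vectors, where the form has the components of
  -- D_J μ.
  rw [gaugedForm_eq_sum]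
  refine Finset.sum_eq_zero fun α _ => Finset.sum_eq_zero fun β _ => ?_
  rw [← gaugedDJ_eq_gaugedForm _ (hc q hq).dir_trace_eq, h.gauged_closed e he q hq]
  simp

theorem isSCKT_proj (h : IsDrivenCofactorSystem n g μ J K) (he : IsSmoothChart e) :
    IsSCKT e.target (compMetric e g) (compEnd e (projK g K)) := by
  refine ⟨fun q hq => ((h.proj_spec he hq).1 0).self_adj, 0, fun q hq α β γ => ?_⟩
  simp [covDeriv_eq_cov, h.cov_proj he hq]

theorem gaugedDJ_proj (h : IsDrivenCofactorSystem n g μ J K) (he : IsSmoothChart e)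
    {q : Coord ι} (hq : q ∈ e.target) (α β : ι) :
    gaugedDJ (compEnd e (projK g K)) (compForm e μ) q α β = 0 := by
  rw [gaugedDJ_eq_gaugedForm _ (h.isSCKTAt_proj he hq).dir_trace_eq, h.gaugedForm_proj he hq]

end IsDrivenCofactorSystem

end Chart

/-! ### Adapted coordinates -/

section AdaptedCoordinates

variable {m n : ℕ}

theorem join_inl (y : Coord (Fin m)) (x : Coord (Fin n)) (i : Fin m) :
    join y x (Sum.inl i) = y i := rfl

theorem join_mem_box {V : Set (Coord (Fin m))} {Ω : Set (Coord (Fin n))} {y : Coord (Fin m)}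
    {x : Coord (Fin n)} (hy : y ∈ V) (hx : x ∈ Ω) : join y x ∈ box V Ω :=
  ⟨y, hy, x, hx, rfl⟩

/-- The inclusion of the coordinate space of the `y^i`. -/
def leftL : Coord (Fin m) →L[ℝ] Coord (Idx m n) :=
  LinearMap.toContinuousLinearMap
    { toFun := fun y => join y 0
      map_add' := fun y z => by ext (i | a) <;> simp [join]
      map_smul' := fun c y => by ext (i | a) <;> simp [join] }

/-- The inclusion of the coordinate space of the `x^a`. -/
def rightL : Coord (Fin n) →L[ℝ] Coord (Idx m n) :=
  LinearMap.toContinuousLinearMap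
    { toFun := fun x => join 0 x
      map_add' := fun y z => by ext (i | a) <;> simp [join]
      map_smul' := fun c y => by ext (i | a) <;> simp [join] }

theorem hasFDerivAt_join_left (y : Coord (Fin m)) (x : Coord (Fin n)) :
    HasFDerivAt (fun z => join z x) (leftL : Coord (Fin m) →L[ℝ] Coord (Idx m n)) y := by
  have h : (fun z : Coord (Fin m) => join z x) = fun z => leftL z + join 0 x := by
    ext z (i | a) <;> simp [join, leftL]
  rw [h]
  exact leftL.hasFDerivAt.add_const _

theorem hasFDerivAt_join_right (y : Coord (Fin m)) (x : Coord (Fin n)) :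
    HasFDerivAt (fun z => join y z) (rightL : Coord (Fin n) →L[ℝ] Coord (Idx m n)) x := by
  have h : (fun z : Coord (Fin n) => join y z) = fun z => rightL z + join y 0 := by
    ext z (i | a) <;> simp [join, rightL]
  rw [h]
  exact rightL.hasFDerivAt.add_const _

theorem pd_join_left {F : Coord (Idx m n) → ℝ} {y : Coord (Fin m)} {x : Coord (Fin n)}
    (hF : DifferentiableAt ℝ F (join y x)) (i : Fin m) :
    pd (fun z => F (join z x)) y i = pd F (join y x) (Sum.inl i) := by
  have h := HasFDerivAt.comp (g := F) (f := fun z => join z x) y hF.hasFDerivAt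
    (hasFDerivAt_join_left y x)
  have h1 : (leftL (EuclideanSpace.single i 1) : Coord (Idx m n))
      = EuclideanSpace.single (Sum.inl i) 1 := by
    ext (j | a) <;> simp [join, leftL]
  change fderiv ℝ (F ∘ fun z => join z x) y _ = _
  rw [h.fderiv, ContinuousLinearMap.comp_apply, h1, pd]

theorem pd_join_right {F : Coord (Idx m n) → ℝ} {y : Coord (Fin m)} {x : Coord (Fin n)}
    (hF : DifferentiableAt ℝ F (join y x)) (a : Fin n) :
    pd (fun z => F (join y z)) x a = pd F (join y x) (Sum.inr a) := by
  have h := HasFDerivAt.comp (g := F) (f := fun z => join y z) x hF.hasFDerivAt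
    (hasFDerivAt_join_right y x)
  have h1 : (rightL (EuclideanSpace.single a 1) : Coord (Idx m n))
      = EuclideanSpace.single (Sum.inr a) 1 := by
    ext (j | a) <;> simp [join, rightL]
  change fderiv ℝ (F ∘ fun z => join y z) x _ = _
  rw [h.fderiv, ContinuousLinearMap.comp_apply, h1, pd]

/-- A function whose derivatives with respect to the `x^a` vanish depends on the `y^i` only. -/
theorem eq_of_pd_inr_eq_zero {F : Coord (Idx m n) → ℝ} {y : Coord (Fin m)}
    {Ω : Set (Coord (Fin n))} (hΩ : IsOpen Ω) (hΩc : IsPreconnected Ω)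
    (hF : ∀ x ∈ Ω, DifferentiableAt ℝ F (join y x))
    (h : ∀ x ∈ Ω, ∀ a, pd F (join y x) (Sum.inr a) = 0) {x x' : Coord (Fin n)} (hx : x ∈ Ω)
    (hx' : x' ∈ Ω) : F (join y x) = F (join y x') := by
  refine hΩ.is_const_of_fderiv_eq_zero (𝕜 := ℝ) (f := fun z => F (join y z)) hΩc
    (fun z hz => ?_) (fun z hz => ?_) hx hx'
  · exact (DifferentiableAt.comp (g := F) (f := fun z => join y z) z (hF z hz)
      (hasFDerivAt_join_right y z).differentiableAt).differentiableWithinAt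
  · ext u
    rw [clm_apply_eq_sum]
    refine Finset.sum_eq_zero fun a _ => ?_
    have h1 := pd_join_right (hF z hz) a
    rw [h z hz a, pd] at h1
    simp [h1]

/-- The structure of a parallel pair in coordinates adapted to the projection `P`. -/
structure IsAdaptedPair (V : Set (Coord (Fin m))) (Ω : Set (Coord (Fin n)))
    (G J P : Coord (Idx m n) → Matrix (Idx m n) (Idx m n) ℝ) (Q : Coord (Idx m n) → Idx m n → ℝ)
    (c : Coord (Idx m n) → Idx m n → ℝ) : Prop
    extends IsParallelPair n (box V Ω) G J P Q c where
  isOpen_left : IsOpen V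
  isOpen_right : IsOpen Ω
  isPreconnected_right : IsPreconnected Ω
  proj_eq : ∀ q ∈ box V Ω, P q = Matrix.fromBlocks 0 0 0 1
  form_eq : ∀ q ∈ box V Ω, ∀ i a, pd (fun x => Q x (Sum.inl i)) q (Sum.inr a)
    = Q q ⬝ᵥ chr G q (Pi.single (Sum.inr a) 1) *ᵥ Pi.single (Sum.inl i) 1

namespace IsAdaptedPair

variable {V : Set (Coord (Fin m))} {Ω : Set (Coord (Fin n))}
  {G J P : Coord (Idx m n) → Matrix (Idx m n) (Idx m n) ℝ} {Q : Coord (Idx m n) → Idx m n → ℝ}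
  {c : Coord (Idx m n) → Idx m n → ℝ} {q : Coord (Idx m n)}

theorem proj_eventuallyEq (h : IsAdaptedPair V Ω G J P Q c) (hq : q ∈ box V Ω) :
    P =ᶠ[𝓝 q] fun _ => Matrix.fromBlocks 0 0 0 1 := by
  filter_upwards [h.isOpen.mem_nhds hq] with x hx using h.proj_eq x hx

theorem pd_proj (h : IsAdaptedPair V Ω G J P Q c) (hq : q ∈ box V Ω) (α β γ : Idx m n) :
    pd (fun x => P x α β) q γ = 0 := by
  have : (fun x => P x α β) =ᶠ[𝓝 q]
      fun _ => (Matrix.fromBlocks 0 0 0 1 : Matrix (Idx m n) (Idx m n) ℝ) α β := by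
    filter_upwards [h.proj_eventuallyEq hq] with x hx
    rw [hx]
  rw [pd_congr this]
  simp [pd]

/-- In adapted coordinates P is constant, so ∇P = 0 reduces to a vanishing commutator with the
connection matrix. -/
theorem proj_chr (h : IsAdaptedPair V Ω G J P Q c) (hq : q ∈ box V Ω) (u : Idx m n → ℝ) :
    P q * chr G q u = chr G q u * P q := by
  have h1 := (h.parallel q hq).cov_eq u
  have h2 : dirMat P q u = 0 := by
    rw [dirMat_congr (h.proj_eventuallyEq hq) u, dirMat_const]
  rw [cov, h2] at h1
  simp at h1
  rw [neg_add_eq_zero] at h1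
  exact h1

theorem chr_inl_inr (h : IsAdaptedPair V Ω G J P Q c) (hq : q ∈ box V Ω) (u : Idx m n → ℝ)
    (i : Fin m) (a : Fin n) : chr G q u (Sum.inl i) (Sum.inr a) = 0 := by
  have := congrFun (congrFun (h.proj_chr hq u) (Sum.inl i)) (Sum.inr a)
  rw [h.proj_eq q hq] at this
  simpa [Matrix.mul_apply, Matrix.one_apply] using this.symm

theorem chr_inr_inl (h : IsAdaptedPair V Ω G J P Q c) (hq : q ∈ box V Ω) (u : Idx m n → ℝ)
    (i : Fin m) (a : Fin n) : chr G q u (Sum.inr a) (Sum.inl i) = 0 := by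
  have := congrFun (congrFun (h.proj_chr hq u) (Sum.inr a)) (Sum.inl i)
  rw [h.proj_eq q hq] at this
  simpa [Matrix.mul_apply, Matrix.one_apply] using this

/-- The commutator kills the symbols whose upper and first lower index are of different type;
symmetry in the lower indices then kills every symbol with lower indices of different type. -/
theorem chr_single_inl (h : IsAdaptedPair V Ω G J P Q c) (hq : q ∈ box V Ω) (i : Fin m)
    (α : Idx m n) (a : Fin n) : chr G q (Pi.single (Sum.inl i) 1) α (Sum.inr a) = 0 := by
  rcases α with j | b
  · exact h.chr_inl_inr hq _ _ _
  · have := congrFun (chr_mulVec_comm (h.parallel q hq).symm (Pi.single (Sum.inl i) 1)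
      (Pi.single (Sum.inr a) 1)) (Sum.inr b)
    simp only [Matrix.mulVec_single_one, Matrix.col_apply] at this
    rw [this, h.chr_inr_inl hq]

theorem chr_single_inr (h : IsAdaptedPair V Ω G J P Q c) (hq : q ∈ box V Ω) (a : Fin n)
    (α : Idx m n) (i : Fin m) : chr G q (Pi.single (Sum.inr a) 1) α (Sum.inl i) = 0 := by
  have := congrFun (chr_mulVec_comm (h.parallel q hq).symm (Pi.single (Sum.inr a) 1)
    (Pi.single (Sum.inl i) 1)) α
  simp only [Matrix.mulVec_single_one, Matrix.col_apply] at this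
  rw [this, h.chr_single_inl hq]

theorem inv_metric_inl_inr (h : IsAdaptedPair V Ω G J P Q c) (hq : q ∈ box V Ω) (i : Fin m)
    (a : Fin n) : (G q)⁻¹ (Sum.inl i) (Sum.inr a) = 0 := by
  have hp := h.parallel q hq
  have h1 : P q * (G q)⁻¹ = (G q)⁻¹ * (P q)ᵀ := by
    have h2 : (P q)ᵀ * G q = G q * P q := by
      have := hp.self_adj.eq
      rwa [Matrix.transpose_mul, hp.metric_symm] at this
    have hu := hp.det_ne.isUnit
    calc P q * (G q)⁻¹ = (G q)⁻¹ * (G q * P q) * (G q)⁻¹ := by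
          rw [← mul_assoc, Matrix.nonsing_inv_mul _ hu, one_mul]
      _ = _ := by
          rw [← h2, mul_assoc, mul_assoc, Matrix.mul_nonsing_inv _ hu, mul_one]
  have := congrFun (congrFun h1 (Sum.inl i)) (Sum.inr a)
  rw [h.proj_eq q hq] at this
  simpa [Matrix.mul_apply, Matrix.one_apply] using this.symm

/-- By ∇g⁻¹ = 0 the derivative along x^a involves only symbols with an upper y-index and a lower
x-index, and these all vanish. -/
theorem pd_inv_metric (h : IsAdaptedPair V Ω G J P Q c) (hq : q ∈ box V Ω) (i j : Fin m)
    (a : Fin n) : pd (fun x => (G x)⁻¹ (Sum.inl i) (Sum.inl j)) q (Sum.inr a) = 0 := by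
  have hp := h.parallel q hq
  have hz : ∀ k α, chr G q (Pi.single (Sum.inr a) 1) (Sum.inl k) α = 0 := by
    rintro k (l | b)
    · exact h.chr_single_inr hq _ _ _
    · exact h.chr_inl_inr hq _ _ _
  have := congrFun (congrFun (dirMat_metric_inv hp.symm hp.smooth_metric hp.det_ne
    (Pi.single (Sum.inr a) 1)) (Sum.inl i)) (Sum.inl j)
  rw [← dir_single]
  simpa [dirMat, Matrix.mul_apply, hz] using this

/-- The Jacobi condition equates this derivative with a contraction of Q with Christoffel symbols
having mixed lower indices, which are zero. -/
theorem pd_form (h : IsAdaptedPair V Ω G J P Q c) (hq : q ∈ box V Ω) (i : Fin m)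
    (a : Fin n) : pd (fun x => Q x (Sum.inl i)) q (Sum.inr a) = 0 := by
  rw [h.form_eq q hq, Matrix.mulVec_single_one]
  exact Finset.sum_eq_zero fun α _ => by
    rw [Matrix.col_apply, h.chr_single_inr hq, mul_zero]

variable {y : Coord (Fin m)} {x x' : Coord (Fin n)}

theorem inv_metric_eq (h : IsAdaptedPair V Ω G J P Q c) (hy : y ∈ V) (hx : x ∈ Ω)
    (hx' : x' ∈ Ω) (i j : Fin m) :
    (G (join y x))⁻¹ (Sum.inl i) (Sum.inl j) = (G (join y x'))⁻¹ (Sum.inl i) (Sum.inl j) :=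
  eq_of_pd_inr_eq_zero (F := fun q => (G q)⁻¹ (Sum.inl i) (Sum.inl j)) h.isOpen_right
    h.isPreconnected_right
    (fun _ hz => ((h.parallel _ (join_mem_box hy hz)).smooth_metric.inv
      (h.parallel _ (join_mem_box hy hz)).det_ne).diffMat _ _)
    (fun _ hz a => h.pd_inv_metric (join_mem_box hy hz) i j a) hx hx'

theorem pd_inv_metric_eq (h : IsAdaptedPair V Ω G J P Q c) (hy : y ∈ V) (hx : x ∈ Ω)
    (hx' : x' ∈ Ω) (i j k : Fin m) :
    pd (fun q => (G q)⁻¹ (Sum.inl i) (Sum.inl j)) (join y x) (Sum.inl k)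
      = pd (fun q => (G q)⁻¹ (Sum.inl i) (Sum.inl j)) (join y x') (Sum.inl k) := by
  have hd : ∀ z ∈ Ω, DifferentiableAt ℝ (fun q => (G q)⁻¹ (Sum.inl i) (Sum.inl j)) (join y z) :=
    fun z hz => ((h.parallel _ (join_mem_box hy hz)).smooth_metric.inv
      (h.parallel _ (join_mem_box hy hz)).det_ne).diffMat _ _
  rw [← pd_join_left (hd x hx), ← pd_join_left (hd x' hx')]
  refine pd_congr ?_ k
  filter_upwards [h.isOpen_left.mem_nhds hy] with z hz using h.inv_metric_eq hz hx hx' i j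

theorem form_eq_of_mem (h : IsAdaptedPair V Ω G J P Q c) (hy : y ∈ V) (hx : x ∈ Ω)
    (hx' : x' ∈ Ω) (i : Fin m) : Q (join y x) (Sum.inl i) = Q (join y x') (Sum.inl i) :=
  eq_of_pd_inr_eq_zero (F := fun q => Q q (Sum.inl i)) h.isOpen_right
    h.isPreconnected_right
    (fun _ hz => (h.smooth_form _ (join_mem_box hy hz) _).differentiableAt (by simp))
    (fun _ hz a => h.pd_form (join_mem_box hy hz) i a) hx hx'

theorem hatQ_inl (h : IsAdaptedPair V Ω G J P Q c) (hq : q ∈ box V Ω) (p : Coord (Idx m n))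
    (i : Fin m) :
    hatQ G q p (Sum.inl i) = ∑ j, (G q)⁻¹ (Sum.inl i) (Sum.inl j) * p (Sum.inl j) := by
  simp [hatQ, h.inv_metric_inl_inr hq]

/-- The connection term is rewritten as -½ ∂_i g^{jk} p_j p_k: this block of the inverse metric is
known to depend on y only. -/
theorem hatP_inl (h : IsAdaptedPair V Ω G J P Q c) (hq : q ∈ box V Ω) (p : Coord (Idx m n))
    (i : Fin m) :
    hatP G Q q p (Sum.inl i)
      = -(1 / 2) * (∑ j, ∑ k, p (Sum.inl j) * (pd (fun x => (G x)⁻¹ (Sum.inl j) (Sum.inl k)) q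
          (Sum.inl i) * p (Sum.inl k))) + Q q (Sum.inl i) := by
  have hp := h.parallel q hq
  set u : Idx m n → ℝ := Pi.single (Sum.inl i) 1 with hu
  have hD := dirMat_metric_inv hp.symm hp.smooth_metric hp.det_ne u
  -- The two connection terms of the derivative of g⁻¹ are transposes of each other and so agree as
  -- quadratic forms in p.
  have hq' : p.ofLp ⬝ᵥ chr G q u *ᵥ ((G q)⁻¹ *ᵥ p.ofLp)
      = -(1 / 2) * (p.ofLp ⬝ᵥ dirMat (fun x => (G x)⁻¹) q u *ᵥ p.ofLp) := by
    have h1 : p.ofLp ⬝ᵥ (chr G q u * (G q)⁻¹) *ᵥ p.ofLp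
        = p.ofLp ⬝ᵥ ((G q)⁻¹ * (chr G q u)ᵀ) *ᵥ p.ofLp := by
      rw [dot_mulVec, Matrix.transpose_mul, hp.inv_symm, dotProduct_comm]
    have h2 : dirMat (fun x => (G x)⁻¹) q u
      = -(chr G q u * (G q)⁻¹) - (G q)⁻¹ * (chr G q u)ᵀ := hD
    rw [h2, Matrix.sub_mulVec, Matrix.neg_mulVec, dotProduct_sub, dotProduct_neg, ← h1,
      Matrix.mulVec_mulVec]
    ring
  have hz : ∀ (a : Fin n) α, chr G q u (Sum.inr a) α = 0 := by
    rintro a (l | b)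
    · exact h.chr_inr_inl hq _ _ _
    · exact h.chr_single_inl hq _ _ _
  have hz1 : ∀ α (a : Fin n), chr G q u α (Sum.inr a) = 0 := fun α a =>
    h.chr_single_inl hq _ _ _
  have e1 : ∀ a b, dirMat (fun x => (G x)⁻¹) q u (Sum.inr a) (Sum.inr b) = 0 := fun a b => by
    have := congrFun (congrFun hD (Sum.inr a)) (Sum.inr b)
    simpa [Matrix.mul_apply, hz] using this
  have e2 : ∀ j a, dirMat (fun x => (G x)⁻¹) q u (Sum.inl j) (Sum.inr a) = 0 := fun j a => by
    have := congrFun (congrFun hD (Sum.inl j)) (Sum.inr a)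
    simpa [Matrix.mul_apply, hz, hz1, h.inv_metric_inl_inr hq] using this
  have e3 : ∀ j a, dirMat (fun x => (G x)⁻¹) q u (Sum.inr a) (Sum.inl j) = 0 := fun j a => by
    have hs : ∀ j, (G q)⁻¹ (Sum.inr a) (Sum.inl j) = (G q)⁻¹ (Sum.inl j) (Sum.inr a) := fun j =>
      congrFun (congrFun hp.inv_symm (Sum.inl j)) (Sum.inr a)
    have := congrFun (congrFun hD (Sum.inr a)) (Sum.inl j)
    simpa [Matrix.mul_apply, hz, hz1, h.inv_metric_inl_inr hq, hs] using this
  rw [hatP_eq hp.symm hp.det_ne, hq']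
  simp only [dotProduct, Matrix.mulVec, Fintype.sum_sum_type, e1, e2, e3, zero_mul,
    Finset.sum_const_zero, add_zero, mul_zero, Finset.mul_sum]
  rfl

/-- The equations of the driving system involve the driving variables only. -/
theorem hat_inl_eq (h : IsAdaptedPair V Ω G J P Q c) (hy : y ∈ V) (hx : x ∈ Ω)
    (hx' : x' ∈ Ω) (r : Coord (Fin m)) (s s' : Coord (Fin n)) (i : Fin m) :
    hatQ G (join y x) (join r s) (Sum.inl i) = hatQ G (join y x') (join r s') (Sum.inl i) ∧
      hatP G Q (join y x) (join r s) (Sum.inl i)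
        = hatP G Q (join y x') (join r s') (Sum.inl i) := by
  have hq := join_mem_box hy hx
  have hq' := join_mem_box hy hx'
  constructor
  · rw [h.hatQ_inl hq, h.hatQ_inl hq']
    exact Finset.sum_congr rfl fun j _ => by
      rw [h.inv_metric_eq hy hx hx', join_inl, join_inl]
  · rw [h.hatP_inl hq, h.hatP_inl hq', h.form_eq_of_mem hy hx hx']
    simp only [join_inl, h.pd_inv_metric_eq hy hx hx']

theorem poissonQ_proj (h : IsAdaptedPair V Ω G J P Q c) (hq : q ∈ box V Ω)
    (F : Coord (Idx m n) → Coord (Idx m n) → ℝ) (p : Coord (Idx m n)) :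
    (∀ i, poissonQ P F q p (Sum.inl i) = 0) ∧
      ∀ a, poissonQ P F q p (Sum.inr a) = pd (fun s => F q s) p (Sum.inr a) := by
  simp [poissonQ, h.proj_eq q hq, Matrix.one_apply]

theorem poissonP_proj (h : IsAdaptedPair V Ω G J P Q c) (hq : q ∈ box V Ω)
    (F : Coord (Idx m n) → Coord (Idx m n) → ℝ) (p : Coord (Idx m n)) :
    (∀ i, poissonP P F q p (Sum.inl i) = 0) ∧
      ∀ a, poissonP P F q p (Sum.inr a) = -pd (fun x => F x p) q (Sum.inr a) := by
  simp [poissonP, h.proj_eq q hq, h.pd_proj hq, Matrix.one_apply]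

/-- With constant P = diag(0, 1) the term containing derivatives of P drops out and only the
derivatives in x^a and p_a remain. -/
theorem bracket_proj_eq (h : IsAdaptedPair V Ω G J P Q c) (hy : y ∈ V) (hx : x ∈ Ω)
    {F H : Coord (Idx m n) → Coord (Idx m n) → ℝ} {r : Coord (Fin m)} {s : Coord (Fin n)}
    (hF : DiffAt₂ F (join y x) (join r s)) (hH : DiffAt₂ H (join y x) (join r s)) :
    bracket (fun _ => (1 : Matrix (Fin n) (Fin n) ℝ)) (fun x s => F (join y x) (join r s))
      (fun x s => H (join y x) (join r s)) x s = bracket P F H (join y x) (join r s) := by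
  have hq := join_mem_box hy hx
  have hl : ∀ {F : Coord (Idx m n) → Coord (Idx m n) → ℝ}, DiffAt₂ F (join y x) (join r s) →
      ∀ a, pd (fun z => F (join y z) (join r s)) x a
        = pd (fun z => F z (join r s)) (join y x) (Sum.inr a) := fun hF a =>
    pd_join_right (F := fun z => _) hF.hasFDerivAt_left.differentiableAt a
  have hr : ∀ {F : Coord (Idx m n) → Coord (Idx m n) → ℝ}, DiffAt₂ F (join y x) (join r s) →
      ∀ a, pd (fun z => F (join y x) (join r z)) s a
        = pd (fun z => F (join y x) z) (join r s) (Sum.inr a) := fun hF a =>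
    pd_join_right (F := fun z => _) hF.hasFDerivAt_right.differentiableAt a
  have h0 : ∀ α β γ : Fin n, pd (fun _ : Coord (Fin n) => (1 : Matrix (Fin n) (Fin n) ℝ) α β) x γ
      = 0 := fun α β γ => by simp [pd]
  rw [bracket, bracket, alongField, alongField]
  simp only [Fintype.sum_sum_type, (h.poissonQ_proj hq F _).1, (h.poissonQ_proj hq F _).2,
    (h.poissonP_proj hq F _).1, (h.poissonP_proj hq F _).2, zero_mul, Finset.sum_const_zero,
    zero_add]
  simp only [poissonQ, poissonP, h0, hl hF, hl hH, hr hF, hr hH]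
  simp [Matrix.one_apply]

variable {W : Fin (n + 1) → Coord (Idx m n) → ℝ}

/-- The last of the quadratic functions depends on the driving variables only. -/
theorem quadFun_last_eq (h : IsAdaptedPair V Ω G J P Q c)
    (hW : IsPotentialFamily J P Q (box V Ω) W) (hy : y ∈ V) (hx : x ∈ Ω) (hx' : x' ∈ Ω)
    (r : Coord (Fin m)) (s s' : Coord (Fin n)) :
    quadFun G J P (Fin.last n : Fin (n + 1)) (W (Fin.last n)) (join y x) (join r s)
      = quadFun G J P (Fin.last n : Fin (n + 1)) (W (Fin.last n)) (join y x') (join r s') := by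
  have hF := fun z (hz : z ∈ Ω) p =>
    h.diffAt₂_quadFun hW (join_mem_box hy hz) p (Fin.last n)
  have hlast := fun z (hz : z ∈ Ω) p (a : Fin n) =>
    h.poisson_last hW (join_mem_box hy hz) p (Sum.inr a)
  -- The components of P_P(dH) are the p_a-derivatives and the negative x^a-derivatives of H, and
  -- all vanish for the top function. The point is moved from x to x' first, then the momentum from
  -- s to s'.
  have h1 := eq_of_pd_inr_eq_zero
    (F := fun q => quadFun G J P (Fin.last n : Fin (n + 1)) (W (Fin.last n)) q (join r s))
    h.isOpen_right h.isPreconnected_right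
    (fun z hz => (hF z hz (join r s)).hasFDerivAt_left.differentiableAt)
    (fun z hz a => by
      have := (hlast z hz (join r s) a).2
      rw [(h.poissonP_proj (join_mem_box hy hz) _ _).2, neg_eq_zero] at this
      exact this) hx hx'
  have h2 := eq_of_pd_inr_eq_zero (y := r)
    (F := fun p => quadFun G J P (Fin.last n : Fin (n + 1)) (W (Fin.last n)) (join y x') p)
    isOpen_univ isPreconnected_univ
    (fun z _ => (hF x' hx' (join r z)).hasFDerivAt_right.differentiableAt)
    (fun z _ a => by
      have := (hlast x' hx' (join r z) a).1
      rw [(h.poissonQ_proj (join_mem_box hy hx') _ _).2] at this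
      exact this) (Set.mem_univ s) (Set.mem_univ s')
  exact h1.trans h2

/-- The quadratic functions are constant along solutions of the full system, composed of solutions
of the driving and the driven system. -/
theorem quadFun_const (h : IsAdaptedPair V Ω G J P Q c)
    (hW : IsPotentialFamily J P Q (box V Ω) W) {T : Set ℝ} (hT : IsOpen T)
    (hTc : T.OrdConnected) {y r : ℝ → Coord (Fin m)} {x s : ℝ → Coord (Fin n)}
    (hd : IsDrivingSolution (hatQ G) (hatP G Q) V Ω T y r)
    (hs : IsDrivenSolution (hatQ G) (hatP G Q) Ω T y r x s) (k : Fin (n + 1)) {t t' : ℝ}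
    (ht : t ∈ T) (ht' : t' ∈ T) :
    quadFun G J P k (W k) (join (y t) (x t)) (join (r t) (s t))
      = quadFun G J P k (W k) (join (y t') (x t')) (join (r t') (s t')) := by
  have hder : ∀ t ∈ T, HasDerivAt (fun u => quadFun G J P k (W k) (join (y u) (x u))
      (join (r u) (s u))) 0 t := fun t ht => by
    obtain ⟨hy, hd'⟩ := hd t ht
    obtain ⟨hx, hs'⟩ := hs t ht
    have hq := join_mem_box hy hx
    -- The driving equations hold for all values of (x, s), in particular along the driven solution;
    -- the two solutions together form an integral curve of Γ̂.
    have h1 := (h.diffAt₂_quadFun hW hq (join (r t) (s t)) k).hasDerivAt_comp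
      (x := fun u => join (y u) (x u)) (s := fun u => join (r u) (s u)) (t := t)
      (u := hatQ G (join (y t) (x t)) (join (r t) (s t)))
      (w := hatP G Q (join (y t) (x t)) (join (r t) (s t)))
      (by
        rintro (i | a)
        · exact (hd' _ hx (s t) i).1
        · exact (hs' a).1)
      (by
        rintro (i | a)
        · exact (hd' _ hx (s t) i).2
        · exact (hs' a).2)
    rwa [(h.integrals_and_involution hW hq _).1 k] at h1
  exact hT.is_const_of_deriv_eq_zero hTc.isPreconnected
    (fun t ht => (hder t ht).differentiableAt.differentiableWithinAt)
    (fun t ht => (hder t ht).deriv) ht ht'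

end IsAdaptedPair

end AdaptedCoordinates

/-! ### Adapted charts -/

namespace IsAdapted

variable {m n : ℕ} {M : Type*} [TopologicalSpace M] [ChartedSpace (Coord (Idx m n)) M]
  [IsManifold 𝓘(ℝ, Coord (Idx m n)) ∞ M] {g : RiemMetric (Idx m n) M}
  {K : ∀ x : M, TangentSpace 𝓘(ℝ, Coord (Idx m n)) x →
    Submodule ℝ (TangentSpace 𝓘(ℝ, Coord (Idx m n)) x)}
  {e : OpenPartialHomeomorph M (Coord (Idx m n))}

/-- The projection annihilates the ∂/∂y^i, which lie in K^⊥, and fixes the ∂/∂x^a, which lie in K.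
-/
theorem compEnd_projK (h : IsAdapted g K e) (he : IsSmoothChart e) {q : Coord (Idx m n)}
    (hq : q ∈ e.target) : compEnd e (projK g K) q = Matrix.fromBlocks 0 0 0 1 := by
  have hfr := he.frame_compEnd hq (projK g K)
  have hker : ∀ i : Fin m, compEnd e (projK g K) q *ᵥ Pi.single (Sum.inl i) 1 = 0 := fun i => by
    have hw : (EuclideanSpace.single (Sum.inl i) 1 : Coord (Idx m n))
        ∈ compDist e (fun x w => perp g x (K x w)) q 0 := by
      rw [(h q hq 0).2]
      exact Submodule.subset_span ⟨i, rfl⟩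
    rw [compDist, Submodule.mem_comap, map_zero] at hw
    have h1 : projK g K (e.symm q) (frame e q (EuclideanSpace.single (Sum.inl i) 1)) = 0 :=
      (Submodule.projection_apply_eq_zero_iff _).mpr hw
    have h2 := he.frame_injective hq ((hfr _).trans (h1.trans (map_zero (frame e q)).symm))
    exact congrArg WithLp.ofLp h2
  have hid : ∀ a : Fin n, compEnd e (projK g K) q *ᵥ Pi.single (Sum.inr a) 1
      = Pi.single (Sum.inr a) 1 := fun a => by
    refine (he.isOrthProj_compEnd_projK hq g K).eq_self (EuclideanSpace.single (Sum.inr a) 1) ?_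
    rw [(h q hq 0).1]
    exact Submodule.subset_span ⟨a, rfl⟩
  apply Matrix.ext_of_mulVec_single
  rintro (i | a)
  · rw [hker]
    ext (j | b) <;> simp
  · rw [hid]
    ext (j | b) <;> simp [Pi.single_apply, Matrix.one_apply]

theorem isAdaptedPair {μ : ∀ x : M, TangentSpace 𝓘(ℝ, Coord (Idx m n)) x →L[ℝ] ℝ}
    {J : ∀ x : M, TangentSpace 𝓘(ℝ, Coord (Idx m n)) x →L[ℝ]
      TangentSpace 𝓘(ℝ, Coord (Idx m n)) x} (h : IsAdapted g K e)
    (hsys : IsDrivenCofactorSystem n g μ J K) (he : IsSmoothChart e)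
    {c : Coord (Idx m n) → Idx m n → ℝ} {V : Set (Coord (Fin m))} {Ω : Set (Coord (Fin n))}
    (hV : IsOpen V) (hΩ : IsOpen Ω) (hΩc : IsPreconnected Ω) (hsub : box V Ω ⊆ e.target)
    (hpair : IsParallelPair n (box V Ω) (compMetric e g) (compEnd e fun x => (J x).toLinearMap)
      (compEnd e (projK g K)) (compForm e μ) c) :
    IsAdaptedPair V Ω (compMetric e g) (compEnd e fun x => (J x).toLinearMap)
      (compEnd e (projK g K)) (compForm e μ) c := by
  refine ⟨hpair, hV, hΩ, hΩc, fun q hq => h.compEnd_projK he (hsub hq), fun q hq i a => ?_⟩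
  -- The Jacobi condition for ∂_a in K and ∂_i in K^⊥ is the field `form_eq`.
  have h1 := hsys.dirVec_form he (hsub hq) (Pi.single (Sum.inl i) 1) (Pi.single (Sum.inr a) 1)
  have e1 : (Matrix.fromBlocks 0 0 0 1 : Matrix (Idx m n) (Idx m n) ℝ)
      *ᵥ Pi.single (Sum.inr a) 1 = Pi.single (Sum.inr a) 1 := by
    ext (j | b) <;> simp [Pi.single_apply, Matrix.one_apply]
  have e2 : (Matrix.fromBlocks 0 0 0 1 : Matrix (Idx m n) (Idx m n) ℝ)
      *ᵥ Pi.single (Sum.inl i) 1 = 0 := by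
    ext (j | b) <;> simp
  rw [h.compEnd_projK he (hsub hq), e1, e2, sub_zero, dotProduct_single, mul_one] at h1
  exact h1

end IsAdapted

end DrivenCofactor

end

/-! ### The main theorem -/

theorem mainTheorem7 {m n : ℕ} {M : Type*} [TopologicalSpace M]
    [ChartedSpace (Coord (Idx m n)) M] [IsManifold 𝓘(ℝ, Coord (Idx m n)) ∞ M]
    (g : RiemMetric (Idx m n) M)
    (μ : ∀ x : M, TangentSpace 𝓘(ℝ, Coord (Idx m n)) x →L[ℝ] ℝ)
    (J : ∀ x : M, TangentSpace 𝓘(ℝ, Coord (Idx m n)) x →L[ℝ]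
      TangentSpace 𝓘(ℝ, Coord (Idx m n)) x)
    (K : ∀ x : M, TangentSpace 𝓘(ℝ, Coord (Idx m n)) x →
      Submodule ℝ (TangentSpace 𝓘(ℝ, Coord (Idx m n)) x))
    (hsys : IsDrivenCofactorSystem n g μ J K) :
    -- `K` is spanned by a distribution on `M`
    (∀ x v, K x v = K x 0) ∧
    ∀ e : OpenPartialHomeomorph M (Coord (Idx m n)), IsSmoothChart e →
      ∀ (G Jc Pc : Coord (Idx m n) → Matrix (Idx m n) (Idx m n) ℝ)
        (Q : Coord (Idx m n) → Idx m n → ℝ),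
        G = compMetric e g → Jc = compEnd e (fun x => (J x).toLinearMap) →
        Pc = compEnd e (projK g K) → Q = compForm e μ →
        -- `(J, P₂)` is a cofactor pair
        (IsSCKT e.target G Pc ∧ ∀ q ∈ e.target, ∀ α β, gaugedDJ Pc Q q α β = 0) ∧
        -- the cofactor tensor of `J + a P₂` is a polynomial of degree at most `n` in `a`
        (∀ q ∈ e.target, ∀ a : ℝ, (Jc q + a • Pc q).adjugate
          = ∑ k : Fin (n + 1), a ^ (k : ℕ) • cofCoeff (Jc q) (Pc q) k) ∧
        -- the functions `W_(i)` exist locally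
        (∀ O ⊆ e.target, IsOpen O → Convex ℝ O →
          ∃ W : Fin (n + 1) → Coord (Idx m n) → ℝ, IsPotentialFamily Jc Pc Q O W) ∧
        ∀ O ⊆ e.target, IsOpen O → ∀ W : Fin (n + 1) → Coord (Idx m n) → ℝ,
          IsPotentialFamily Jc Pc Q O W →
          ∀ H : Fin (n + 1) → Coord (Idx m n) → Coord (Idx m n) → ℝ,
            (∀ k, H k = quadFun G Jc Pc k (W k)) →
            -- `det (J + a P₂) Γ̂ = P_{J + a P₂} (dH(a))` with `H(a) = ∑ H_(i) a ^ (i - 1)`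
            (∀ a : ℝ, ∀ q ∈ O, ∀ p, ∀ α,
              (Jc q + a • Pc q).det * hatQ G q p α
                = poissonQ (fun x => Jc x + a • Pc x)
                    (fun x s => ∑ k : Fin (n + 1), a ^ (k : ℕ) * H k x s) q p α ∧
              (Jc q + a • Pc q).det * hatP G Q q p α
                = poissonP (fun x => Jc x + a • Pc x)
                    (fun x s => ∑ k : Fin (n + 1), a ^ (k : ℕ) * H k x s) q p α) ∧
            -- the `H_(i)` are first integrals of `Γ̂`
            (∀ k, ∀ q ∈ O, ∀ p, alongField (hatQ G q p) (hatP G Q q p) (H k) q p = 0) ∧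
            -- they are in involution with respect to both brackets
            (∀ k l, ∀ q ∈ O, ∀ p, bracket Jc (H k) (H l) q p = 0) ∧
            (∀ k l, ∀ q ∈ O, ∀ p, bracket Pc (H k) (H l) q p = 0) ∧
            -- adapted coordinates
            (IsAdapted g K e → ∀ (V : Set (Coord (Fin m))) (Ω : Set (Coord (Fin n))),
              IsOpen V → IsOpen Ω → IsPreconnected Ω → O = box V Ω →
              -- the driving equations involve the driving variables only
              (∀ y ∈ V, ∀ x ∈ Ω, ∀ x' ∈ Ω, ∀ r s s', ∀ i : Fin m,
                hatQ G (join y x) (join r s) (Sum.inl i)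
                  = hatQ G (join y x') (join r s') (Sum.inl i) ∧
                hatP G Q (join y x) (join r s) (Sum.inl i)
                  = hatP G Q (join y x') (join r s') (Sum.inl i)) ∧
              -- so does the last of the functions `H_(i)`
              (∀ y ∈ V, ∀ x ∈ Ω, ∀ x' ∈ Ω, ∀ r s s',
                H (Fin.last n) (join y x) (join r s)
                  = H (Fin.last n) (join y x') (join r s')) ∧
              ∀ T : Set ℝ, IsOpen T → T.OrdConnected → ∀ y r : ℝ → Coord (Fin m),
                IsDrivingSolution (hatQ G) (hatP G Q) V Ω T y r →
                -- the other `n` functions are integrals of the driven system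
                (∀ x s : ℝ → Coord (Fin n),
                  IsDrivenSolution (hatQ G) (hatP G Q) Ω T y r x s →
                  ∀ k : Fin n, ∀ t ∈ T, ∀ t' ∈ T,
                    H k.castSucc (join (y t) (x t)) (join (r t) (s t))
                      = H k.castSucc (join (y t') (x t')) (join (r t') (s t'))) ∧
                -- in involution with respect to the standard Poisson bracket in `(x^a, p_a)`
                ∀ k l : Fin n, ∀ t ∈ T, ∀ x ∈ Ω, ∀ s : Coord (Fin n),
                  bracket (fun _ => (1 : Matrix (Fin n) (Fin n) ℝ))
                    (fun x s => H k.castSucc (join (y t) x) (join (r t) s))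
                    (fun x s => H l.castSucc (join (y t) x) (join (r t) s)) x s = 0) := by
  refine ⟨hsys.dist_const, ?_⟩
  rintro e he _ _ _ _ rfl rfl rfl rfl
  obtain ⟨c, hpair⟩ := hsys.exists_isParallelPair he
  refine ⟨⟨hsys.isSCKT_proj he, fun q hq => hsys.gaugedDJ_proj he hq⟩,
    fun q hq a => hpair.adjugate_eq hq a,
    fun O hO hOo hOc => (hpair.mono hOo hO).exists_potentials hOc, ?_⟩
  intro O hO hOo W hW H hH
  obtain rfl : H = fun k : Fin (n + 1) => quadFun _ _ _ k (W k) := funext hH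
  -- The potentials exist on `O` only, so the pair is restricted from the chart domain.
  have hpO := hpair.mono hOo hO
  refine ⟨fun a q hq p α => hpO.det_mul_hat hW hq p a α,
    fun k q hq p => (hpO.integrals_and_involution hW hq p).1 k,
    fun k l q hq p => (hpO.integrals_and_involution hW hq p).2.1 k l,
    fun k l q hq p => (hpO.integrals_and_involution hW hq p).2.2 k l, ?_⟩
  rintro had V Ω hV hΩ hΩc rfl
  have hA := had.isAdaptedPair hsys he hV hΩ hΩc hO hpO
  refine ⟨fun y hy x hx x' hx' r s s' i => hA.hat_inl_eq hy hx hx' r s s' i,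
    fun y hy x hx x' hx' r s s' => hA.quadFun_last_eq hW hy hx hx' r s s', ?_⟩
  intro T hT hTc y r hd
  refine ⟨fun x s hs k t ht t' ht' => hA.quadFun_const hW hT hTc hd hs k.castSucc ht ht',
    fun k l t ht x hx s => ?_⟩
  have hq := join_mem_box (hd t ht).1 hx
  rw [hA.bracket_proj_eq (hd t ht).1 hx (hpO.diffAt₂_quadFun hW hq _ k.castSucc)
    (hpO.diffAt₂_quadFun hW hq _ l.castSucc)]
  exact (hpO.integrals_and_involution hW hq _).2.2 _ _
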